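/- **Conventions.** Orbifolds are effective, Hausdorff and paracompact. A chart of an $n$-dimensional smooth orbifold $N$ is a triple $(U,\Gamma,\varphi)$, where $U\subseteq\mathbb R^n$ is open and connected, $\Gamma$ is a finite group of diffeomorphisms of $U$, and $\varphi:U\to N$ induces a homeomorphism of $U/\Gamma$ onto an open subset. An oriented orbifold has an atlas of charts whose changes of charts are orientation-preserving local diffeomorphisms. $P_{\mathrm{GL}_+}N$ denotes its bundle of positively oriented frames, glued from the quotients $(U\times \mathrm{GL}_+(n))/\Gamma$ by the differentials of the changes of charts. For a (continuous) Riemannian metric $h$ on $N$, $P_{\mathrm{SO}}N\subseteq P_{\mathrm{GL}_+}N$ is the subspace of orthonormal frames. A *spin structure* on $(N,h)$ is a two-sheeted covering $P_{\mathrm{Spin}}N\to P_{\mathrm{SO}}N$ with a continuous right action of $\mathrm{Spin}(n)$ on $P_{\mathrm{Spin}}N$ that covers the action of $\mathrm{SO}(n)$ on $P_{\mathrm{SO}}N$, such that the pullback of $P_{\mathrm{Spin}}N$ to the oriented orthonormal frames of every chart domain $U$ is a principal $\mathrm{Spin}(n)$-bundle over $U$ (for $n=0$ just a two-sheeted covering,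 $\mathrm{Spin}(0)=\{\pm1\}$). Its *topological spin structure* $\widetilde P N\to P_{\mathrm{GL}_+}N$ is the two-sheeted covering of $P_{\mathrm{GL}_+}N$, compatible with the double covering group of $\mathrm{GL}_+(n)$, that restricts to $P_{\mathrm{Spin}}N\to P_{\mathrm{SO}}N$; it is unique up to isomorphism. An *$S^1$-principal orbifold bundle* is a map $f:M\to N$ from an $(n+1)$-dimensional orbifold $M$ with a continuous $S^1$-action to an $n$-dimensional orbifold $N$ such that every point of $N$ lies in $\varphi(U)$ for some chart $(U,\Gamma,\varphi)$ of $N$ with the following property: $\Gamma$ acts on $U\times S^1$ by smooth bundle automorphisms $\gamma(x,t)=(\gamma x,a_\gamma(x)t)$, and there is an $S^1$-equivariant isomorphism of orbifolds $(U\times S^1)/\Gamma\cong f^{-1}(\varphi(U))$ over $U/\Gamma\cong\varphi(U)$. A spin structure on $M$ is *projectable* if the $S^1$-action on $P_{\mathrm{GL}_+}M$ by differentials lifts to a continuous $S^1$-action on the topological spin structure $\widetilde PM$ by automorphisms. If $M$ and $N$ are oriented, call a positively oriented frame $(u,v_1,\dots,v_n)$ of $M$ *adapted* if $u$ is vertical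 and $(df\,v_1,\dots,df\,v_n)$ is a positively oriented frame of $N$; let $q:P_{\mathrm{ad}}M\to P_{\mathrm{GL}_+}N$ be the map sending an adapted frame to the latter frame. A projectable spin structure on $M$ and a spin structure on $N$ *induce each other* if, for some lift of the $S^1$-action to $\widetilde PM$, there is a continuous $S^1$-invariant map $\widetilde PM|_{P_{\mathrm{ad}}M}\to\widetilde PN$ over $q$ that is bijective on the two-point fibres of the coverings and equivariant with respect to $\mathrm{Spin}(n)\subset\mathrm{Spin}(n+1)$, i.e. if $\widetilde PM|_{P_{\mathrm{ad}}M}$ is $S^1$-equivariantly the pullback $q^*\widetilde PN$. **Proposition.** Let $f:M\to N$ be an $S^1$-principal orbifold bundle, where $M$ and $N$ are oriented orbifolds with arbitrary Riemannian metrics $g$ on $M$ and $h$ on $N$. 1. For every projectable spin structure on $(M,g)$ there is a spin structure on $(N,h)$ induced by it. 2. For every spin structure on $(N,h)$ there is a projectable spin structure on $(M,g)$ induced by it. -/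

import Mathlib

open Set Filter Topology
open scoped ContDiff

universe u

noncomputable section

/-- Euclidean space `ℝⁿ`. -/
abbrev Euc (n : ℕ) : Type := EuclideanSpace ℝ (Fin n)

/-! ## The spin groups -/

/-- The quadratic form `v ↦ ⟪v, v⟫` on `ℝⁿ`. -/
def eucForm (n : ℕ) : QuadraticForm ℝ (Euc n) :=
  LinearMap.BilinMap.toQuadraticMap (innerₗ (Euc n))

/-- The spin group `Spin(n)`, inside the Clifford algebra of `ℝⁿ`. -/
abbrev SpinGrp (n : ℕ) : Type := spinGroup (eucForm n)

/-- The canonical topology of the (finite-dimensional) Clifford algebra; `Spin(n)` carries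
the subspace topology. -/
instance eucCliffordTopology (n : ℕ) : TopologicalSpace (CliffordAlgebra (eucForm n)) :=
  moduleTopology ℝ (CliffordAlgebra (eucForm n))

/-- The group `GL₊(n)`, as linear endomorphisms of `ℝⁿ` of positive determinant. -/
abbrev GLPlus (n : ℕ) : Type := {R : Euc n →L[ℝ] Euc n // 0 < R.det}

/-- `R` is the image of `s` under the two-fold covering homomorphism
`Spin(n) → SO(n) ⊆ GL₊(n)`, `s ↦ (v ↦ s v s⁻¹)`. -/
def IsSpinImage {n : ℕ} (s : SpinGrp n) (R : GLPlus n) : Prop :=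
  ∀ v : Euc n, (s : CliffordAlgebra (eucForm n)) * CliffordAlgebra.ι (eucForm n) v
    = CliffordAlgebra.ι (eucForm n) (R.1 v) * (s : CliffordAlgebra (eucForm n))

/-- The inclusion `ℝⁿ → ℝⁿ⁺¹`, `v ↦ (0, v)`. -/
def eucIncl (n : ℕ) : Euc n →L[ℝ] Euc (n + 1) :=
  LinearMap.toContinuousLinearMap
    { toFun := fun v => WithLp.toLp 2 (Fin.cons 0 (fun i => v i))
      map_add' := by
        intro v w
        ext i
        refine Fin.cases ?_ (fun j => ?_) i <;> simp
      map_smul' := by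
        intro r v
        ext i
        refine Fin.cases ?_ (fun j => ?_) i <;> simp }

/-- The first standard basis vector of `ℝⁿ⁺¹`. -/
def eucFirst (n : ℕ) : Euc (n + 1) := EuclideanSpace.single 0 1

/-- The inclusion `v ↦ (0, v)` as an isometry of quadratic spaces. -/
def eucInclIsometry (n : ℕ) : eucForm n →qᵢ eucForm (n + 1) where
  toLinearMap := (eucIncl n).toLinearMap
  map_app' := by
    intro v
    simp [eucForm, eucIncl, EuclideanSpace.norm_sq_eq, Fin.sum_univ_succ]

/-- The algebra map of Clifford algebras induced by `v ↦ (0, v)`. -/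
def cliffordIncl (n : ℕ) :
    CliffordAlgebra (eucForm n) →ₐ[ℝ] CliffordAlgebra (eucForm (n + 1)) :=
  CliffordAlgebra.map (eucInclIsometry n)

theorem cliffordIncl_star (n : ℕ) (x : CliffordAlgebra (eucForm n)) :
    cliffordIncl n (star x) = star (cliffordIncl n x) := by
  induction x using CliffordAlgebra.induction with
  | algebraMap r => simp
  | ι v => simp [cliffordIncl]
  | mul a b ha hb => simp [ha, hb]
  | add a b ha hb => simp [ha, hb]

theorem cliffordIncl_mem_spinGroup (n : ℕ) (s : SpinGrp n) :
    cliffordIncl n s ∈ spinGroup (eucForm (n + 1)) := by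
  obtain ⟨s, ⟨⟨x, hx, rfl⟩, hu⟩, he⟩ := s
  refine ⟨⟨⟨Units.map (cliffordIncl n : _ →* _) x, ?_, rfl⟩, ?_⟩, ?_⟩
  · have h : lipschitzGroup (eucForm n) ≤
        (lipschitzGroup (eucForm (n + 1))).comap (Units.map (cliffordIncl n : _ →* _)) := by
      refine (Subgroup.closure_le _).2 ?_
      rintro y ⟨v, hv⟩
      refine Subgroup.subset_closure ⟨eucInclIsometry n v, ?_⟩
      simp [← hv, cliffordIncl]
    exact h hx
  · change (x : CliffordAlgebra (eucForm n)) ∈ unitary _ at hu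
    change cliffordIncl n (x : CliffordAlgebra (eucForm n)) ∈ unitary _
    rw [Unitary.mem_iff] at hu ⊢
    refine ⟨?_, ?_⟩
    · have := congrArg (cliffordIncl n) hu.1
      simpa [cliffordIncl_star] using this
    · have := congrArg (cliffordIncl n) hu.2
      simpa [cliffordIncl_star] using this
  · change (x : CliffordAlgebra (eucForm n)) ∈ CliffordAlgebra.evenOdd (eucForm n) 0 at he
    change cliffordIncl n (x : CliffordAlgebra (eucForm n))
      ∈ CliffordAlgebra.evenOdd (eucForm (n + 1)) 0
    refine CliffordAlgebra.even_induction (eucForm n)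
      (motive := fun y _ => cliffordIncl n y ∈ CliffordAlgebra.evenOdd (eucForm (n + 1)) 0)
      ?_ ?_ ?_ _ he
    · intro r
      rw [AlgHom.commutes]
      exact (CliffordAlgebra.even (eucForm (n + 1))).algebraMap_mem r
    · intro y z _ _ hy hz
      rw [map_add]
      exact add_mem hy hz
    · intro v w y _ hy
      have h := (CliffordAlgebra.even (eucForm (n + 1))).mul_mem
        (CliffordAlgebra.ι_mul_ι_mem_evenOdd_zero (eucForm (n + 1))
          (eucInclIsometry n v) (eucInclIsometry n w)) hy
      change _ ∈ CliffordAlgebra.even (eucForm (n + 1))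
      simpa [cliffordIncl] using h

/-- The inclusion `Spin(n) → Spin(n+1)` covering `SO(n) → SO(n+1)`, `A ↦ diag(1, A)`. -/
def spinIncl (n : ℕ) (s : SpinGrp n) : SpinGrp (n + 1) :=
  ⟨cliffordIncl n s, cliffordIncl_mem_spinGroup n s⟩

/-! ## Orbifolds -/

/-- An `n`-dimensional orbifold chart `(U, Γ, φ)` on a space `X`: a connected open subset `U` of
`ℝⁿ`, a finite group `Γ` of diffeomorphisms of `U` (so it acts effectively), and a map
`φ : U → X` that induces a homeomorphism from `U/Γ` onto an open subset of `X`.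
The values of `φ` outside `U` play no role. -/
structure OrbifoldChart (n : ℕ) (X : Type u) [TopologicalSpace X] : Type u where
  U : Set (Euc n)
  isOpen_U : IsOpen U
  isConnected_U : IsConnected U
  Γ : Subgroup (Equiv.Perm U)
  finite_Γ : Finite Γ
  smooth_Γ : ∀ γ ∈ Γ, ∃ g : Euc n → Euc n, ContDiffOn ℝ ∞ g U ∧ ∀ x : U, g x = (γ x : Euc n)
  φ : Euc n → X
  continuousOn_φ : ContinuousOn φ U
  isOpen_image_φ : ∀ V : Set (Euc n), V ⊆ U → IsOpen V → IsOpen (φ '' V)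
  φ_eq_iff : ∀ x y : U, φ x = φ y ↔ ∃ γ ∈ Γ, γ x = y

section Lifts

variable {X Y : Type u} [TopologicalSpace Y] {m : ℕ}
variable {E : Type} [NormedAddCommGroup E] [NormedSpace ℝ E]

/-- `ψ` is, near `x`, a smooth lift of the map `F : X → Y` with respect to the parametrization
`σ : E → X` of `X` and the chart `c` of `Y`: it is smooth, takes values in the domain of the
chart, and `c.φ ∘ ψ = F ∘ σ`. -/
def IsLocalLift (F : X → Y) (σ : E → X) (c : OrbifoldChart m Y) (ψ : E → Euc m) (x : E) : Prop :=
  ∀ᶠ z in 𝓝 x, ContDiffAt ℝ ∞ ψ z ∧ ψ z ∈ c.U ∧ c.φ (ψ z) = F (σ z)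

/-- The parametrization `σ`, defined on the open set `S`, and the chart `c` are compatible:
whenever `σ x = c.φ y`, there is a local diffeomorphism `ψ` with `ψ x = y` and
`c.φ ∘ ψ = σ` near `x`. -/
def IsCompatible (σ : E → Y) (S : Set E) (c : OrbifoldChart m Y) : Prop :=
  ∀ x ∈ S, ∀ y ∈ c.U, σ x = c.φ y →
    ∃ ψ : E → Euc m, IsLocalLift id σ c ψ x ∧ ψ x = y ∧ Function.Bijective (fderiv ℝ ψ x)

end Lifts

/-- An oriented (effective, smooth) `n`-dimensional orbifold structure on `X`: an atlas of
pairwise compatible orbifold charts that cover `X`, all of whose changes of charts preserve the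
orientation of `ℝⁿ`. -/
structure OrientedOrbifold (n : ℕ) (X : Type u) [TopologicalSpace X] : Type u where
  atlas : Set (OrbifoldChart n X)
  covers : ∀ p : X, ∃ c ∈ atlas, p ∈ c.φ '' c.U
  compatible : ∀ c ∈ atlas, ∀ c' ∈ atlas, IsCompatible c.φ c.U c'
  oriented : ∀ c ∈ atlas, ∀ c' ∈ atlas, ∀ x ∈ c.U, ∀ ψ : Euc n → Euc n,
    IsLocalLift id c.φ c' ψ x → Function.Bijective (fderiv ℝ ψ x) → 0 < (fderiv ℝ ψ x).det

namespace OrientedOrbifold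

variable {n : ℕ} {X : Type u} [TopologicalSpace X]

/-! ### Frame bundles -/

/-- A positively oriented frame in a chart: a chart `c` of the atlas, a point `x` of its domain
and a frame of `T_x U = ℝⁿ`, given by the isomorphism `A : ℝⁿ → T_x U` that sends the standard
basis to the frame. -/
def FrameRep (O : OrientedOrbifold n X) : Type u :=
  Σ c : O.atlas, {a : Euc n × (Euc n →L[ℝ] Euc n) // a.1 ∈ c.1.U ∧ 0 < a.2.det}

namespace FrameRep

variable {O : OrientedOrbifold n X}

instance : TopologicalSpace O.FrameRep :=
  inferInstanceAs (TopologicalSpace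
    (Σ c : O.atlas, {a : Euc n × (Euc n →L[ℝ] Euc n) // a.1 ∈ c.1.U ∧ 0 < a.2.det}))

/-- The chart of a frame in a chart. -/
def chart (a : O.FrameRep) : OrbifoldChart n X := a.1.1

/-- The foot point of a frame in a chart. -/
def pt (a : O.FrameRep) : Euc n := a.2.1.1

/-- The frame itself, as a linear map. -/
def frame (a : O.FrameRep) : Euc n →L[ℝ] Euc n := a.2.1.2

/-- The right action of `GL₊(n)` on frames in charts. -/
def rotate (a : O.FrameRep) (R : GLPlus n) : O.FrameRep :=
  ⟨a.1, ⟨(a.2.1.1, a.2.1.2.comp R.1), a.2.2.1, by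
    have h : (a.2.1.2.comp R.1).det = a.2.1.2.det * R.1.det :=
      LinearMap.det_comp (a.2.1.2 : Euc n →ₗ[ℝ] Euc n) (R.1 : Euc n →ₗ[ℝ] Euc n)
    rw [h]
    exact mul_pos a.2.2.2 R.2⟩⟩

/-- Two frames in charts represent the same frame of the orbifold if a change of charts
carries the one to the other. -/
def Rel (a b : O.FrameRep) : Prop :=
  ∃ ψ : Euc n → Euc n, IsLocalLift id a.chart.φ b.chart ψ a.pt ∧ ψ a.pt = b.pt ∧
    b.frame = (fderiv ℝ ψ a.pt).comp a.frame

theorem Rel.rotate {a b : O.FrameRep} (h : a.Rel b) (R : GLPlus n) :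
    (a.rotate R).Rel (b.rotate R) := by
  obtain ⟨ψ, h1, h2, h3⟩ := h
  refine ⟨ψ, h1, h2, ?_⟩
  change b.frame.comp R.1 = (fderiv ℝ ψ a.pt).comp (a.frame.comp R.1)
  rw [h3, ContinuousLinearMap.comp_assoc]

end FrameRep

/-- The bundle `P_{GL₊}(X)` of positively oriented frames of the orbifold, glued from the frames
in the charts, with the quotient topology. Over the domain `φ(U)` of a chart, it is the quotient
of `U × GL₊(n)` by `Γ`. -/
def FrameBundle (O : OrientedOrbifold n X) : Type u := Quot (FrameRep.Rel (O := O))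

instance (O : OrientedOrbifold n X) : TopologicalSpace O.FrameBundle :=
  inferInstanceAs (TopologicalSpace (Quot (FrameRep.Rel (O := O))))

/-- The frame of the orbifold represented by a frame in a chart. -/
def FrameRep.mk {O : OrientedOrbifold n X} (a : O.FrameRep) : O.FrameBundle := Quot.mk _ a

/-- The right action of `GL₊(n)` on the frame bundle. -/
def FrameBundle.rotate {O : OrientedOrbifold n X} (F : O.FrameBundle) (R : GLPlus n) :
    O.FrameBundle :=
  Quot.map (fun a : O.FrameRep => a.rotate R) (fun _ _ h => h.rotate R) F

/-- A Riemannian metric on the orbifold: inner products `g_c(x)` on the tangent spaces of the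
chart domains that depend continuously on the point and are invariant under changes of charts
(in particular under the groups of the charts). Only continuity is demanded; smooth and
`C^{1,α}` metrics are special cases. -/
structure Metric (O : OrientedOrbifold n X) : Type u where
  g : OrbifoldChart n X → Euc n → Euc n →L[ℝ] Euc n →L[ℝ] ℝ
  continuousOn : ∀ c ∈ O.atlas, ContinuousOn (g c) c.U
  symm : ∀ c ∈ O.atlas, ∀ x ∈ c.U, ∀ v w, g c x v w = g c x w v
  pos : ∀ c ∈ O.atlas, ∀ x ∈ c.U, ∀ v, v ≠ 0 → 0 < g c x v v
  invariant : ∀ c ∈ O.atlas, ∀ c' ∈ O.atlas, ∀ x ∈ c.U, ∀ ψ : Euc n → Euc n,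
    IsLocalLift id c.φ c' ψ x → Function.Bijective (fderiv ℝ ψ x) →
      ∀ v w, g c' (ψ x) (fderiv ℝ ψ x v) (fderiv ℝ ψ x w) = g c x v w

/-- The bundle `P_{SO}(X) ⊆ P_{GL₊}(X)` of positively oriented orthonormal frames. -/
def Metric.orthonormalFrames {O : OrientedOrbifold n X} (g : O.Metric) : Set O.FrameBundle :=
  {F | ∃ a : O.FrameRep, a.mk = F ∧
    ∀ v w : Euc n, g.g a.chart a.pt (a.frame v) (a.frame w) = inner ℝ v w}

/-! ### Spin structures -/

/-- A two-sheeted covering of a part `S` of the frame bundle, together with a continuous right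
action of `Spin(n)` on its total space that covers the action of `SO(n)` on frames and such that
the kernel `{±1}` of `Spin(n) → SO(n)` acts freely. As the frames in a chart domain `U` form a
principal bundle over `U`, the last condition says that `Spin(n)` acts freely on the pullback
`P_{Spin}(U)` of the covering to the frames of `U`; for orthonormal frames, `P_{Spin}(U)` is
thus a principal `Spin(n)`-bundle over `U`, which induces the covering over `φ(U)`. -/
structure SpinCover (O : OrientedOrbifold n X) (S : Set O.FrameBundle) : Type (u + 1) where
  P : Type u
  [top : TopologicalSpace P]
  proj : P → S
  isCoveringMap : IsCoveringMap proj
  two_sheeted : ∀ F : S, (proj ⁻¹' {F}).ncard = 2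
  act : P → SpinGrp n → P
  continuous_act : Continuous (fun q : P × SpinGrp n => act q.1 q.2)
  act_one : ∀ p, act p 1 = p
  act_mul : ∀ p s t, act p (s * t) = act (act p s) t
  equivariant : ∀ p s (R : GLPlus n), IsSpinImage s R →
    (proj (act p s) : O.FrameBundle) = (proj p : O.FrameBundle).rotate R
  free : ∀ p s, IsSpinImage s (⟨ContinuousLinearMap.id ℝ (Euc n), by
    change 0 < LinearMap.det (LinearMap.id : Euc n →ₗ[ℝ] Euc n); simp⟩ : GLPlus n) →
    act p s = p → s = 1

attribute [instance] SpinCover.top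

/-- A spin structure on an oriented Riemannian orbifold: `P_{Spin} → P_{SO}`. -/
abbrev SpinStructure (O : OrientedOrbifold n X) (g : O.Metric) : Type (u + 1) :=
  O.SpinCover g.orthonormalFrames

/-- A topological spin structure on an oriented orbifold: a two-sheeted covering of the bundle of
all positively oriented frames, compatible with the double covering group of `GL₊(n)`. That group
deformation retracts onto its subgroup `Spin(n)`, so by unique lifting an action of `Spin(n)` on
the covering extends uniquely to an action of the double covering group that covers the action of
`GL₊(n)` on frames; hence the compatibility is expressed by the action of `Spin(n)`. -/
abbrev TopSpinStructure (O : OrientedOrbifold n X) : Type (u + 1) :=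
  O.SpinCover Set.univ

/-- `Q` is the topological spin structure of the spin structure `P`: the restriction of `Q` to
the orthonormal frames is isomorphic to `P` (being injective, `j` is an isomorphism from `P`
onto this restriction, since both are two-sheeted coverings). -/
def Extends {O : OrientedOrbifold n X} {g : O.Metric} (Q : O.TopSpinStructure)
    (P : O.SpinStructure g) : Prop :=
  ∃ j : P.P → Q.P, Continuous j ∧ Function.Injective j ∧
    (∀ p, (Q.proj (j p) : O.FrameBundle) = (P.proj p : O.FrameBundle)) ∧
    ∀ p s, j (P.act p s) = Q.act (j p) s

/-! ### Circle actions and projectable spin structures -/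

/-- The differential of the homeomorphism `F` of the orbifold, computed through its local smooth
lifts, sends the frame `A` to the frame `B`. -/
def PushFrame (O : OrientedOrbifold n X) (F : X → X) (A B : O.FrameBundle) : Prop :=
  ∃ a b : O.FrameRep, a.mk = A ∧ b.mk = B ∧ ∃ ψ : Euc n → Euc n,
    IsLocalLift F a.chart.φ b.chart ψ a.pt ∧ ψ a.pt = b.pt ∧
    b.frame = (fderiv ℝ ψ a.pt).comp a.frame

/-- A lift of the circle action on the orbifold to a topological spin structure `Q`: a continuous
action of `S¹` on the total space of `Q` by automorphisms of `Q` that covers the action of `S¹`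
on frames by differentials. -/
structure CircleLift {O : OrientedOrbifold n X} [MulAction Circle X] (Q : O.TopSpinStructure) :
    Type u where
  κ : Circle → Q.P → Q.P
  continuous_κ : Continuous (fun q : Circle × Q.P => κ q.1 q.2)
  κ_one : ∀ p, κ 1 p = p
  κ_mul : ∀ s t p, κ (s * t) p = κ s (κ t p)
  κ_act : ∀ t p s, κ t (Q.act p s) = Q.act (κ t p) s
  covers : ∀ t p, O.PushFrame (fun x => t • x) (Q.proj p) (Q.proj (κ t p))

/-- A spin structure is projectable if the circle action lifts to its topological spin
structure. -/
def SpinStructure.IsProjectable {O : OrientedOrbifold n X} [MulAction Circle X] {g : O.Metric}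
    (P : O.SpinStructure g) : Prop :=
  ∃ Q : O.TopSpinStructure, Extends Q P ∧ Nonempty (CircleLift Q)

end OrientedOrbifold

/-! ## Principal circle orbibundles -/

section Bundles

variable {n : ℕ} {M N : Type u} [TopologicalSpace M] [TopologicalSpace N] [MulAction Circle M]

/-- A local trivialization of `f : M → N` over an orbifold chart `c = (U, Γ, φ)` of `N`: a map
`Φ : U × S¹ → M` and an action `γ (x, t) = (γ x, a_γ(x) t)` of `Γ` on `U × S¹` by smooth
bundle automorphisms such that `Φ` is `S¹`-equivariant, lies over `φ`, is compatible with the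
orbifold structure of `M`, and induces a bijection (thus an isomorphism of orbifolds) from
`(U × S¹)/Γ` onto `f⁻¹(φ(U))`. -/
structure OrbibundleTrivialization (OM : OrientedOrbifold (n + 1) M) (f : M → N)
    (c : OrbifoldChart n N) : Type u where
  Φ : Euc n → Circle → M
  a : Equiv.Perm c.U → Euc n → Circle
  smooth_a : ∀ γ ∈ c.Γ, ContDiffOn ℝ ∞ (fun x => (a γ x : ℂ)) c.U
  a_mul : ∀ γ ∈ c.Γ, ∀ δ ∈ c.Γ, ∀ x : c.U, a (γ * δ) x = a γ (δ x) * a δ x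
  equivariant : ∀ x ∈ c.U, ∀ s t : Circle, Φ x (s * t) = s • Φ x t
  lies_over : ∀ x ∈ c.U, ∀ t : Circle, f (Φ x t) = c.φ x
  surj : ∀ p : M, f p ∈ c.φ '' c.U → ∃ x ∈ c.U, ∃ t : Circle, Φ x t = p
  eq_iff : ∀ (x y : c.U) (t s : Circle),
    Φ x t = Φ y s ↔ ∃ γ ∈ c.Γ, γ x = y ∧ a γ x * t = s
  compatible : ∀ c' ∈ OM.atlas,
    IsCompatible (fun z : Euc n × ℝ => Φ z.1 (Circle.exp z.2)) (c.U ×ˢ Set.univ) c'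

/-- `f : M → N` is an `S¹`-principal orbifold bundle, for the given action of `S¹` on `M`:
around every point of `N` there is an orbifold chart, compatible with the atlas of `N`, over
which `f` has a local trivialization. -/
def IsCircleOrbibundle (OM : OrientedOrbifold (n + 1) M) (ON : OrientedOrbifold n N)
    (f : M → N) : Prop :=
  ∀ p : N, ∃ c : OrbifoldChart n N, p ∈ c.φ '' c.U ∧
    (∀ c' ∈ ON.atlas, IsCompatible c.φ c.U c') ∧ Nonempty (OrbibundleTrivialization OM f c)

/-- The frame `B = (u, v₁, …, vₙ)` of `M` is adapted and projects to the frame `A` of `N`: its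
first vector `u` is vertical, and the differential of `f` (computed through local smooth lifts)
sends `(v₁, …, vₙ)` to `A`. -/
def FrameProjects {OM : OrientedOrbifold (n + 1) M} {ON : OrientedOrbifold n N} (f : M → N)
    (B : OM.FrameBundle) (A : ON.FrameBundle) : Prop :=
  ∃ (b : OM.FrameRep) (a : ON.FrameRep), b.mk = B ∧ a.mk = A ∧ ∃ ψ : Euc (n + 1) → Euc n,
    IsLocalLift f b.chart.φ a.chart ψ b.pt ∧ ψ b.pt = a.pt ∧
    fderiv ℝ ψ b.pt (b.frame (eucFirst n)) = 0 ∧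
    ((fderiv ℝ ψ b.pt).comp b.frame).comp (eucIncl n) = a.frame

/-- The topological spin structure `Q` on `M` with the lift `κ` of the circle action and the
topological spin structure `Q'` on `N` correspond to each other: there is a continuous map `Φ`
from the part of `Q` over the adapted frames of `M` to `Q'` that lies over the projection of
adapted frames to frames of `N`, is bijective on the two-point fibres, invariant under `κ`, and
equivariant with respect to `Spin(n) ⊆ Spin(n+1)`. In other words, the part of `Q` over the
adapted frames is the pullback of `Q'` to the adapted frames, with its circle action. -/
def TopInduces {OM : OrientedOrbifold (n + 1) M} {ON : OrientedOrbifold n N} (f : M → N)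
    (Q : OM.TopSpinStructure) (κ : OrientedOrbifold.CircleLift Q) (Q' : ON.TopSpinStructure) :
    Prop :=
  ∃ Φ : {p : Q.P // ∃ A : ON.FrameBundle, FrameProjects f (Q.proj p : OM.FrameBundle) A} → Q'.P,
    Continuous Φ ∧
    (∀ p, FrameProjects f (Q.proj p.1 : OM.FrameBundle) (Q'.proj (Φ p) : ON.FrameBundle)) ∧
    (∀ p q, Q.proj p.1 = Q.proj q.1 → Φ p = Φ q → p = q) ∧
    (∀ p q (t : Circle), q.1 = κ.κ t p.1 → Φ q = Φ p) ∧
    (∀ p q (s : SpinGrp n), q.1 = Q.act p.1 (spinIncl n s) → Φ q = Q'.act (Φ p) s)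

/-- The (projectable) spin structure `P` on `M` and the spin structure `P'` on `N` induce each
other, through their topological spin structures and a lift of the circle action. -/
def SpinInduces {OM : OrientedOrbifold (n + 1) M} {ON : OrientedOrbifold n N} (f : M → N)
    {g : OM.Metric} {h : ON.Metric} (P : OM.SpinStructure g) (P' : ON.SpinStructure h) : Prop :=
  ∃ (Q : OM.TopSpinStructure) (κ : OrientedOrbifold.CircleLift Q) (Q' : ON.TopSpinStructure),
    OrientedOrbifold.Extends Q P ∧ OrientedOrbifold.Extends Q' P' ∧ TopInduces f Q κ Q'

end Bundles

end

/-!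
A spin structure for a Riemannian metric is the restriction of a topological spin structure: polar
decomposition retracts the positively oriented frames onto the orthonormal frames, compatibly with
rotations, and a two-sheeted covering of the orthonormal frames extends by pulling back along this
retraction (`SpinCover.restrict`, `SpinCover.extend`). So the metrics play no role, and it is enough
to compare coverings of the bundles of all positively oriented frames.

The link between the two frame bundles is the bundle of adapted frames of the total space. Two
adapted frames over the same frame of the base differ by an element of `S¹` and a vertical shear,
i.e. a positive endomorphism of `ℝⁿ⁺¹ = ℝ × ℝⁿ` over the identity of `ℝⁿ`; these are unique and
depend continuously on the frames. So the adapted frames form a principal bundle over the frames of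
the base for the group of pairs of a rotation in `S¹` and a shear (`FrameProjects.circ_shear_free`,
`FrameProjects.exists_circ_shear`, `exists_adapted_trivialization`). This holds at the singular
points as well, because a diffeomorphism of finite order that fixes a frame is the identity, so the
chart groups act freely on frames (`OrbifoldChart.eq_one_of_jet`). In both directions, the covering
is now a quotient of a covering of a principal bundle by a lift of the action of its structure
group, and such a quotient is a covering again (`nonempty_orbit_localPullback`,
`isCoveringMap_of_localPullback`).

From the total space to the base, `S¹` acts on the covering of the adapted frames because the spin
structure is projectable, and the shears act because they form a contractible group
(`IsCoveringMap.exists_lift_family`). The two actions commute, and the quotient `DescendedSpin` by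
them is the spin structure on the base.

From the base to the total space, every frame can be rotated by `Spin(n+1)` so that it becomes
adapted, and the rotation is unique up to the stabilizer of the first basis vector
(`FrameProjects.rotation_eucFirst`). For `n ≠ 0` this stabilizer is `Spin(n)`; for `n = 0` it is
`{±1}`, where `-1` exchanges the two sheets of the covering (`SpinCover.exists_isStabilizerAction`).
Hence the pairs of a frame and a rotation that makes it adapted (`RotatedFrames`) form a principal
bundle over the frames for this stabilizer. The spin structure on the base pulls back to this
bundle, and the quotient `LiftedSpin` of the pullback by the stabilizer is the spin structure on the
total space. The group `S¹` acts on it because it does not move the frames of the base.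
-/

noncomputable section

/-! ### Splitting off the first coordinate -/

/-- The projection `ℝⁿ⁺¹ → ℝⁿ` that forgets the first coordinate. -/
def eucTail (n : ℕ) : Euc (n + 1) →L[ℝ] Euc n :=
  LinearMap.toContinuousLinearMap
    { toFun := fun v => WithLp.toLp 2 (fun i => v i.succ)
      map_add' := by intro v w; ext i; simp
      map_smul' := by intro r v; ext i; simp }

@[simp] theorem eucTail_apply {n : ℕ} (v : Euc (n + 1)) (i : Fin n) :
    eucTail n v i = v i.succ := rfl

@[simp] theorem eucIncl_zero_coord {n : ℕ} (v : Euc n) : eucIncl n v 0 = 0 := rfl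

@[simp] theorem eucIncl_succ_coord {n : ℕ} (v : Euc n) (i : Fin n) :
    eucIncl n v i.succ = v i := rfl

@[simp] theorem eucTail_eucIncl {n : ℕ} (v : Euc n) : eucTail n (eucIncl n v) = v := by
  ext i; simp

@[simp] theorem eucFirst_zero_coord {n : ℕ} : eucFirst n 0 = 1 := by simp [eucFirst]

@[simp] theorem eucTail_eucFirst {n : ℕ} : eucTail n (eucFirst n) = 0 := by
  ext i; simp [eucFirst]

theorem eucFirst_add_eucIncl {n : ℕ} (v : Euc (n + 1)) :
    v 0 • eucFirst n + eucIncl n (eucTail n v) = v := by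
  ext i
  refine Fin.cases ?_ (fun j => ?_) i <;> simp [eucFirst]

theorem inner_eucFirst {n : ℕ} (v : Euc (n + 1)) : inner ℝ (eucFirst n) v = v 0 := by
  simp [eucFirst, EuclideanSpace.inner_single_left]

@[simp] theorem norm_eucFirst {n : ℕ} : ‖eucFirst n‖ = 1 := by simp [eucFirst]

theorem norm_eucIncl {n : ℕ} (v : Euc n) : ‖eucIncl n v‖ = ‖v‖ := by
  simp [EuclideanSpace.norm_eq, Fin.sum_univ_succ]

/-! ### Clifford algebras of Euclidean spaces -/

theorem eucForm_apply {n : ℕ} (v : Euc n) : eucForm n v = ‖v‖ ^ 2 := by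
  simp [eucForm]

open CliffordAlgebra in
theorem ι_mul_self {n : ℕ} (v : Euc n) :
    ι (eucForm n) v * ι (eucForm n) v = algebraMap ℝ _ (‖v‖ ^ 2) := by
  rw [ι_sq_scalar, eucForm_apply]

theorem eucForm_polar {n : ℕ} (v w : Euc n) :
    QuadraticMap.polar (eucForm n) v w = 2 * inner ℝ v w := by
  simp only [QuadraticMap.polar, eucForm_apply, @norm_add_sq_real]
  ring

open CliffordAlgebra in
theorem ι_mul_ι_add {n : ℕ} (v w : Euc n) :
    ι (eucForm n) v * ι (eucForm n) w + ι (eucForm n) w * ι (eucForm n) v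
      = algebraMap ℝ _ (2 * inner ℝ v w) := by
  rw [ι_mul_ι_add_swap, eucForm_polar]

instance cliffordNontrivial (n : ℕ) : Nontrivial (CliffordAlgebra (eucForm n)) :=
  inferInstance

@[simp] theorem cliffordIncl_ι {n : ℕ} (v : Euc n) :
    cliffordIncl n (CliffordAlgebra.ι (eucForm n) v)
      = CliffordAlgebra.ι (eucForm (n + 1)) (eucIncl n v) := by
  rw [cliffordIncl, CliffordAlgebra.map_apply_ι]
  rfl

/-- The Clifford element `e₀` of the first basis vector. -/
abbrev cliffordFirst (n : ℕ) : CliffordAlgebra (eucForm (n + 1)) :=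
  CliffordAlgebra.ι (eucForm (n + 1)) (eucFirst n)

theorem cliffordFirst_sq (n : ℕ) : cliffordFirst n * cliffordFirst n = 1 := by
  rw [ι_mul_self]; simp

open CliffordAlgebra in
theorem cliffordIncl_mul_first {n : ℕ} (x : CliffordAlgebra (eucForm n)) :
    cliffordIncl n x * cliffordFirst n = cliffordFirst n * cliffordIncl n (involute x) := by
  induction x using CliffordAlgebra.induction with
  | algebraMap r => simp [Algebra.commutes]
  | ι v =>
    have h := ι_mul_ι_add (eucIncl n v) (eucFirst n)
    rw [real_inner_comm, inner_eucFirst] at h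
    simp only [eucIncl_zero_coord, mul_zero, map_zero] at h
    simp [eq_neg_iff_add_eq_zero, h]
  | mul a b ha hb => simp only [map_mul]; rw [mul_assoc, hb, ← mul_assoc, ha, mul_assoc]
  | add a b ha hb => simp only [map_add, add_mul, mul_add, ha, hb]

/-- The algebra `Cl(n+1)` is generated by `Cl(n)` and the first basis vector. -/
theorem clifford_decomposition {n : ℕ} (x : CliffordAlgebra (eucForm (n + 1))) :
    ∃ a b : CliffordAlgebra (eucForm n),
      x = cliffordIncl n a + cliffordFirst n * cliffordIncl n b := by
  induction x using CliffordAlgebra.induction with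
  | algebraMap r => exact ⟨algebraMap ℝ _ r, 0, by simp⟩
  | ι v =>
    refine ⟨CliffordAlgebra.ι _ (eucTail n v), algebraMap ℝ _ (v 0), ?_⟩
    conv_lhs => rw [← eucFirst_add_eucIncl v]
    rw [map_add, map_smul, cliffordIncl_ι, AlgHom.commutes, Algebra.smul_def,
      Algebra.commutes]
    exact add_comm _ _
  | mul x y hx hy =>
    obtain ⟨a, b, rfl⟩ := hx
    obtain ⟨c, d, rfl⟩ := hy
    refine ⟨a * c + CliffordAlgebra.involute b * d, CliffordAlgebra.involute a * d + b * c, ?_⟩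
    have h1 : cliffordIncl n a * (cliffordFirst n * cliffordIncl n d)
        = cliffordFirst n * (cliffordIncl n (CliffordAlgebra.involute a) * cliffordIncl n d) := by
      rw [← mul_assoc, cliffordIncl_mul_first, mul_assoc]
    have h2 : cliffordFirst n * cliffordIncl n b * (cliffordFirst n * cliffordIncl n d)
        = cliffordIncl n (CliffordAlgebra.involute b) * cliffordIncl n d := by
      rw [mul_assoc, ← mul_assoc (cliffordIncl n b), cliffordIncl_mul_first, ← mul_assoc,
        ← mul_assoc, cliffordFirst_sq, one_mul]
    simp only [map_add, map_mul, add_mul, mul_add, h1, h2]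
    simp only [mul_assoc]
    abel
  | add x y hx hy =>
    obtain ⟨a, b, rfl⟩ := hx
    obtain ⟨c, d, rfl⟩ := hy
    exact ⟨a + c, b + d, by simp only [map_add, mul_add]; abel⟩

theorem matrix_fin_two_mul_self {A : Type*} [Ring A] [Algebra ℝ A] (x : A) (r s : ℝ)
    (hx : x * x = algebraMap ℝ A s) :
    !![x, algebraMap ℝ A r; algebraMap ℝ A r, -x] * !![x, algebraMap ℝ A r; algebraMap ℝ A r, -x]
      = algebraMap ℝ (Matrix (Fin 2) (Fin 2) A) (s + r ^ 2) := by
  have hc := Algebra.commutes (R := ℝ) r x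
  rw [Matrix.mul_fin_two, hx, hc, ← map_mul, neg_mul_neg, hx, ← map_add, ← map_add,
    Matrix.algebraMap_eq_diagonal, mul_neg, hc, add_neg_cancel, neg_mul, add_neg_cancel]
  ext i j; fin_cases i <;> fin_cases j <;> simp [pow_two, add_comm]

/-- The matrix `[[v, r], [r, -v]]` over `Cl(n)` of a vector `(r, v)` of `ℝⁿ⁺¹`. -/
def cliffordMatrix (n : ℕ) :
    Euc (n + 1) →ₗ[ℝ] Matrix (Fin 2) (Fin 2) (CliffordAlgebra (eucForm n)) where
  toFun v := !![CliffordAlgebra.ι (eucForm n) (eucTail n v),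
    algebraMap ℝ (CliffordAlgebra (eucForm n)) (v 0);
    algebraMap ℝ (CliffordAlgebra (eucForm n)) (v 0),
    -CliffordAlgebra.ι (eucForm n) (eucTail n v)]
  map_add' v w := by
    rw [map_add, map_add, PiLp.add_apply, map_add, neg_add]
    ext i j; fin_cases i <;> fin_cases j <;> rfl
  map_smul' r v := by
    rw [map_smul, map_smul, PiLp.smul_apply, smul_eq_mul, map_mul, ← Algebra.smul_def, ← smul_neg]
    ext i j; fin_cases i <;> fin_cases j <;> rfl

theorem cliffordMatrix_mul_self (n : ℕ) (v : Euc (n + 1)) :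
    cliffordMatrix n v * cliffordMatrix n v = algebraMap ℝ _ (eucForm (n + 1) v) := by
  have hn : ‖v‖ ^ 2 = ‖eucTail n v‖ ^ 2 + v 0 ^ 2 := by
    simp [EuclideanSpace.norm_sq_eq, Fin.sum_univ_succ, add_comm]
  rw [eucForm_apply, hn]
  exact matrix_fin_two_mul_self _ _ _ (ι_mul_self (eucTail n v))

/-- The representation of `Cl(n+1)` by `2 × 2` matrices over `Cl(n)` in which `e₀` is the swap of
the two coordinates and `v ∈ ℝⁿ` is `diag(v, -v)`. -/
def cliffordMatrixRep (n : ℕ) :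
    CliffordAlgebra (eucForm (n + 1)) →ₐ[ℝ] Matrix (Fin 2) (Fin 2) (CliffordAlgebra (eucForm n)) :=
  CliffordAlgebra.lift (eucForm (n + 1)) ⟨cliffordMatrix n, cliffordMatrix_mul_self n⟩

theorem cliffordMatrixRep_ι (n : ℕ) (v : Euc (n + 1)) :
    cliffordMatrixRep n (CliffordAlgebra.ι (eucForm (n + 1)) v) = cliffordMatrix n v :=
  CliffordAlgebra.lift_ι_apply _ _ _

theorem cliffordIncl_injective (n : ℕ) : Function.Injective (cliffordIncl n) := by
  have h : ∀ x, cliffordMatrixRep n (cliffordIncl n x)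
      = !![x, 0; 0, CliffordAlgebra.involute x] := by
    intro x
    induction x using CliffordAlgebra.induction with
    | algebraMap r =>
      rw [AlgHom.commutes, AlgHom.commutes, AlgHom.commutes, Matrix.algebraMap_eq_diagonal]
      ext i j; fin_cases i <;> fin_cases j <;> simp
    | ι v =>
      rw [cliffordIncl_ι, cliffordMatrixRep_ι]
      change !![_, _; _, _] = _
      rw [eucTail_eucIncl, eucIncl_zero_coord, map_zero, CliffordAlgebra.involute_ι]
    | mul a b ha hb =>
      rw [map_mul, map_mul, ha, hb, Matrix.mul_fin_two, map_mul]
      simp only [mul_zero, zero_mul, add_zero, zero_add]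
    | add a b ha hb =>
      rw [map_add, map_add, ha, hb, map_add]
      ext i j; fin_cases i <;> fin_cases j <;> simp
  intro x y hxy
  have := congrArg (fun z => cliffordMatrixRep n z 0 0) hxy
  simpa [h] using this

theorem clifford_zero_scalar (x : CliffordAlgebra (eucForm 0)) : ∃ r : ℝ, x = algebraMap ℝ _ r := by
  induction x using CliffordAlgebra.induction with
  | algebraMap r => exact ⟨r, rfl⟩
  | ι v => exact ⟨0, by rw [Subsingleton.elim v 0]; simp⟩
  | mul a b ha hb => obtain ⟨r, rfl⟩ := ha; obtain ⟨s, rfl⟩ := hb; exact ⟨r * s, by simp⟩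
  | add a b ha hb => obtain ⟨r, rfl⟩ := ha; obtain ⟨s, rfl⟩ := hb; exact ⟨r + s, by simp⟩

instance cliffordFinite (n : ℕ) : Module.Finite ℝ (CliffordAlgebra (eucForm n)) := by
  induction n with
  | zero =>
    refine Module.Finite.of_surjective (Algebra.linearMap ℝ (CliffordAlgebra (eucForm 0)))
      fun x => ?_
    obtain ⟨r, rfl⟩ := clifford_zero_scalar x
    exact ⟨r, rfl⟩
  | succ n ih =>
    refine Module.Finite.of_surjective
      ((cliffordIncl n).toLinearMap.coprod
        ((LinearMap.mulLeft ℝ (cliffordFirst n)).comp (cliffordIncl n).toLinearMap)) fun x => ?_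
    obtain ⟨a, b, rfl⟩ := clifford_decomposition x
    exact ⟨(a, b), by simp⟩

instance (n : ℕ) : IsModuleTopology ℝ (CliffordAlgebra (eucForm n)) := ⟨rfl⟩

instance (n : ℕ) : IsTopologicalRing (CliffordAlgebra (eucForm n)) :=
  IsModuleTopology.isTopologicalRing ℝ _

instance (n : ℕ) : ContinuousSMul ℝ (CliffordAlgebra (eucForm n)) :=
  IsModuleTopology.toContinuousSMul ℝ _

/-- The even elements of the centralizer of `ℝⁿ` in the Clifford algebra are the scalars. -/
theorem clifford_even_central {n : ℕ} (x : CliffordAlgebra (eucForm n))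
    (hx : CliffordAlgebra.involute x = x)
    (hc : ∀ v, x * CliffordAlgebra.ι _ v = CliffordAlgebra.ι _ v * x) :
    ∃ r : ℝ, x = algebraMap ℝ _ r := by
  induction n with
  | zero => exact clifford_zero_scalar x
  | succ n ih =>
    obtain ⟨a, b, hab⟩ := clifford_decomposition x
    have hinv : ∀ z, CliffordAlgebra.involute (cliffordIncl n z)
        = cliffordIncl n (CliffordAlgebra.involute z) := by
      intro z
      induction z using CliffordAlgebra.induction with
      | algebraMap r => simp
      | ι v => simp
      | mul a b ha hb => simp [ha, hb]
      | add a b ha hb => simp [ha, hb]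
    -- averaging over the grading automorphism makes `a` even and `b` odd
    set a' := (1 / 2 : ℝ) • (a + CliffordAlgebra.involute a) with ha'
    set b' := (1 / 2 : ℝ) • (b - CliffordAlgebra.involute b) with hb'
    have hbodd : CliffordAlgebra.involute b' = -b' := by
      simp [hb', ← smul_neg]
    have haeven : CliffordAlgebra.involute a' = a' := by
      simp [ha', add_comm]
    have hx' : x = cliffordIncl n a' + cliffordFirst n * cliffordIncl n b' := by
      have h1 : x = (1 / 2 : ℝ) • (x + CliffordAlgebra.involute x) := by
        rw [hx, ← two_smul ℝ x, smul_smul]; norm_num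
      rw [h1, hab]
      simp only [map_add, map_mul, hinv, CliffordAlgebra.involute_ι, ha', hb', map_smul, map_sub,
        mul_smul_comm, mul_sub, smul_add, smul_sub, neg_mul, cliffordFirst]
      simp only [smul_neg]
      abel
    have h := hc (eucFirst n)
    rw [hx', add_mul, mul_add, cliffordIncl_mul_first, haeven, mul_assoc, cliffordIncl_mul_first,
      hbodd, ← mul_assoc, ← mul_assoc, cliffordFirst_sq, one_mul, one_mul, map_neg] at h
    have h0 : cliffordIncl n b' = 0 := by
      have h2 : (2 : ℝ) • cliffordIncl n b' = 0 := by
        rw [two_smul]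
        have := add_left_cancel h
        nth_rewrite 1 [← this]
        simp
      simpa using h2
    rw [h0, mul_zero, add_zero] at hx'
    obtain ⟨r, hr⟩ := ih a' haeven (fun v => by
      apply cliffordIncl_injective
      rw [map_mul, map_mul, cliffordIncl_ι, ← hx', hc])
    exact ⟨r, by rw [hx', hr]; simp⟩

/-! ### The group `GL₊(n)` -/

namespace GLPlus

variable {n : ℕ}

theorem det_comp (A B : Euc n →L[ℝ] Euc n) : (A.comp B).det = A.det * B.det :=
  LinearMap.det_comp (A : Euc n →ₗ[ℝ] Euc n) (B : Euc n →ₗ[ℝ] Euc n)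

theorem det_id : (ContinuousLinearMap.id ℝ (Euc n)).det = 1 := by
  change LinearMap.det (LinearMap.id : Euc n →ₗ[ℝ] Euc n) = 1
  simp

theorem continuous_det : Continuous (fun A : Euc n →L[ℝ] Euc n => A.det) :=
  ContinuousLinearMap.continuous_det

/-- A linear endomorphism with nonzero determinant is invertible. -/
theorem isUnit_of_det_ne_zero {A : Euc n →L[ℝ] Euc n} (h : A.det ≠ 0) : IsUnit A := by
  obtain ⟨e, he⟩ := (LinearMap.isUnit_iff_isUnit_det (A : Euc n →ₗ[ℝ] Euc n)).2 h.isUnit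
  refine ⟨⟨A, LinearMap.toContinuousLinearMap e.inv, ?_, ?_⟩, rfl⟩
  · ext1 v
    have := congrArg (fun f : Euc n →ₗ[ℝ] Euc n => f v) e.val_inv
    rw [he] at this
    exact this
  · ext1 v
    have := congrArg (fun f : Euc n →ₗ[ℝ] Euc n => f v) e.inv_val
    rw [he] at this
    exact this

theorem comp_inverse {A : Euc n →L[ℝ] Euc n} (h : A.det ≠ 0) :
    A.comp (Ring.inverse A) = ContinuousLinearMap.id ℝ (Euc n) :=
  Ring.mul_inverse_cancel A (isUnit_of_det_ne_zero h)

theorem inverse_comp {A : Euc n →L[ℝ] Euc n} (h : A.det ≠ 0) :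
    (Ring.inverse A).comp A = ContinuousLinearMap.id ℝ (Euc n) :=
  Ring.inverse_mul_cancel A (isUnit_of_det_ne_zero h)

theorem det_mul_det_inverse {A : Euc n →L[ℝ] Euc n} (h : A.det ≠ 0) :
    A.det * (Ring.inverse A).det = 1 := by
  rw [← det_comp, comp_inverse h, det_id]

theorem det_inverse {A : Euc n →L[ℝ] Euc n} (h : A.det ≠ 0) :
    (Ring.inverse A).det = A.det⁻¹ :=
  eq_inv_of_mul_eq_one_right (det_mul_det_inverse h)

theorem continuousAt_inverse {A : Euc n →L[ℝ] Euc n} (h : A.det ≠ 0) :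
    ContinuousAt Ring.inverse A := by
  obtain ⟨u, rfl⟩ := isUnit_of_det_ne_zero h
  exact NormedRing.inverse_continuousAt u

instance : Mul (GLPlus n) :=
  ⟨fun a b => ⟨a.1.comp b.1, by rw [det_comp]; exact mul_pos a.2 b.2⟩⟩

instance : One (GLPlus n) :=
  ⟨⟨ContinuousLinearMap.id ℝ (Euc n), by rw [det_id]; exact one_pos⟩⟩

instance : Inv (GLPlus n) :=
  ⟨fun a => ⟨Ring.inverse a.1, by rw [det_inverse a.2.ne']; exact inv_pos.2 a.2⟩⟩

@[simp] theorem coe_one : (1 : GLPlus n).1 = ContinuousLinearMap.id ℝ (Euc n) := rfl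

instance : Group (GLPlus n) where
  mul_assoc a b c := Subtype.ext (ContinuousLinearMap.comp_assoc _ _ _)
  one_mul a := Subtype.ext (ContinuousLinearMap.id_comp _)
  mul_one a := Subtype.ext (ContinuousLinearMap.comp_id _)
  inv_mul_cancel a := Subtype.ext (inverse_comp a.2.ne')

instance : IsTopologicalGroup (GLPlus n) where
  continuous_mul := by
    refine Continuous.subtype_mk ?_ _
    exact (continuous_subtype_val.comp continuous_fst).clm_comp
      (continuous_subtype_val.comp continuous_snd)
  continuous_inv := by
    refine Continuous.subtype_mk ?_ _
    refine continuous_iff_continuousAt.2 fun a => ?_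
    exact (continuousAt_inverse a.2.ne').comp continuous_subtype_val.continuousAt

theorem mul_apply (a b : GLPlus n) (v : Euc n) : (a * b).1 v = a.1 (b.1 v) := rfl

theorem one_apply (v : Euc n) : (1 : GLPlus n).1 v = v := rfl

theorem inv_apply_apply (a : GLPlus n) (v : Euc n) : (a⁻¹).1 (a.1 v) = v := by
  rw [← mul_apply, inv_mul_cancel, one_apply]

theorem apply_inv_apply (a : GLPlus n) (v : Euc n) : a.1 ((a⁻¹).1 v) = v := by
  rw [← mul_apply, mul_inv_cancel, one_apply]

end GLPlus

/-! ### The covering homomorphism `Spin(n) → SO(n)` -/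

section SpinRotation

variable {n : ℕ}

open CliffordAlgebra in
theorem ι_injective : Function.Injective (ι (eucForm n)) := by
  intro v w h
  have h0 : ι (eucForm n) (v - w) = 0 := by rw [map_sub, h, sub_self]
  have h1 := ι_mul_self (v - w)
  rw [h0, mul_zero] at h1
  have h2 : ‖v - w‖ ^ 2 = 0 :=
    (algebraMap ℝ (CliffordAlgebra (eucForm n))).injective (by rw [← h1, map_zero])
  exact sub_eq_zero.1 (norm_eq_zero.1 (pow_eq_zero_iff two_ne_zero |>.1 h2))

/-- Conjugation by a vector is the negative of the reflection in its orthogonal complement. -/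
theorem ι_mul_ι_eq_reflection {u : Euc n} (hu : u ≠ 0) (v : Euc n) :
    CliffordAlgebra.ι (eucForm n) u * CliffordAlgebra.ι (eucForm n) v
      = -(CliffordAlgebra.ι (eucForm n) (Submodule.reflection (Submodule.span ℝ {u})ᗮ v)
        * CliffordAlgebra.ι (eucForm n) u) := by
  have hu' : ‖u‖ ^ 2 ≠ 0 := pow_ne_zero 2 (norm_ne_zero_iff.2 hu)
  rw [Submodule.reflection_orthogonal_apply, Submodule.reflection_singleton_apply, map_neg,
    map_sub, two_smul, ← add_smul, map_smul, neg_mul, neg_neg, sub_mul, smul_mul_assoc,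
    ι_mul_self, eq_sub_iff_add_eq, ι_mul_ι_add, Algebra.smul_def, ← map_mul]
  congr 1
  simp only [RCLike.ofReal_real_eq_id, id]
  field_simp
  ring

theorem det_reflection_ne_zero {u : Euc n} (hu : u ≠ 0) :
    LinearMap.det (Submodule.reflection (Submodule.span ℝ {u})ᗮ).toLinearEquiv.toLinearMap
      = -1 := by
  have h := Submodule.det_reflection (Submodule.span ℝ {u})ᗮ
  rw [Submodule.orthogonal_orthogonal, finrank_span_singleton hu, pow_one] at h
  exact h

/-- A Clifford element `x` that acts on vectors as the isometry `R`: it is even or odd, according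
to the sign `ε = det R`, and `x v = ε R(v) x`. -/
def TwistedLift (x : CliffordAlgebra (eucForm n)) (R : Euc n ≃ₗᵢ[ℝ] Euc n) (ε : ℝ) : Prop :=
  (ε = 1 ∨ ε = -1) ∧ CliffordAlgebra.involute x = ε • x ∧
    LinearMap.det R.toLinearEquiv.toLinearMap = ε ∧
    ∀ v, x * CliffordAlgebra.ι (eucForm n) v = ε • (CliffordAlgebra.ι (eucForm n) (R v) * x)

theorem TwistedLift.one : TwistedLift (1 : CliffordAlgebra (eucForm n)) 1 1 :=
  ⟨Or.inl rfl, by simp, by exact LinearMap.det_id, by simp⟩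

theorem TwistedLift.mul {x y : CliffordAlgebra (eucForm n)} {R S : Euc n ≃ₗᵢ[ℝ] Euc n} {ε δ : ℝ}
    (hx : TwistedLift x R ε) (hy : TwistedLift y S δ) : TwistedLift (x * y) (R * S) (ε * δ) := by
  obtain ⟨h1, h2, h3, h4⟩ := hx
  obtain ⟨k1, k2, k3, k4⟩ := hy
  refine ⟨?_, ?_, ?_, fun v => ?_⟩
  · rcases h1 with rfl | rfl <;> rcases k1 with rfl | rfl <;> simp
  · rw [map_mul, h2, k2, smul_mul_smul_comm]
  · rw [← h3, ← k3, ← LinearMap.det_comp]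
    rfl
  · rw [mul_assoc, k4, mul_smul_comm, ← mul_assoc, h4, smul_mul_assoc, smul_smul, mul_assoc,
      mul_comm δ]
    rfl

theorem TwistedLift.ι {u : Euc n} (hu : u ≠ 0) :
    TwistedLift (CliffordAlgebra.ι (eucForm n) u)
      (Submodule.reflection (Submodule.span ℝ {u})ᗮ) (-1) :=
  ⟨Or.inr rfl, by simp, det_reflection_ne_zero hu, fun v => by
    rw [ι_mul_ι_eq_reflection hu, neg_one_smul]⟩

theorem TwistedLift.inv {x : (CliffordAlgebra (eucForm n))ˣ} {R : Euc n ≃ₗᵢ[ℝ] Euc n} {ε : ℝ}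
    (hx : TwistedLift (x : CliffordAlgebra (eucForm n)) R ε) :
    TwistedLift ((x⁻¹ : (CliffordAlgebra (eucForm n))ˣ) : CliffordAlgebra (eucForm n)) R⁻¹ ε := by
  obtain ⟨h1, h2, h3, h4⟩ := hx
  have hε : ε * ε = 1 := by rcases h1 with rfl | rfl <;> norm_num
  refine ⟨h1, ?_, ?_, fun v => ?_⟩
  · have h := congrArg CliffordAlgebra.involute x.mul_inv
    rw [map_mul, h2, map_one, smul_mul_assoc] at h
    rw [← Units.inv_mul_cancel_left x (CliffordAlgebra.involute _), ← one_smul ℝ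
      ((x : CliffordAlgebra (eucForm n)) * _), ← hε, ← smul_smul, h]
    simp
  · have h : LinearMap.det R.toLinearEquiv.toLinearMap
        * LinearMap.det (R⁻¹).toLinearEquiv.toLinearMap = 1 := by
      rw [← LinearMap.det_comp]
      have : R.toLinearEquiv.toLinearMap ∘ₗ (R⁻¹).toLinearEquiv.toLinearMap = LinearMap.id := by
        ext1 v; exact R.apply_symm_apply v
      rw [this, LinearMap.det_id]
    rw [h3] at h
    rcases h1 with rfl | rfl <;> linarith
  · have h := h4 (R⁻¹ v)
    have hR : R (R⁻¹ v) = v := R.apply_symm_apply v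
    rw [hR] at h
    have h' : CliffordAlgebra.ι (eucForm n) v * (x : CliffordAlgebra (eucForm n))
        = ε • ((x : CliffordAlgebra (eucForm n)) * CliffordAlgebra.ι (eucForm n) (R⁻¹ v)) := by
      rw [h, smul_smul, hε, one_smul]
    have h'' := congrArg (fun z => ((x⁻¹ : (CliffordAlgebra (eucForm n))ˣ) :
      CliffordAlgebra (eucForm n)) * z * ((x⁻¹ : (CliffordAlgebra (eucForm n))ˣ) :
      CliffordAlgebra (eucForm n))) h'
    simp only [mul_smul_comm, smul_mul_assoc] at h''
    rw [Units.inv_mul_cancel_left, ← mul_assoc, Units.mul_inv_cancel_right] at h''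
    exact h''

theorem exists_twistedLift_of_mem_lipschitzGroup {x : (CliffordAlgebra (eucForm n))ˣ}
    (hx : x ∈ lipschitzGroup (eucForm n)) :
    ∃ R ε, TwistedLift (x : CliffordAlgebra (eucForm n)) R ε := by
  refine Subgroup.closure_induction (G := (CliffordAlgebra (eucForm n))ˣ) (p := fun x _ => ∃ R ε,
    TwistedLift (x : CliffordAlgebra (eucForm n)) R ε) ?_ ?_ ?_ ?_ hx
  · rintro x ⟨u, hu⟩
    have hu0 : u ≠ 0 := by
      rintro rfl
      rw [map_zero] at hu
      exact x.ne_zero hu.symm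
    exact ⟨_, _, hu ▸ TwistedLift.ι hu0⟩
  · exact ⟨1, 1, TwistedLift.one⟩
  · rintro x y - - ⟨R, ε, h⟩ ⟨S, δ, k⟩
    exact ⟨_, _, h.mul k⟩
  · rintro x - ⟨R, ε, h⟩
    exact ⟨_, _, h.inv⟩

theorem exists_isometry_of_spin (s : SpinGrp n) : ∃ R : Euc n ≃ₗᵢ[ℝ] Euc n,
    LinearMap.det R.toLinearEquiv.toLinearMap = 1 ∧
    ∀ v, (s : CliffordAlgebra (eucForm n)) * CliffordAlgebra.ι (eucForm n) v
      = CliffordAlgebra.ι (eucForm n) (R v) * s := by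
  obtain ⟨x, hx, hxs⟩ := s.2.1.1
  obtain ⟨R, ε, h1, h2, h3, h4⟩ := exists_twistedLift_of_mem_lipschitzGroup hx
  have hs : (x : CliffordAlgebra (eucForm n)) = s := hxs
  have hε : ε = 1 := by
    rcases h1 with h | h
    · exact h
    · exfalso
      rw [hs, spinGroup.involute_eq s.2, h, neg_one_smul, eq_neg_iff_add_eq_zero, ← two_smul ℝ,
        smul_eq_zero] at h2
      rcases h2 with h2 | h2
      · norm_num at h2
      · exact x.ne_zero (hs.trans h2)
  subst hε
  refine ⟨R, h3, fun v => ?_⟩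
  rw [← hs, h4, one_smul]

/-- The isometry `v ↦ s v s⁻¹` of `ℝⁿ` that belongs to `s ∈ Spin(n)`. -/
def spinIsometry (s : SpinGrp n) : Euc n ≃ₗᵢ[ℝ] Euc n := (exists_isometry_of_spin s).choose

theorem mul_ι_spin (s : SpinGrp n) (v : Euc n) :
    (s : CliffordAlgebra (eucForm n)) * CliffordAlgebra.ι (eucForm n) v
      = CliffordAlgebra.ι (eucForm n) (spinIsometry s v) * s :=
  (exists_isometry_of_spin s).choose_spec.2 v

/-- The covering homomorphism `Spin(n) → SO(n) ⊆ GL₊(n)` as a map. -/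
def spinRotFun (s : SpinGrp n) : GLPlus n :=
  ⟨(spinIsometry s).toContinuousLinearEquiv, by
    have h := (exists_isometry_of_spin s).choose_spec.1
    change 0 < LinearMap.det (spinIsometry s).toLinearEquiv.toLinearMap
    rw [spinIsometry, h]
    exact one_pos⟩

theorem isSpinImage_spinRotFun (s : SpinGrp n) : IsSpinImage s (spinRotFun s) := mul_ι_spin s

theorem spin_mul_star (s : SpinGrp n) :
    (s : CliffordAlgebra (eucForm n)) * star (s : CliffordAlgebra (eucForm n)) = 1 :=
  s.2.1.2.2

theorem IsSpinImage.unique {s : SpinGrp n} {R S : GLPlus n} (h : IsSpinImage s R)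
    (k : IsSpinImage s S) : R = S := by
  refine Subtype.ext (ContinuousLinearMap.ext fun v => ι_injective ?_)
  have h1 := (h v).symm.trans (k v)
  have h2 := congrArg (fun z => z * star (s : CliffordAlgebra (eucForm n))) h1
  simpa only [mul_assoc, spin_mul_star, mul_one] using h2

theorem isSpinImage_one : IsSpinImage (1 : SpinGrp n) 1 := fun v => by
  simp

theorem IsSpinImage.mul {s t : SpinGrp n} {R S : GLPlus n} (h : IsSpinImage s R)
    (k : IsSpinImage t S) : IsSpinImage (s * t) (R * S) := fun v => by
  change (s : CliffordAlgebra (eucForm n)) * t * _ = _ * (s * t)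
  rw [mul_assoc, k v, ← mul_assoc, h, mul_assoc]
  rfl

/-- The covering homomorphism `Spin(n) → SO(n) ⊆ GL₊(n)`. -/
def spinRot : SpinGrp n →* GLPlus n where
  toFun := spinRotFun
  map_one' := (isSpinImage_spinRotFun 1).unique isSpinImage_one
  map_mul' s t := (isSpinImage_spinRotFun _).unique
    ((isSpinImage_spinRotFun s).mul (isSpinImage_spinRotFun t))

theorem isSpinImage_spinRot (s : SpinGrp n) : IsSpinImage s (spinRot s) :=
  isSpinImage_spinRotFun s

theorem isSpinImage_iff {s : SpinGrp n} {R : GLPlus n} : IsSpinImage s R ↔ R = spinRot s :=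
  ⟨fun h => h.unique (isSpinImage_spinRot s), fun h => h ▸ isSpinImage_spinRot s⟩

theorem inner_spinRot (s : SpinGrp n) (v w : Euc n) :
    inner ℝ ((spinRot s).1 v) ((spinRot s).1 w) = inner ℝ v w :=
  (spinIsometry s).inner_map_map v w

theorem norm_spinRot (s : SpinGrp n) (v : Euc n) : ‖(spinRot s).1 v‖ = ‖v‖ :=
  (spinIsometry s).norm_map v

theorem continuous_clifford_linear {E : Type*} [AddCommGroup E] [Module ℝ E] [TopologicalSpace E]
    [ContinuousAdd E] [ContinuousSMul ℝ E] (L : CliffordAlgebra (eucForm n) →ₗ[ℝ] E) :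
    Continuous L :=
  IsModuleTopology.continuous_of_linearMap L

theorem continuous_ι : Continuous (CliffordAlgebra.ι (eucForm n)) :=
  LinearMap.continuous_of_finiteDimensional _

theorem continuous_spin_coe :
    Continuous (fun s : SpinGrp n => (s : CliffordAlgebra (eucForm n))) :=
  continuous_subtype_val

theorem continuous_clifford_star :
    Continuous (fun x : CliffordAlgebra (eucForm n) => star x) := by
  have h : (fun x : CliffordAlgebra (eucForm n) => star x)
      = (CliffordAlgebra.reverse.comp
        (CliffordAlgebra.involute (Q := eucForm n)).toLinearMap) := by
    ext x; simp [CliffordAlgebra.star_def]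
  rw [h]
  exact continuous_clifford_linear _

instance : IsTopologicalGroup (SpinGrp n) where
  continuous_mul := continuous_mul
  continuous_inv := Continuous.subtype_mk (continuous_clifford_star.comp continuous_spin_coe) _

theorem continuous_spinRot : Continuous (spinRot (n := n)) := by
  refine Continuous.subtype_mk (continuous_clm_apply.2 fun v => ?_) _
  obtain ⟨L, hL⟩ := (CliffordAlgebra.ι (eucForm n)).exists_leftInverse_of_injective
    (LinearMap.ker_eq_bot.2 ι_injective)
  have h : ∀ s : SpinGrp n, spinIsometry s v
      = L ((s : CliffordAlgebra (eucForm n)) * CliffordAlgebra.ι (eucForm n) v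
        * star (s : CliffordAlgebra (eucForm n))) := by
    intro s
    rw [mul_ι_spin, mul_assoc, spin_mul_star, mul_one]
    exact (LinearMap.congr_fun hL _).symm
  change Continuous (fun s : SpinGrp n => spinIsometry s v)
  simp_rw [h]
  exact (continuous_clifford_linear L).comp ((continuous_spin_coe.mul continuous_const).mul
    (continuous_clifford_star.comp continuous_spin_coe))

/-- The kernel of `Spin(n) → SO(n)` is contained in `{±1}`. -/
theorem spinRot_eq_one {s : SpinGrp n} (h : spinRot s = 1) :
    (s : CliffordAlgebra (eucForm n)) = 1 ∨ (s : CliffordAlgebra (eucForm n)) = -1 := by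
  obtain ⟨r, hr⟩ := clifford_even_central (s : CliffordAlgebra (eucForm n))
    (spinGroup.involute_eq s.2) (fun v => by
      have := isSpinImage_spinRot s v
      rwa [h] at this)
  have h1 := spin_mul_star s
  rw [hr, CliffordAlgebra.star_algebraMap, ← map_mul, ← map_one (algebraMap ℝ _)] at h1
  have h2 : r * r = 1 := (algebraMap ℝ (CliffordAlgebra (eucForm n))).injective h1
  rcases mul_self_eq_one_iff.1 h2 with h3 | h3 <;> rw [hr, h3] <;> simp

/-! ### Elements of the spin group from unit vectors -/

theorem ι_isUnit {u : Euc n} (hu : u ≠ 0) : IsUnit (CliffordAlgebra.ι (eucForm n) u) := by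
  rw [CliffordAlgebra.isUnit_ι_iff, eucForm_apply]
  exact (pow_ne_zero 2 (norm_ne_zero_iff.2 hu)).isUnit

theorem ι_mul_ι_mem_spinGroup {u v : Euc n} (hu : ‖u‖ = 1) (hv : ‖v‖ = 1) :
    CliffordAlgebra.ι (eucForm n) u * CliffordAlgebra.ι (eucForm n) v ∈ spinGroup (eucForm n) := by
  have hu0 : u ≠ 0 := norm_ne_zero_iff.1 (by rw [hu]; exact one_ne_zero)
  have hv0 : v ≠ 0 := norm_ne_zero_iff.1 (by rw [hv]; exact one_ne_zero)
  refine ⟨⟨⟨(ι_isUnit hu0).unit * (ι_isUnit hv0).unit, ?_, rfl⟩, ?_⟩,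
    CliffordAlgebra.ι_mul_ι_mem_evenOdd_zero _ _ _⟩
  · exact mul_mem (Subgroup.subset_closure ⟨u, rfl⟩) (Subgroup.subset_closure ⟨v, rfl⟩)
  · change _ ∈ unitary _
    have h1 : ∀ {w : Euc n}, ‖w‖ = 1 →
        CliffordAlgebra.ι (eucForm n) w * CliffordAlgebra.ι (eucForm n) w = 1 := by
      intro w hw
      rw [ι_mul_self, hw]; simp
    rw [Unitary.mem_iff, star_mul, CliffordAlgebra.star_ι, CliffordAlgebra.star_ι, neg_mul_neg]
    constructor
    · rw [mul_assoc, ← mul_assoc (CliffordAlgebra.ι (eucForm n) u), h1 hu, one_mul, h1 hv]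
    · rw [mul_assoc, ← mul_assoc (CliffordAlgebra.ι (eucForm n) v), h1 hv, one_mul, h1 hu]

/-- The product `u v ∈ Spin(n)` of two unit vectors. -/
def spinOfUnits {u v : Euc n} (hu : ‖u‖ = 1) (hv : ‖v‖ = 1) : SpinGrp n :=
  ⟨_, ι_mul_ι_mem_spinGroup hu hv⟩

theorem spinRot_spinOfUnits_apply {u v : Euc n} (hu : ‖u‖ = 1) (hv : ‖v‖ = 1) :
    (spinRot (spinOfUnits hu hv)).1 v = (2 * inner ℝ u v) • u - v := by
  apply ι_injective
  have h := isSpinImage_spinRot (spinOfUnits hu hv) v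
  have h1 : CliffordAlgebra.ι (eucForm n) v * CliffordAlgebra.ι (eucForm n) v = 1 := by
    rw [ι_mul_self, hv]; simp
  have h2 : CliffordAlgebra.ι (eucForm n) u * CliffordAlgebra.ι (eucForm n) u = 1 := by
    rw [ι_mul_self, hu]; simp
  have h3 := ι_mul_ι_add u v
  change CliffordAlgebra.ι (eucForm n) u * CliffordAlgebra.ι (eucForm n) v * _
    = _ * (CliffordAlgebra.ι (eucForm n) u * CliffordAlgebra.ι (eucForm n) v) at h
  rw [mul_assoc, h1, mul_one] at h
  have h4 := congrArg (fun z => z * (CliffordAlgebra.ι (eucForm n) v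
    * CliffordAlgebra.ι (eucForm n) u)) h
  simp only [mul_assoc] at h4
  rw [← mul_assoc (CliffordAlgebra.ι (eucForm n) v) (CliffordAlgebra.ι (eucForm n) v), h1, one_mul,
    h2, mul_one] at h4
  rw [← h4, eq_sub_of_add_eq' h3, mul_sub, ← mul_assoc, h2, one_mul, ← Algebra.commutes,
    ← Algebra.smul_def, map_sub, map_smul]

end SpinRotation

/-- The determinant of a linear map that is block triangular with respect to `ℝⁿ⁺¹ = ℝ × ℝⁿ`. -/
theorem det_eq_of_tail_comp {n : ℕ} {C : Euc (n + 1) →L[ℝ] Euc (n + 1)} {A : Euc n →L[ℝ] Euc n}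
    (h : ∀ v, eucTail n (C v) = A (eucTail n v)) : C.det = C (eucFirst n) 0 * A.det := by
  have hC : C.det = (LinearMap.toMatrix (EuclideanSpace.basisFun (Fin (n + 1)) ℝ).toBasis
      (EuclideanSpace.basisFun (Fin (n + 1)) ℝ).toBasis
      (C : Euc (n + 1) →ₗ[ℝ] Euc (n + 1))).det := (LinearMap.det_toMatrix _ _).symm
  have hA : A.det = (LinearMap.toMatrix (EuclideanSpace.basisFun (Fin n) ℝ).toBasis
      (EuclideanSpace.basisFun (Fin n) ℝ).toBasis
      (A : Euc n →ₗ[ℝ] Euc n)).det := (LinearMap.det_toMatrix _ _).symm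
  have h0 : ∀ i : Fin n, C (eucFirst n) i.succ = 0 := fun i => by
    have := congrArg (fun w : Euc n => w i) (h (eucFirst n))
    simpa using this
  have h1 : ∀ i j : Fin n, C (EuclideanSpace.single j.succ 1) i.succ
      = A (EuclideanSpace.single j 1) i := fun i j => by
    have := congrArg (fun w : Euc n => w i) (h (EuclideanSpace.single j.succ 1))
    have h2 : eucTail n (EuclideanSpace.single j.succ 1) = EuclideanSpace.single j (1 : ℝ) := by
      ext i; simp
    rw [h2] at this
    exact this
  rw [hC, hA, Matrix.det_succ_column_zero, Fin.sum_univ_succ, Finset.sum_eq_zero, add_zero]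
  · simp only [Fin.val_zero, pow_zero, one_mul, Fin.succAbove_zero]
    congr 2
    ext i j
    simp [LinearMap.toMatrix_apply, h1]
  · intro i _
    have : (LinearMap.toMatrix (EuclideanSpace.basisFun (Fin (n + 1)) ℝ).toBasis
      (EuclideanSpace.basisFun (Fin (n + 1)) ℝ).toBasis
      (C : Euc (n + 1) →ₗ[ℝ] Euc (n + 1))) i.succ 0 = 0 := by
      simpa [LinearMap.toMatrix_apply, eucFirst] using h0 i
    rw [this]; simp

/-! ### The action of `Spin(n+1)` on the sphere -/

/-- For `v ≠ -e₀`, the element of `Spin(n+1)` that turns `e₀` into the unit vector `v` inside the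
plane spanned by the two vectors; it is the product of `(v + e₀)/|v + e₀|` and `e₀`. -/
def spinTo {n : ℕ} (v : Euc (n + 1)) : SpinGrp (n + 1) :=
  open Classical in
  if h : v + eucFirst n ≠ 0 then
    spinOfUnits (u := ‖v + eucFirst n‖⁻¹ • (v + eucFirst n)) (v := eucFirst n)
      (by rw [norm_smul, norm_inv, norm_norm, inv_mul_cancel₀ (norm_ne_zero_iff.2 h)])
      norm_eucFirst
  else 1

theorem spinTo_coe {n : ℕ} {v : Euc (n + 1)} (h : v + eucFirst n ≠ 0) :
    (spinTo v : CliffordAlgebra (eucForm (n + 1)))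
      = CliffordAlgebra.ι _ (‖v + eucFirst n‖⁻¹ • (v + eucFirst n)) * cliffordFirst n := by
  rw [spinTo, dif_pos h]
  rfl

theorem spinRot_spinTo {n : ℕ} {v : Euc (n + 1)} (hv : ‖v‖ = 1) (h : v + eucFirst n ≠ 0) :
    (spinRot (spinTo v)).1 (eucFirst n) = v := by
  rw [spinTo, dif_pos h, spinRot_spinOfUnits_apply, smul_smul, real_inner_smul_left]
  have h1 : inner ℝ (v + eucFirst n) (eucFirst n) = ‖v + eucFirst n‖ ^ 2 / 2 := by
    rw [@norm_add_sq_real, hv, norm_eucFirst, inner_add_left, real_inner_self_eq_norm_sq,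
      norm_eucFirst]
    ring
  have h2 : ‖v + eucFirst n‖ ≠ 0 := norm_ne_zero_iff.2 h
  rw [h1, show 2 * (‖v + eucFirst n‖⁻¹ * (‖v + eucFirst n‖ ^ 2 / 2)) * ‖v + eucFirst n‖⁻¹ = 1 by
    field_simp, one_smul, add_sub_cancel_right]

theorem continuousAt_spinTo {n : ℕ} {v : Euc (n + 1)} (h : v + eucFirst n ≠ 0) :
    ContinuousAt spinTo v := by
  rw [Topology.IsInducing.subtypeVal.continuousAt_iff]
  have h1 : ∀ᶠ w in 𝓝 v, w + eucFirst n ≠ 0 :=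
    (continuous_id.add continuous_const).continuousAt.eventually_ne h
  have h2 : ContinuousAt (fun w : Euc (n + 1) =>
      CliffordAlgebra.ι (eucForm (n + 1)) (‖w + eucFirst n‖⁻¹ • (w + eucFirst n))
        * cliffordFirst n) v := by
    refine ContinuousAt.mul (continuous_ι.continuousAt.comp ?_) continuousAt_const
    exact ((continuous_id.add continuous_const).norm.continuousAt.inv₀
      (norm_ne_zero_iff.2 h)).smul (continuous_id.add continuous_const).continuousAt
  exact h2.congr (h1.mono fun w hw => (spinTo_coe hw).symm)

theorem eucFirst_add_self_ne_zero (n : ℕ) : eucFirst n + eucFirst n ≠ 0 := by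
  intro h
  have := congrArg (fun w : Euc (n + 1) => w 0) h
  simp at this

/-- For `n ≥ 1`, the group `Spin(n+1)` acts transitively on the unit sphere. -/
theorem exists_spinRot_eq {n : ℕ} (hn : n ≠ 0) {v : Euc (n + 1)} (hv : ‖v‖ = 1) :
    ∃ s : SpinGrp (n + 1), (spinRot s).1 (eucFirst n) = v := by
  by_cases h : v + eucFirst n = 0
  · obtain ⟨m, rfl⟩ := Nat.exists_eq_succ_of_ne_zero hn
    have hu : ‖eucIncl (m + 1) (eucFirst m)‖ = 1 := by rw [norm_eucIncl, norm_eucFirst]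
    refine ⟨spinOfUnits hu norm_eucFirst, ?_⟩
    rw [spinRot_spinOfUnits_apply, real_inner_comm, inner_eucFirst, eucIncl_zero_coord, mul_zero,
      zero_smul, zero_sub, eq_neg_of_add_eq_zero_left h]
  · exact ⟨spinTo v, spinRot_spinTo hv h⟩

/-! ### Surjectivity of `Spin(n) → SO(n)` -/

/-- A product of reflections is the twisted conjugation by a product of unit vectors. The sign `ε`
is at once the determinant of the former, and the norm and the parity of the latter. -/
theorem lipschitz_lift_of_reflections {n : ℕ} (l : List (Euc n)) :
    ∃ (x : (CliffordAlgebra (eucForm n))ˣ) (ε : ℝ), x ∈ lipschitzGroup (eucForm n) ∧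
      TwistedLift (x : CliffordAlgebra (eucForm n))
        (l.map fun v => Submodule.reflection (Submodule.span ℝ {v})ᗮ).prod ε ∧
      star (x : CliffordAlgebra (eucForm n)) * x = algebraMap ℝ _ ε ∧
      (x : CliffordAlgebra (eucForm n)) * star (x : CliffordAlgebra (eucForm n))
        = algebraMap ℝ _ ε ∧
      ((ε = 1 ∧ (x : CliffordAlgebra (eucForm n)) ∈ CliffordAlgebra.evenOdd (eucForm n) 0) ∨
        (ε = -1 ∧ (x : CliffordAlgebra (eucForm n)) ∈ CliffordAlgebra.evenOdd (eucForm n) 1)) := by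
  induction l with
  | nil =>
    refine ⟨1, 1, one_mem _, TwistedLift.one, by simp, by simp, Or.inl ⟨rfl, ?_⟩⟩
    exact (CliffordAlgebra.even (eucForm n)).one_mem
  | cons v l ih =>
    obtain ⟨x, ε, h1, h2, h3, h4, h5⟩ := ih
    by_cases hv : v = 0
    · refine ⟨x, ε, h1, ?_, h3, h4, h5⟩
      have : Submodule.reflection (Submodule.span ℝ {v})ᗮ = 1 := by
        ext w : 1
        rw [hv, Submodule.reflection_orthogonal_apply, Submodule.reflection_singleton_apply]
        simp
      rw [List.map_cons, List.prod_cons, this, one_mul]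
      exact h2
    · have hv' : ‖v‖ ≠ 0 := norm_ne_zero_iff.2 hv
      have hu : ‖‖v‖⁻¹ • v‖ = 1 := by rw [norm_smul, norm_inv, norm_norm, inv_mul_cancel₀ hv']
      have hu0 : ‖v‖⁻¹ • v ≠ 0 := norm_ne_zero_iff.1 (by rw [hu]; exact one_ne_zero)
      have hsp : Submodule.span ℝ {‖v‖⁻¹ • v} = Submodule.span ℝ {v} :=
        Submodule.span_singleton_smul_eq (inv_ne_zero hv').isUnit v
      have hl := TwistedLift.ι hu0
      simp only [hsp] at hl
      have hq : CliffordAlgebra.ι (eucForm n) (‖v‖⁻¹ • v)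
          * CliffordAlgebra.ι (eucForm n) (‖v‖⁻¹ • v) = 1 := by rw [ι_mul_self, hu]; simp
      refine ⟨(ι_isUnit hu0).unit * x, -1 * ε, mul_mem (Subgroup.subset_closure ⟨_, rfl⟩) h1, ?_,
        ?_, ?_, ?_⟩
      · rw [List.map_cons, List.prod_cons]
        exact hl.mul h2
      · rw [Units.val_mul, IsUnit.unit_spec, star_mul, CliffordAlgebra.star_ι, mul_assoc,
          ← mul_assoc (-_), neg_mul, hq, neg_mul, one_mul, mul_neg, h3]
        simp
      · rw [Units.val_mul, IsUnit.unit_spec, star_mul, CliffordAlgebra.star_ι, mul_assoc,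
          ← mul_assoc (x : CliffordAlgebra (eucForm n)), h4, ← mul_assoc, ← Algebra.commutes,
          mul_assoc, mul_neg, hq]
        simp
      · rw [Units.val_mul, IsUnit.unit_spec]
        have h1' := CliffordAlgebra.ι_mem_evenOdd_one (eucForm n) (‖v‖⁻¹ • v)
        rcases h5 with ⟨rfl, h5⟩ | ⟨rfl, h5⟩
        · refine Or.inr ⟨by norm_num, ?_⟩
          simpa using CliffordAlgebra.evenOdd_mul_le (eucForm n) 1 0 (Submodule.mul_mem_mul h1' h5)
        · refine Or.inl ⟨by norm_num, ?_⟩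
          have := CliffordAlgebra.evenOdd_mul_le (eucForm n) 1 1 (Submodule.mul_mem_mul h1' h5)
          rwa [show (1 : ZMod 2) + 1 = 0 by decide] at this

/-- Every orientation-preserving isometry of `ℝⁿ` lifts to `Spin(n)`. -/
theorem exists_spinRot_eq_of_norm {n : ℕ} (R : GLPlus n) (hR : ∀ v, ‖R.1 v‖ = ‖v‖) :
    ∃ s : SpinGrp n, spinRot s = R := by
  let R₀ : Euc n →ₗᵢ[ℝ] Euc n := ⟨R.1, hR⟩
  let R' : Euc n ≃ₗᵢ[ℝ] Euc n := R₀.toLinearIsometryEquiv rfl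
  have hR' : ∀ v, R' v = R.1 v := fun v => rfl
  obtain ⟨l, -, hl⟩ := R'.reflections_generate_dim
  obtain ⟨x, ε, h1, h2, h3, h4, h5⟩ := lipschitz_lift_of_reflections l
  rw [← hl] at h2
  have hε : ε = 1 := by
    rcases h2.1 with h | h
    · exact h
    · exfalso
      have h6 := h2.2.2.1
      have h7 : LinearMap.det R'.toLinearEquiv.toLinearMap = R.1.det := rfl
      have := R.2
      rw [← h7, h6, h] at this
      norm_num at this
  subst hε
  have heven : (x : CliffordAlgebra (eucForm n)) ∈ CliffordAlgebra.evenOdd (eucForm n) 0 := by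
    rcases h5 with h | h
    · exact h.2
    · have := h.1
      norm_num at this
  refine ⟨⟨x, ⟨⟨x, h1, rfl⟩, ?_⟩, heven⟩, ?_⟩
  · change _ ∈ unitary _
    rw [Unitary.mem_iff, h3, h4, map_one]
    exact ⟨rfl, rfl⟩
  · refine (isSpinImage_iff.1 fun v => ?_).symm
    have := h2.2.2.2 v
    rwa [one_smul, hR'] at this

/-! ### The subgroup `Spin(n) ⊆ Spin(n+1)` -/

theorem spinIncl_coe {n : ℕ} (s : SpinGrp n) :
    (spinIncl n s : CliffordAlgebra (eucForm (n + 1))) = cliffordIncl n s := rfl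

@[simp] theorem spinIncl_one (n : ℕ) : spinIncl n 1 = 1 :=
  Subtype.ext (map_one (cliffordIncl n))

theorem spinIncl_mul {n : ℕ} (s t : SpinGrp n) :
    spinIncl n (s * t) = spinIncl n s * spinIncl n t :=
  Subtype.ext (map_mul (cliffordIncl n) _ _)

theorem spinIncl_injective (n : ℕ) : Function.Injective (spinIncl n) := fun _ _ h =>
  Subtype.ext (cliffordIncl_injective n (congrArg Subtype.val h))

theorem continuous_spinIncl (n : ℕ) : Continuous (spinIncl n) :=
  Continuous.subtype_mk ((continuous_clifford_linear (cliffordIncl n).toLinearMap).comp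
    continuous_spin_coe) _

theorem spinRot_spinIncl_eucFirst {n : ℕ} (s : SpinGrp n) :
    (spinRot (spinIncl n s)).1 (eucFirst n) = eucFirst n := by
  apply ι_injective
  have h1 := isSpinImage_spinRot (spinIncl n s) (eucFirst n)
  have h2 := cliffordIncl_mul_first (s : CliffordAlgebra (eucForm n))
  rw [spinGroup.involute_eq s.2] at h2
  have h3 := h1.symm.trans h2
  have h4 := congrArg (fun z => z * star (spinIncl n s : CliffordAlgebra (eucForm (n + 1)))) h3
  simpa only [mul_assoc, spin_mul_star, ← spinIncl_coe, mul_one] using h4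

theorem spinRot_spinIncl_eucIncl {n : ℕ} (s : SpinGrp n) (v : Euc n) :
    (spinRot (spinIncl n s)).1 (eucIncl n v) = eucIncl n ((spinRot s).1 v) := by
  apply ι_injective
  have h1 := isSpinImage_spinRot (spinIncl n s) (eucIncl n v)
  have h2 := congrArg (cliffordIncl n) (isSpinImage_spinRot s v)
  rw [map_mul, map_mul, cliffordIncl_ι, cliffordIncl_ι, ← spinIncl_coe] at h2
  have h4 := congrArg (fun z => z * star (spinIncl n s : CliffordAlgebra (eucForm (n + 1))))
    (h1.symm.trans h2)
  simpa only [mul_assoc, spin_mul_star, mul_one] using h4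

/-- An element of `Spin(n+1)` that fixes the first basis vector acts on the other coordinates. -/
theorem spinRot_eucIncl_zero {n : ℕ} {k : SpinGrp (n + 1)}
    (hk : (spinRot k).1 (eucFirst n) = eucFirst n) (v : Euc n) :
    (spinRot k).1 (eucIncl n v) = eucIncl n (eucTail n ((spinRot k).1 (eucIncl n v))) := by
  have h : (spinRot k).1 (eucIncl n v) 0 = 0 := by
    rw [← inner_eucFirst, ← hk, inner_spinRot, inner_eucFirst, eucIncl_zero_coord]
  conv_lhs => rw [← eucFirst_add_eucIncl ((spinRot k).1 (eucIncl n v)), h, zero_smul, zero_add]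

theorem eucTail_spinRot {n : ℕ} {k : SpinGrp (n + 1)}
    (hk : (spinRot k).1 (eucFirst n) = eucFirst n) (v : Euc (n + 1)) :
    eucTail n ((spinRot k).1 v) = eucTail n ((spinRot k).1 (eucIncl n (eucTail n v))) := by
  conv_lhs => rw [← eucFirst_add_eucIncl v]
  rw [map_add, map_smul, hk, map_add, map_smul, eucTail_eucFirst, smul_zero, zero_add]

/-- The restriction to `ℝⁿ` of the rotation of an element of `Spin(n+1)` that fixes the first
basis vector. -/
def stabRot {n : ℕ} (k : SpinGrp (n + 1)) (hk : (spinRot k).1 (eucFirst n) = eucFirst n) :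
    GLPlus n :=
  ⟨((eucTail n).comp (spinRot k).1).comp (eucIncl n), by
    have h := det_eq_of_tail_comp (C := (spinRot k).1)
      (A := ((eucTail n).comp (spinRot k).1).comp (eucIncl n)) (eucTail_spinRot hk)
    have h1 := (spinRot k).2
    rw [h, hk, eucFirst_zero_coord, one_mul] at h1
    exact h1⟩

theorem spinRot_eucIncl {n : ℕ} {k : SpinGrp (n + 1)}
    (hk : (spinRot k).1 (eucFirst n) = eucFirst n) (v : Euc n) :
    (spinRot k).1 (eucIncl n v) = eucIncl n ((stabRot k hk).1 v) :=
  spinRot_eucIncl_zero hk v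

theorem norm_stabRot {n : ℕ} {k : SpinGrp (n + 1)}
    (hk : (spinRot k).1 (eucFirst n) = eucFirst n) (v : Euc n) :
    ‖(stabRot k hk).1 v‖ = ‖v‖ := by
  rw [← norm_eucIncl, ← spinRot_eucIncl, norm_spinRot, norm_eucIncl]

theorem spinRot_eq_of_eucFirst {n : ℕ} {k l : SpinGrp (n + 1)}
    (hk : (spinRot k).1 (eucFirst n) = eucFirst n) (hl : (spinRot l).1 (eucFirst n) = eucFirst n)
    (h : stabRot k hk = stabRot l hl) : spinRot k = spinRot l := by
  refine Subtype.ext (ContinuousLinearMap.ext fun v => ?_)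
  rw [← eucFirst_add_eucIncl v, map_add, map_add, map_smul, map_smul, hk, hl, spinRot_eucIncl hk,
    spinRot_eucIncl hl, h]

theorem stabRot_spinIncl {n : ℕ} (s : SpinGrp n) :
    stabRot (spinIncl n s) (spinRot_spinIncl_eucFirst s) = spinRot s := by
  refine Subtype.ext (ContinuousLinearMap.ext fun v => ?_)
  change eucTail n ((spinRot (spinIncl n s)).1 (eucIncl n v)) = _
  rw [spinRot_spinIncl_eucIncl, eucTail_eucIncl]

theorem neg_one_mem_spinGroup {n : ℕ} (hn : n ≠ 0) :
    (-1 : CliffordAlgebra (eucForm n)) ∈ spinGroup (eucForm n) := by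
  obtain ⟨m, rfl⟩ := Nat.exists_eq_succ_of_ne_zero hn
  have h := ι_mul_ι_mem_spinGroup (u := eucFirst m) (v := -eucFirst m) norm_eucFirst
    (by rw [norm_neg, norm_eucFirst])
  rwa [map_neg, mul_neg, cliffordFirst_sq] at h

/-- For `n ≥ 1`, the stabilizer in `Spin(n+1)` of the first basis vector is `Spin(n)`. -/
theorem exists_spinIncl_eq {n : ℕ} (hn : n ≠ 0) {k : SpinGrp (n + 1)}
    (hk : (spinRot k).1 (eucFirst n) = eucFirst n) : ∃ s, spinIncl n s = k := by
  obtain ⟨s, hs⟩ := exists_spinRot_eq_of_norm (stabRot k hk) (norm_stabRot hk)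
  have h : spinRot (k * (spinIncl n s)⁻¹) = 1 := by
    rw [map_mul, map_inv, mul_inv_eq_one]
    exact spinRot_eq_of_eucFirst hk (spinRot_spinIncl_eucFirst s) (by rw [stabRot_spinIncl, hs])
  rcases spinRot_eq_one h with h1 | h1
  · exact ⟨s, (mul_inv_eq_one.1 (Subtype.ext h1)).symm⟩
  · refine ⟨⟨-1, neg_one_mem_spinGroup hn⟩ * s, ?_⟩
    have h2 : spinIncl n ⟨-1, neg_one_mem_spinGroup hn⟩ = k * (spinIncl n s)⁻¹ := by
      refine Subtype.ext (Eq.trans ?_ h1.symm)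
      rw [spinIncl_coe, map_neg, map_one]
    rw [spinIncl_mul, h2, inv_mul_cancel_right]

/-- The inverse of `Spin(n) → Spin(n+1)` is continuous on its image. -/
theorem continuous_of_spinIncl {n : ℕ} {T : Type*} [TopologicalSpace T] {r : T → SpinGrp n}
    (h : Continuous fun t => spinIncl n (r t)) : Continuous r := by
  obtain ⟨L, hL⟩ := (cliffordIncl n).toLinearMap.exists_leftInverse_of_injective
    (LinearMap.ker_eq_bot.2 (cliffordIncl_injective n))
  refine Topology.IsInducing.subtypeVal.continuous_iff.2 ?_
  have h1 : (Subtype.val ∘ r : T → CliffordAlgebra (eucForm n))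
      = fun t => L (spinIncl n (r t) : CliffordAlgebra (eucForm (n + 1))) :=
    funext fun t => (LinearMap.congr_fun hL _).symm
  exact ((continuous_clifford_linear L).comp (continuous_spin_coe.comp h)).congr
    fun t => (congrFun h1 t).symm

/-- The rotations of the elements of `Spin(1)` that fix the basis vector are trivial, so these
elements are `±1`. -/
theorem spin_one_cases (k : SpinGrp 1) (hk : (spinRot k).1 (eucFirst 0) = eucFirst 0) :
    k = 1 ∨ (k : CliffordAlgebra (eucForm 1)) = -1 := by
  have h : spinRot k = 1 := by
    refine Subtype.ext (ContinuousLinearMap.ext fun v => ?_)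
    rw [← eucFirst_add_eucIncl v, Subsingleton.elim (eucTail 0 v) 0, map_zero, add_zero, map_smul,
      hk]
    rfl
  exact (spinRot_eq_one h).imp_left fun h => Subtype.ext h

/-- The elements `1` and `-1` of the spin group are separated by the sign of a linear functional
that is `1` at `1`. -/
theorem exists_isOpen_spin_one (n : ℕ) : ∃ V : Set (SpinGrp n), IsOpen V ∧ 1 ∈ V ∧
    ∀ k : SpinGrp n, (k : CliffordAlgebra (eucForm n)) = -1 → k ∉ V ∧ ∃ W : Set (SpinGrp n),
      IsOpen W ∧ k ∈ W ∧ 1 ∉ W := by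
  obtain ⟨L, hL⟩ := LinearMap.exists_leftInverse_of_injective
    (Algebra.linearMap ℝ (CliffordAlgebra (eucForm n)))
    (LinearMap.ker_eq_bot.2 (algebraMap ℝ (CliffordAlgebra (eucForm n))).injective)
  have h1 : L 1 = 1 := by
    have := LinearMap.congr_fun hL (1 : ℝ)
    simpa using this
  have hc : Continuous fun s : SpinGrp n => L (s : CliffordAlgebra (eucForm n)) :=
    (continuous_clifford_linear L).comp continuous_spin_coe
  refine ⟨{s | 0 < L s}, isOpen_lt continuous_const hc, ?_, fun k hk => ⟨?_, {s | L s < 0},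
    isOpen_lt hc continuous_const, ?_, ?_⟩⟩
  · change 0 < L 1
    rw [h1]; exact one_pos
  · change ¬ 0 < L k
    rw [hk, map_neg, h1]; norm_num
  · change L k < 0
    rw [hk, map_neg, h1]; norm_num
  · change ¬ L 1 < 0
    rw [h1]; norm_num

/-! ### Coverings -/

theorem ncard_fiber_univ {P S : Type*} (p : P → S) (x : ↥(univ : Set S)) :
    ((fun q => (⟨p q, mem_univ _⟩ : ↥(univ : Set S))) ⁻¹' {x}).ncard = (p ⁻¹' {x.1}).ncard := by
  congr 1
  ext q
  exact ⟨fun h => congrArg Subtype.val h, fun h => Subtype.ext h⟩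

section Coverings

variable {Z Y P S : Type*} [TopologicalSpace Z] [TopologicalSpace Y] [TopologicalSpace P]
  [TopologicalSpace S]

/-- The map `π : Z → Y` is, over the open set `W`, the pullback of `ϖ : P → S` along a map
`σ : W → S`. The second component of the identification of `π⁻¹(W)` with the pullback is `g`, its
inverse is `s`. All maps are total functions whose values outside of the relevant sets are
irrelevant. -/
structure LocalPullback (π : Z → Y) (ϖ : P → S) (W : Set Y) where
  σ : Y → S
  g : Z → P
  s : Y → P → Z
  continuousOn_σ : ContinuousOn σ W
  continuousOn_g : ContinuousOn g (π ⁻¹' W)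
  continuousOn_s : ContinuousOn (fun q : Y × P => s q.1 q.2) {q | q.1 ∈ W ∧ ϖ q.2 = σ q.1}
  proj_g : ∀ z, π z ∈ W → ϖ (g z) = σ (π z)
  proj_s : ∀ y ∈ W, ∀ p, ϖ p = σ y → π (s y p) = y
  g_s : ∀ y ∈ W, ∀ p, ϖ p = σ y → g (s y p) = p
  s_g : ∀ z, π z ∈ W → s (π z) (g z) = z

theorem LocalPullback.isEvenlyCovered {π : Z → Y} {ϖ : P → S} {W : Set Y}
    (L : LocalPullback π ϖ W) (hπ : Continuous π) (hϖ : IsCoveringMap ϖ) (hW : IsOpen W) {y : Y}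
    (hy : y ∈ W) : IsEvenlyCovered π y (ϖ ⁻¹' {L.σ y}) := by
  obtain ⟨hd, U, hU, hUo, -, H, hH⟩ := hϖ (L.σ y)
  have hWo : IsOpen (W ∩ L.σ ⁻¹' U) := L.continuousOn_σ.isOpen_inter_preimage hW hUo
  have hg : ∀ z : π ⁻¹' (W ∩ L.σ ⁻¹' U), L.g z ∈ ϖ ⁻¹' U := fun z => by
    change ϖ (L.g z) ∈ U
    rw [L.proj_g z z.2.1]
    exact z.2.2
  have hs : ∀ q : (W ∩ L.σ ⁻¹' U : Set Y) × (ϖ ⁻¹' {L.σ y}),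
      ϖ (H.symm (⟨L.σ q.1, q.1.2.2⟩, q.2)) = L.σ q.1 := fun q => by
    rw [← hH, H.apply_symm_apply]
  refine ⟨hd, W ∩ L.σ ⁻¹' U, ⟨hy, hU⟩, hWo, hWo.preimage hπ, ?_, ?_⟩
  · refine
      { toFun := fun z => (⟨π z, z.2⟩, (H ⟨L.g z, hg z⟩).2)
        invFun := fun q => ⟨L.s q.1 (H.symm (⟨L.σ q.1, q.1.2.2⟩, q.2)), by
          change π _ ∈ W ∩ L.σ ⁻¹' U
          rw [L.proj_s _ q.1.2.1 _ (hs q)]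
          exact q.1.2⟩
        left_inv := ?_
        right_inv := ?_
        continuous_toFun := ?_
        continuous_invFun := ?_ }
    · intro z
      refine Subtype.ext ?_
      have h1 : ((⟨L.σ (π z), z.2.2⟩ : U), (H ⟨L.g z, hg z⟩).2) = H ⟨L.g z, hg z⟩ :=
        Prod.ext (Subtype.ext (by rw [hH]; exact (L.proj_g z z.2.1).symm)) rfl
      change L.s (π z) (H.symm ((⟨L.σ (π z), z.2.2⟩ : U), (H ⟨L.g z, hg z⟩).2)) = z
      rw [h1, H.symm_apply_apply]
      exact L.s_g z z.2.1
    · intro q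
      refine Prod.ext (Subtype.ext (L.proj_s _ q.1.2.1 _ (hs q))) ?_
      have h1 : (⟨L.g (L.s q.1 (H.symm (⟨L.σ q.1, q.1.2.2⟩, q.2))), by
          rw [L.g_s _ q.1.2.1 _ (hs q)]; exact Subtype.coe_prop _⟩ : ϖ ⁻¹' U)
          = H.symm (⟨L.σ q.1, q.1.2.2⟩, q.2) :=
        Subtype.ext (L.g_s _ q.1.2.1 _ (hs q))
      change (H ⟨L.g (L.s q.1 (H.symm (⟨L.σ q.1, q.1.2.2⟩, q.2))), _⟩).2 = q.2
      rw [h1, H.apply_symm_apply]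
    · refine Continuous.prodMk ((hπ.comp continuous_subtype_val).subtype_mk _) ?_
      refine continuous_snd.comp (H.continuous.comp (Continuous.subtype_mk ?_ _))
      exact L.continuousOn_g.comp_continuous continuous_subtype_val fun z => z.2.1
    · refine Continuous.subtype_mk ?_ _
      refine L.continuousOn_s.comp_continuous (f := fun q : (W ∩ L.σ ⁻¹' U : Set Y) ×
        (ϖ ⁻¹' {L.σ y}) => ((q.1 : Y), (H.symm (⟨L.σ q.1, q.1.2.2⟩, q.2) : P))) ?_
        fun q => ⟨q.1.2.1, hs q⟩
      refine (continuous_subtype_val.comp continuous_fst).prodMk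
        (continuous_subtype_val.comp (H.symm.continuous.comp (Continuous.prodMk
          (Continuous.subtype_mk ?_ _) continuous_snd)))
      exact L.continuousOn_σ.comp_continuous (continuous_subtype_val.comp continuous_fst)
        fun q => q.1.2.1
  · intro z
    rfl

theorem LocalPullback.ncard_fiber {π : Z → Y} {ϖ : P → S} {W : Set Y}
    (L : LocalPullback π ϖ W) {y : Y} (hy : y ∈ W) :
    (π ⁻¹' {y}).ncard = (ϖ ⁻¹' {L.σ y}).ncard := by
  refine Set.ncard_congr (fun z _ => L.g z) ?_ ?_ ?_
  · rintro z rfl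
    exact L.proj_g z hy
  · rintro z z' hz hz' h
    have hz : π z = y := hz
    have hz' : π z' = y := hz'
    rw [← L.s_g z (hz ▸ hy), ← L.s_g z' (hz' ▸ hy), h, hz, hz']
  · intro p hp
    exact ⟨L.s y p, L.proj_s y hy p hp, L.g_s y hy p hp⟩

theorem isCoveringMap_of_localPullback {π : Z → Y} {ϖ : P → S} (hπ : Continuous π)
    (hϖ : IsCoveringMap ϖ)
    (h : ∀ y, ∃ W : Set Y, IsOpen W ∧ y ∈ W ∧ Nonempty (LocalPullback π ϖ W)) :
    IsCoveringMap π := fun y => by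
  obtain ⟨W, hW, hy, ⟨L⟩⟩ := h y
  exact (L.isEvenlyCovered hπ hϖ hW hy).to_isEvenlyCovered_preimage

theorem ncard_fiber_of_localPullback {π : Z → Y} {ϖ : P → S} {k : ℕ}
    (hϖ : ∀ x, (ϖ ⁻¹' {x}).ncard = k)
    (h : ∀ y, ∃ W : Set Y, IsOpen W ∧ y ∈ W ∧ Nonempty (LocalPullback π ϖ W)) (y : Y) :
    (π ⁻¹' {y}).ncard = k := by
  obtain ⟨W, -, hy, ⟨L⟩⟩ := h y
  rw [L.ncard_fiber hy, hϖ]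

/-- The pullback of a finite covering along a continuous map. -/
theorem exists_localPullback_pullback {ϖ : P → S} {k : ℕ} (hk : k ≠ 0)
    (h : ∀ x, (ϖ ⁻¹' {x}).ncard = k) {σ : Y → S} (hσ : Continuous σ) (y₀ : Y) :
    ∃ W : Set Y, IsOpen W ∧ y₀ ∈ W ∧
      Nonempty (LocalPullback (fun q : {q : Y × P // σ q.1 = ϖ q.2} => q.1.1) ϖ W) := by
  classical
  have hne : Nonempty {q : Y × P // σ q.1 = ϖ q.2} := by
    obtain ⟨p, hp⟩ : (ϖ ⁻¹' {σ y₀}).Nonempty :=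
      Set.nonempty_of_ncard_ne_zero (by rw [h]; exact hk)
    exact ⟨⟨(y₀, p), hp.symm⟩⟩
  let s : Y → P → {q : Y × P // σ q.1 = ϖ q.2} := fun y p =>
    if h : σ y = ϖ p then ⟨(y, p), h⟩ else hne.some
  have hs : ∀ y p (h : ϖ p = σ y), s y p = ⟨(y, p), h.symm⟩ := fun y p h => dif_pos h.symm
  refine ⟨univ, isOpen_univ, mem_univ _, ⟨{
    σ := σ
    g := fun q => q.1.2
    s := s
    continuousOn_σ := hσ.continuousOn
    continuousOn_g := (continuous_snd.comp continuous_subtype_val).continuousOn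
    continuousOn_s := ?_
    proj_g := fun q _ => q.2.symm
    proj_s := fun y _ p h => by rw [hs y p h]
    g_s := fun y _ p h => by rw [hs y p h]
    s_g := fun q _ => by rw [hs _ _ q.2.symm] }⟩⟩
  rw [continuousOn_iff_continuous_domRestrict]
  have h1 : Continuous fun q : {q : Y × P | q.1 ∈ univ ∧ ϖ q.2 = σ q.1} =>
      (⟨q.1, q.2.2.symm⟩ : {q : Y × P // σ q.1 = ϖ q.2}) :=
    Continuous.subtype_mk continuous_subtype_val _
  exact h1.congr fun q => (hs _ _ q.2.2).symm

theorem isCoveringMap_pullback {ϖ : P → S} (hϖ : IsCoveringMap ϖ) {k : ℕ} (hk : k ≠ 0)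
    (h : ∀ x, (ϖ ⁻¹' {x}).ncard = k) {σ : Y → S} (hσ : Continuous σ) :
    IsCoveringMap (fun q : {q : Y × P // σ q.1 = ϖ q.2} => q.1.1) :=
  isCoveringMap_of_localPullback (continuous_fst.comp continuous_subtype_val) hϖ
    (exists_localPullback_pullback hk h hσ)

theorem ncard_fiber_pullback {ϖ : P → S} {k : ℕ} (hk : k ≠ 0) (h : ∀ x, (ϖ ⁻¹' {x}).ncard = k)
    {σ : Y → S} (hσ : Continuous σ) (y : Y) :
    ((fun q : {q : Y × P // σ q.1 = ϖ q.2} => q.1.1) ⁻¹' {y}).ncard = k :=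
  ncard_fiber_of_localPullback h (exists_localPullback_pullback hk h hσ) y

/-- A two-sheeted covering has a continuous involution that exchanges the sheets. -/
theorem exists_sheet_swap {ϖ : P → S} (hϖ : IsCoveringMap ϖ)
    (h2 : ∀ x, (ϖ ⁻¹' {x}).ncard = 2) :
    ∃ sw : P → P, Continuous sw ∧ (∀ p, ϖ (sw p) = ϖ p) ∧ (∀ p, sw p ≠ p) ∧
      ∀ p q, ϖ q = ϖ p → q ≠ p → q = sw p := by
  have hex : ∀ p, ∃ q, ϖ q = ϖ p ∧ q ≠ p ∧ ∀ r, ϖ r = ϖ p → r ≠ p → r = q := by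
    intro p
    obtain ⟨a, b, hab, hF⟩ := Set.ncard_eq_two.1 (h2 (ϖ p))
    have hmem : ∀ r, ϖ r = ϖ p ↔ r = a ∨ r = b := fun r => by
      have : r ∈ ϖ ⁻¹' {ϖ p} ↔ r ∈ ({a, b} : Set P) := by rw [hF]
      exact this
    rcases (hmem p).1 rfl with rfl | rfl
    · exact ⟨b, (hmem b).2 (Or.inr rfl), hab.symm, fun r hr hrp =>
        ((hmem r).1 hr).resolve_left hrp⟩
    · exact ⟨a, (hmem a).2 (Or.inl rfl), hab, fun r hr hrp =>
        ((hmem r).1 hr).resolve_right hrp⟩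
  choose sw h1 h3 h4 using hex
  refine ⟨sw, continuous_iff_continuousAt.2 fun p₀ => ?_, h1, h3, h4⟩
  obtain ⟨e, he, hee⟩ := hϖ.isLocalHomeomorph (sw p₀)
  obtain ⟨V₁, V₂, hV₁, hV₂, hp, hq, hd⟩ := hϖ.isSeparatedMap p₀ (sw p₀) (h1 p₀).symm (h3 p₀).symm
  have htar : ϖ p₀ ∈ e.target := by
    rw [← h1 p₀, hee]
    exact e.map_source he
  have hval : e.symm (ϖ p₀) = sw p₀ := by
    rw [← h1 p₀, hee]
    exact e.left_inv he
  have hc : ContinuousAt (fun p => e.symm (ϖ p)) p₀ :=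
    ContinuousAt.comp (e.continuousAt_symm htar) hϖ.continuous.continuousAt
  have hev : (fun p => e.symm (ϖ p)) =ᶠ[𝓝 p₀] sw := by
    have e1 : ∀ᶠ p in 𝓝 p₀, p ∈ V₁ := hV₁.mem_nhds hp
    have e2 : ∀ᶠ p in 𝓝 p₀, e.symm (ϖ p) ∈ V₂ :=
      hc.eventually (hV₂.mem_nhds (by change e.symm (ϖ p₀) ∈ V₂; rw [hval]; exact hq))
    have e3 : ∀ᶠ p in 𝓝 p₀, ϖ p ∈ e.target :=
      hϖ.continuous.continuousAt.eventually (e.open_target.mem_nhds htar)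
    filter_upwards [e1, e2, e3] with p hp1 hp2 hp3
    refine h4 p _ ?_ ?_
    · exact (congrFun hee _).trans (e.right_inv hp3)
    · intro heq
      exact Set.disjoint_left.1 hd hp1 (heq ▸ hp2)
  exact hc.congr hev

/-- Restriction of an open quotient map to a saturated subset. -/
theorem IsOpenQuotientMap.restrict_preimage {f : Z → Y} (hf : IsOpenQuotientMap f) (T : Set Y) :
    IsOpenQuotientMap (fun z : f ⁻¹' T => (⟨f z, z.2⟩ : T)) where
  surjective := fun y => by
    obtain ⟨z, hz⟩ := hf.surjective y
    exact ⟨⟨z, by rw [mem_preimage, hz]; exact y.2⟩, Subtype.ext hz⟩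
  continuous := (hf.continuous.comp continuous_subtype_val).subtype_mk _
  isOpenMap := hf.isOpenMap.restrictPreimage T

end Coverings

/-! ### Chart groups and local lifts -/

theorem det_ne_zero_of_bijective {m : ℕ} {A : Euc m →L[ℝ] Euc m} (h : Function.Bijective A) :
    A.det ≠ 0 := by
  have : IsUnit (A : Euc m →ₗ[ℝ] Euc m) := (Module.End.isUnit_iff _).2 h
  exact ((LinearMap.isUnit_iff_isUnit_det _).1 this).ne_zero

theorem bijective_of_det_ne_zero {m : ℕ} {A : Euc m →L[ℝ] Euc m} (h : A.det ≠ 0) :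
    Function.Bijective A :=
  (A.toContinuousLinearEquivOfDetNeZero h).bijective

/-- If an open set is covered by finitely many relatively closed subsets, one of these subsets
has an interior point. -/
theorem exists_open_subset_of_finite_cover {E ι : Type*} [TopologicalSpace E] (s : Finset ι)
    (Z : ι → Set E) {V : Set E} (hV : IsOpen V) (hne : V.Nonempty)
    (hZ : ∀ i, IsOpen (V \ Z i)) (hc : ∀ x ∈ V, ∃ i ∈ s, x ∈ Z i) :
    ∃ i ∈ s, ∃ V' ⊆ V, IsOpen V' ∧ V'.Nonempty ∧ V' ⊆ Z i := by
  classical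
  induction s using Finset.induction_on generalizing V with
  | empty =>
    obtain ⟨x, hx⟩ := hne
    obtain ⟨i, hi, -⟩ := hc x hx
    simp at hi
  | insert j s hj ih =>
    by_cases hsub : V ⊆ Z j
    · exact ⟨j, Finset.mem_insert_self j s, V, Subset.rfl, hV, hne, hsub⟩
    · have hne' : (V \ Z j).Nonempty := by
        obtain ⟨x, hx, hxj⟩ := Set.not_subset.1 hsub
        exact ⟨x, hx, hxj⟩
      obtain ⟨i, hi, V', h1, h2, h3, h4⟩ := ih (hZ j) hne' (fun i => by
        have : (V \ Z j) \ Z i = (V \ Z j) ∩ (V \ Z i) := by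
          ext x; simp only [Set.mem_sdiff, mem_inter_iff]; tauto
        rw [this]
        exact (hZ j).inter (hZ i)) (fun x hx => by
        obtain ⟨i, hi, hxi⟩ := hc x hx.1
        rcases Finset.mem_insert.1 hi with rfl | hi
        · exact absurd hxi hx.2
        · exact ⟨i, hi, hxi⟩)
      exact ⟨i, Finset.mem_insert_of_mem hi, V', h1.trans sdiff_subset, h2, h3, h4⟩

theorem continuousAt_fderiv {k m : ℕ} {ψ : Euc k → Euc m} {x : Euc k} (h : ContDiffAt ℝ ∞ ψ x) :
    ContinuousAt (fderiv ℝ ψ) x :=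
  (h.fderiv_right (m := 0) (by simp)).continuousAt

theorem ContDiffAt.differentiableAt_smooth {k m : ℕ} {ψ : Euc k → Euc m} {x : Euc k}
    (h : ContDiffAt ℝ ∞ ψ x) : DifferentiableAt ℝ ψ x :=
  h.differentiableAt (by simp)

/-- A local inverse of a map that is smooth near `x` and has an invertible derivative at `x`. -/
theorem exists_smooth_local_inverse {m : ℕ} {η : Euc m → Euc m} {x : Euc m}
    (hη : ∀ᶠ z in 𝓝 x, ContDiffAt ℝ ∞ η z) (hd : (fderiv ℝ η x).det ≠ 0) :
    ∃ ζ : Euc m → Euc m, ζ (η x) = x ∧ (∀ᶠ w in 𝓝 (η x), ContDiffAt ℝ ∞ ζ w ∧ η (ζ w) = w) ∧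
      ∀ᶠ z in 𝓝 x, ζ (η z) = z := by
  have hx : ContDiffAt ℝ ∞ η x := hη.self_of_nhds
  have hder : HasFDerivAt η ((fderiv ℝ η x).toContinuousLinearEquivOfDetNeZero hd :
      Euc m →L[ℝ] Euc m) x := by
    rw [ContinuousLinearMap.coe_toContinuousLinearEquivOfDetNeZero]
    exact hx.differentiableAt_smooth.hasFDerivAt
  let e := hx.toOpenPartialHomeomorph η hder (by simp)
  have hee : ∀ z, e z = η z := fun z => rfl
  have hxs : x ∈ e.source := hx.mem_toOpenPartialHomeomorph_source hder (by simp)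
  have hxt : η x ∈ e.target := e.map_source hxs
  have hsymm : e.symm (η x) = x := e.left_inv hxs
  refine ⟨e.symm, hsymm, ?_, ?_⟩
  · have hdet : ∀ᶠ z in 𝓝 x, (fderiv ℝ η z).det ≠ 0 :=
      (GLPlus.continuous_det.continuousAt.comp (continuousAt_fderiv hx)).eventually_ne hd
    have hc : ContinuousAt e.symm (η x) := e.continuousAt_symm hxt
    have hev : ∀ᶠ w in 𝓝 (η x), ContDiffAt ℝ ∞ η (e.symm w) ∧
        (fderiv ℝ η (e.symm w)).det ≠ 0 := by
      refine Tendsto.eventually (p := fun z => ContDiffAt ℝ ∞ η z ∧ (fderiv ℝ η z).det ≠ 0) hc ?_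
      rw [hsymm]
      exact hη.and hdet
    filter_upwards [hev, e.open_target.mem_nhds hxt] with w hw hwt
    refine ⟨?_, e.right_inv hwt⟩
    refine e.contDiffAt_symm
      (f₀' := (fderiv ℝ η (e.symm w)).toContinuousLinearEquivOfDetNeZero hw.2)
      hwt ?_ hw.1
    rw [ContinuousLinearMap.coe_toContinuousLinearEquivOfDetNeZero]
    exact hw.1.differentiableAt_smooth.hasFDerivAt
  · filter_upwards [e.open_source.mem_nhds hxs] with z hz
    exact e.left_inv hz

namespace OrbifoldChart

variable {m : ℕ} {Y : Type u} [TopologicalSpace Y] (c : OrbifoldChart m Y)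

open Classical in
/-- A smooth extension to `ℝᵐ` (in the sense of a total function) of an element of the chart
group. -/
def ext (γ : Equiv.Perm c.U) : Euc m → Euc m :=
  if h : γ ∈ c.Γ then (c.smooth_Γ γ h).choose else id

variable {c}

theorem ext_apply {γ : Equiv.Perm c.U} (h : γ ∈ c.Γ) (x : c.U) : c.ext γ x = γ x := by
  rw [ext, dif_pos h]
  exact (c.smooth_Γ γ h).choose_spec.2 x

theorem ext_apply' {γ : Equiv.Perm c.U} (h : γ ∈ c.Γ) {x : Euc m} (hx : x ∈ c.U) :
    c.ext γ x = γ ⟨x, hx⟩ :=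
  ext_apply h ⟨x, hx⟩

theorem ext_mem {γ : Equiv.Perm c.U} (h : γ ∈ c.Γ) {x : Euc m} (hx : x ∈ c.U) :
    c.ext γ x ∈ c.U := by
  rw [ext_apply' h hx]
  exact Subtype.coe_prop _

theorem contDiffAt_ext {γ : Equiv.Perm c.U} (h : γ ∈ c.Γ) {x : Euc m} (hx : x ∈ c.U) :
    ContDiffAt ℝ ∞ (c.ext γ) x := by
  have : ContDiffOn ℝ ∞ (c.ext γ) c.U := by
    rw [ext, dif_pos h]
    exact (c.smooth_Γ γ h).choose_spec.1
  exact this.contDiffAt (c.isOpen_U.mem_nhds hx)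

theorem φ_ext {γ : Equiv.Perm c.U} (h : γ ∈ c.Γ) {x : Euc m} (hx : x ∈ c.U) :
    c.φ (c.ext γ x) = c.φ x := by
  rw [ext_apply' h hx]
  exact ((c.φ_eq_iff ⟨x, hx⟩ (γ ⟨x, hx⟩)).2 ⟨γ, h, rfl⟩).symm

theorem exists_ext_eq {x y : Euc m} (hx : x ∈ c.U) (hy : y ∈ c.U) (h : c.φ x = c.φ y) :
    ∃ γ ∈ c.Γ, c.ext γ x = y := by
  obtain ⟨γ, hγ, hxy⟩ := (c.φ_eq_iff ⟨x, hx⟩ ⟨y, hy⟩).1 h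
  exact ⟨γ, hγ, by rw [ext_apply' hγ hx, hxy]⟩

theorem ext_one {x : Euc m} (hx : x ∈ c.U) : c.ext 1 x = x := by
  rw [ext_apply' (one_mem _) hx]; rfl

theorem ext_mul {γ δ : Equiv.Perm c.U} (hγ : γ ∈ c.Γ) (hδ : δ ∈ c.Γ) {x : Euc m} (hx : x ∈ c.U) :
    c.ext (γ * δ) x = c.ext γ (c.ext δ x) := by
  rw [ext_apply' (mul_mem hγ hδ) hx, ext_apply' hδ hx, ext_apply hγ]; rfl

theorem fderiv_ext_one {x : Euc m} (hx : x ∈ c.U) :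
    fderiv ℝ (c.ext 1) x = ContinuousLinearMap.id ℝ _ := by
  have : c.ext 1 =ᶠ[𝓝 x] id := by
    filter_upwards [c.isOpen_U.mem_nhds hx] with z hz
    exact ext_one hz
  rw [this.fderiv_eq, fderiv_id]

theorem fderiv_ext_mul {γ δ : Equiv.Perm c.U} (hγ : γ ∈ c.Γ) (hδ : δ ∈ c.Γ) {x : Euc m}
    (hx : x ∈ c.U) : fderiv ℝ (c.ext (γ * δ)) x
      = (fderiv ℝ (c.ext γ) (c.ext δ x)).comp (fderiv ℝ (c.ext δ) x) := by
  have : c.ext (γ * δ) =ᶠ[𝓝 x] c.ext γ ∘ c.ext δ := by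
    filter_upwards [c.isOpen_U.mem_nhds hx] with z hz
    exact ext_mul hγ hδ hz
  rw [this.fderiv_eq]
  exact fderiv_comp x (contDiffAt_ext hγ (ext_mem hδ hx)).differentiableAt_smooth
    (contDiffAt_ext hδ hx).differentiableAt_smooth

theorem fderiv_ext_inv_comp {γ : Equiv.Perm c.U} (hγ : γ ∈ c.Γ) {x : Euc m} (hx : x ∈ c.U) :
    (fderiv ℝ (c.ext γ⁻¹) (c.ext γ x)).comp (fderiv ℝ (c.ext γ) x)
      = ContinuousLinearMap.id ℝ _ := by
  rw [← fderiv_ext_mul (inv_mem hγ) hγ hx, inv_mul_cancel, fderiv_ext_one hx]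

theorem fderiv_ext_bijective {γ : Equiv.Perm c.U} (hγ : γ ∈ c.Γ) {x : Euc m} (hx : x ∈ c.U) :
    Function.Bijective (fderiv ℝ (c.ext γ) x) := by
  refine bijective_of_det_ne_zero fun h => ?_
  have := congrArg ContinuousLinearMap.det (fderiv_ext_inv_comp hγ hx)
  rw [GLPlus.det_comp, h, mul_zero, GLPlus.det_id] at this
  exact zero_ne_one this

/-- An element of finite order of the chart group with the `1`-jet of the identity at `x` is the
identity near `x`: the average of its powers is a local diffeomorphism that it leaves
invariant. -/
theorem eventually_ext_eq_of_jet {γ : Equiv.Perm c.U} (hγ : γ ∈ c.Γ) {x : Euc m} (hx : x ∈ c.U)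
    (h0 : c.ext γ x = x) (h1 : fderiv ℝ (c.ext γ) x = ContinuousLinearMap.id ℝ _) :
    ∀ᶠ y in 𝓝 x, c.ext γ y = y := by
  have hfin : Finite c.Γ := c.finite_Γ
  have hord : IsOfFinOrder γ := by
    have h := isOfFinOrder_of_finite (⟨γ, hγ⟩ : c.Γ)
    exact (Submonoid.isOfFinOrder_coe (H := c.Γ.toSubmonoid)).2 h
  set k := orderOf γ with hk
  have hkpos : 0 < k := hord.orderOf_pos
  have hpow : ∀ j : ℕ, γ ^ j ∈ c.Γ := fun j => pow_mem hγ j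
  -- `s` is invariant under `γ`, and its derivative at `x` is `k` times the identity
  let s : Euc m → Euc m := fun y => ∑ j ∈ Finset.range k, c.ext (γ ^ j) y
  have hs : ∀ᶠ y in 𝓝 x, ContDiffAt ℝ ∞ s y := by
    filter_upwards [c.isOpen_U.mem_nhds hx] with y hy
    exact ContDiffAt.sum fun j _ => contDiffAt_ext (hpow j) hy
  have hjet : ∀ j : ℕ, c.ext (γ ^ j) x = x ∧
      fderiv ℝ (c.ext (γ ^ j)) x = ContinuousLinearMap.id ℝ _ := by
    intro j
    induction j with
    | zero => exact ⟨by rw [pow_zero, ext_one hx], by rw [pow_zero, fderiv_ext_one hx]⟩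
    | succ j ih =>
      rw [pow_succ, ext_mul (hpow j) hγ hx, fderiv_ext_mul (hpow j) hγ hx, h0, h1, ih.1, ih.2]
      exact ⟨rfl, ContinuousLinearMap.comp_id _⟩
  have hder : fderiv ℝ s x = (k : ℝ) • ContinuousLinearMap.id ℝ (Euc m) := by
    have : fderiv ℝ s x = ∑ j ∈ Finset.range k, fderiv ℝ (c.ext (γ ^ j)) x :=
      fderiv_fun_sum fun j _ => (contDiffAt_ext (hpow j) hx).differentiableAt_smooth
    rw [this, Finset.sum_congr rfl fun j _ => (hjet j).2, Finset.sum_const, Finset.card_range]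
    exact (Nat.cast_smul_eq_nsmul ℝ k _).symm
  have hdet : (fderiv ℝ s x).det ≠ 0 := by
    apply det_ne_zero_of_bijective
    rw [hder]
    have hk0 : (k : ℝ) ≠ 0 := by exact_mod_cast hkpos.ne'
    exact ⟨fun v w h => by simpa [hk0] using h, fun w => ⟨(k : ℝ)⁻¹ • w, by simp [smul_smul, hk0]⟩⟩
  obtain ⟨ζ, -, -, hζ⟩ := exists_smooth_local_inverse hs hdet
  have hcont : ContinuousAt (c.ext γ) x := (contDiffAt_ext hγ hx).continuousAt
  have hζ' : ∀ᶠ y in 𝓝 x, ζ (s (c.ext γ y)) = c.ext γ y := by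
    refine Tendsto.eventually (p := fun y => ζ (s y) = y) hcont ?_
    rw [h0]
    exact hζ
  filter_upwards [hζ, hζ', c.isOpen_U.mem_nhds hx] with y hy hy' hyU
  have hinv : s (c.ext γ y) = s y := by
    have h3 : ∀ j, c.ext (γ ^ j) (c.ext γ y) = c.ext (γ ^ (j + 1)) y := fun j => by
      rw [pow_succ, ext_mul (hpow j) hγ hyU]
    change ∑ j ∈ Finset.range k, c.ext (γ ^ j) (c.ext γ y)
      = ∑ j ∈ Finset.range k, c.ext (γ ^ j) y
    rw [Finset.sum_congr rfl fun j _ => h3 j]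
    have h4 := Finset.sum_range_succ' (fun j => c.ext (γ ^ j) y) k
    rw [Finset.sum_range_succ, hk, pow_orderOf_eq_one, pow_zero] at h4
    exact (add_right_cancel h4).symm
  rw [← hy', hinv, hy]

/-- The chart group acts freely on frames. -/
theorem eq_one_of_jet {γ : Equiv.Perm c.U} (hγ : γ ∈ c.Γ) {x : Euc m} (hx : x ∈ c.U)
    (h0 : c.ext γ x = x) (h1 : fderiv ℝ (c.ext γ) x = ContinuousLinearMap.id ℝ _) : γ = 1 := by
  let S : Set (Euc m) := {y | ∀ᶠ z in 𝓝 y, c.ext γ z = z}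
  have hS : IsOpen S := isOpen_setOfPred_eventually_nhds
  have hsub : c.U ⊆ S := by
    refine c.isConnected_U.isPreconnected.subset_of_closure_inter_subset hS
      ⟨x, hx, eventually_ext_eq_of_jet hγ hx h0 h1⟩ ?_
    rintro y ⟨hy, hyU⟩
    have hfr : ∃ᶠ z in 𝓝 y, z ∈ S := mem_closure_iff_frequently.1 hy
    have hs := contDiffAt_ext hγ hyU
    refine eventually_ext_eq_of_jet hγ hyU ?_ ?_
    · exact tendsto_nhds_unique_of_frequently_eq hs.continuousAt continuousAt_id
        (hfr.mono fun z hz => hz.self_of_nhds)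
    · refine tendsto_nhds_unique_of_frequently_eq (continuousAt_fderiv hs)
        (tendsto_const_nhds (x := ContinuousLinearMap.id ℝ (Euc m))) (hfr.mono fun z hz => ?_)
      have : c.ext γ =ᶠ[𝓝 z] id := hz
      rw [this.fderiv_eq, fderiv_id]
  refine Equiv.ext fun y => Subtype.ext ?_
  rw [← ext_apply hγ]
  exact (hsub y.2).self_of_nhds

theorem eq_of_jet {γ δ : Equiv.Perm c.U} (hγ : γ ∈ c.Γ) (hδ : δ ∈ c.Γ) {x : Euc m} (hx : x ∈ c.U)
    (h0 : c.ext γ x = c.ext δ x) (h1 : fderiv ℝ (c.ext γ) x = fderiv ℝ (c.ext δ) x) : γ = δ := by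
  have h : δ⁻¹ * γ = 1 := by
    refine eq_one_of_jet (mul_mem (inv_mem hδ) hγ) hx ?_ ?_
    · rw [ext_mul (inv_mem hδ) hγ hx, h0, ← ext_mul (inv_mem hδ) hδ hx, inv_mul_cancel, ext_one hx]
    · rw [fderiv_ext_mul (inv_mem hδ) hγ hx, h0, h1, fderiv_ext_inv_comp hδ hx]
  exact (inv_mul_eq_one.1 h).symm

end OrbifoldChart

section LocalLifts

open OrbifoldChart

variable {X Y : Type u} [TopologicalSpace Y] {k m : ℕ}

theorem IsLocalLift.mem {F : X → Y} {σ : Euc k → X} {c : OrbifoldChart m Y} {ψ : Euc k → Euc m}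
    {x : Euc k} (h : IsLocalLift F σ c ψ x) : ψ x ∈ c.U :=
  h.self_of_nhds.2.1

theorem IsLocalLift.map_eq {F : X → Y} {σ : Euc k → X} {c : OrbifoldChart m Y}
    {ψ : Euc k → Euc m} {x : Euc k} (h : IsLocalLift F σ c ψ x) : c.φ (ψ x) = F (σ x) :=
  h.self_of_nhds.2.2

theorem IsLocalLift.contDiffAt {F : X → Y} {σ : Euc k → X} {c : OrbifoldChart m Y}
    {ψ : Euc k → Euc m} {x : Euc k} (h : IsLocalLift F σ c ψ x) : ContDiffAt ℝ ∞ ψ x :=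
  h.self_of_nhds.1

theorem IsLocalLift.eventually {F : X → Y} {σ : Euc k → X} {c : OrbifoldChart m Y}
    {ψ : Euc k → Euc m} {x : Euc k} (h : IsLocalLift F σ c ψ x) :
    ∀ᶠ z in 𝓝 x, IsLocalLift F σ c ψ z :=
  eventually_eventually_nhds.2 h

theorem IsLocalLift.precomp {F : X → Y} {σ : Euc k → X} {c : OrbifoldChart m Y}
    {ψ : Euc k → Euc m} {l : ℕ} {τ : Euc l → X} {β : Euc l → Euc k} {x : Euc l}
    (h : IsLocalLift F σ c ψ (β x)) (hβ : ∀ᶠ z in 𝓝 x, ContDiffAt ℝ ∞ β z)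
    (hτ : ∀ᶠ z in 𝓝 x, σ (β z) = τ z) : IsLocalLift F τ c (ψ ∘ β) x := by
  have h1 := hβ.self_of_nhds.continuousAt.eventually h
  filter_upwards [h1, hβ, hτ] with z hz hz' hz''
  exact ⟨hz.1.comp z hz', hz.2.1, by rw [← hz'']; exact hz.2.2⟩

theorem IsLocalLift.comp {Y' : Type u} [TopologicalSpace Y'] {l : ℕ} {F : X → Y} {G : Y → Y'}
    {σ : Euc k → X} {c : OrbifoldChart m Y} {c' : OrbifoldChart l Y'} {ψ : Euc k → Euc m}
    {μ : Euc m → Euc l} {x : Euc k} (h : IsLocalLift F σ c ψ x)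
    (hμ : IsLocalLift G c.φ c' μ (ψ x)) : IsLocalLift (G ∘ F) σ c' (μ ∘ ψ) x := by
  have h1 := h.contDiffAt.continuousAt.eventually hμ
  filter_upwards [h1, h] with z hz hz'
  exact ⟨hz.1.comp z hz'.1, hz.2.1, hz.2.2.trans (congrArg G hz'.2.2)⟩

theorem isLocalLift_id (c : OrbifoldChart m Y) {x : Euc m} (hx : x ∈ c.U) :
    IsLocalLift id c.φ c id x := by
  filter_upwards [c.isOpen_U.mem_nhds hx] with z hz
  exact ⟨contDiffAt_id, hz, rfl⟩

theorem isLocalLift_ext {c : OrbifoldChart m Y} {γ : Equiv.Perm c.U} (hγ : γ ∈ c.Γ) {x : Euc m}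
    (hx : x ∈ c.U) : IsLocalLift id c.φ c (c.ext γ) x := by
  filter_upwards [c.isOpen_U.mem_nhds hx] with z hz
  exact ⟨contDiffAt_ext hγ hz, ext_mem hγ hz, φ_ext hγ hz⟩

theorem IsLocalLift.fderiv_comp {F : X → Y} {σ : Euc k → X} {c : OrbifoldChart m Y}
    {ψ : Euc k → Euc m} {x : Euc k} (h : IsLocalLift F σ c ψ x) {l : ℕ} {μ : Euc m → Euc l}
    (hμ : ContDiffAt ℝ ∞ μ (ψ x)) :
    fderiv ℝ (μ ∘ ψ) x = (fderiv ℝ μ (ψ x)).comp (fderiv ℝ ψ x) :=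
  _root_.fderiv_comp x hμ.differentiableAt_smooth h.contDiffAt.differentiableAt_smooth

/-- The `1`-jets of `ψ'` and `γ ∘ ψ` agree at `z`. -/
def JetEq (c : OrbifoldChart m Y) (ψ ψ' : Euc k → Euc m) (γ : Equiv.Perm c.U) (z : Euc k) : Prop :=
  ψ' z = c.ext γ (ψ z) ∧ fderiv ℝ ψ' z = (fderiv ℝ (c.ext γ) (ψ z)).comp (fderiv ℝ ψ z)

theorem JetEq.of_frequently {c : OrbifoldChart m Y} {F : X → Y} {σ : Euc k → X}
    {ψ ψ' : Euc k → Euc m} {x : Euc k} (h : IsLocalLift F σ c ψ x) (h' : IsLocalLift F σ c ψ' x)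
    {γ : Equiv.Perm c.U} (hγ : γ ∈ c.Γ) (hf : ∃ᶠ z in 𝓝 x, JetEq c ψ ψ' γ z) :
    JetEq c ψ ψ' γ x := by
  have hψ := h.contDiffAt.continuousAt
  have he := contDiffAt_ext hγ h.mem
  have hc1 : ContinuousAt (fun z => c.ext γ (ψ z)) x :=
    ContinuousAt.comp (f := ψ) he.continuousAt hψ
  have hc2 : ContinuousAt (fun z => fderiv ℝ (c.ext γ) (ψ z)) x :=
    ContinuousAt.comp (f := ψ) (continuousAt_fderiv he) hψ
  exact ⟨tendsto_nhds_unique_of_frequently_eq h'.contDiffAt.continuousAt hc1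
    (hf.mono fun z hz => hz.1),
    tendsto_nhds_unique_of_frequently_eq (continuousAt_fderiv h'.contDiffAt)
      (hc2.clm_comp (continuousAt_fderiv h.contDiffAt)) (hf.mono fun z hz => hz.2)⟩

/-- Two local smooth lifts of the same map have, up to the group of the chart, the same
`1`-jets. -/
theorem exists_jetEq {c : OrbifoldChart m Y} {F : X → Y} {σ : Euc k → X} {ψ ψ' : Euc k → Euc m}
    {x : Euc k} (h : IsLocalLift F σ c ψ x) (h' : IsLocalLift F σ c ψ' x) :
    ∃ γ ∈ c.Γ, JetEq c ψ ψ' γ x := by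
  have hfin : Finite c.Γ := c.finite_Γ
  have hfr : ∃ᶠ z in 𝓝 x, ∃ γ ∈ (c.Γ : Set (Equiv.Perm c.U)), JetEq c ψ ψ' γ z := by
    rw [frequently_iff]
    intro W hW
    -- on an open subset of `W`, the lifts differ by a fixed element of the group
    obtain ⟨V, hVsub, hVo, hxV⟩ := eventually_nhds_iff.1
      ((h.eventually.and h'.eventually).and (eventually_of_mem hW fun z hz => hz))
    obtain ⟨γ, -, V', hV'V, hV'o, ⟨z, hz⟩, hV'⟩ := exists_open_subset_of_finite_cover
      (@Finset.univ c.Γ (Fintype.ofFinite _)) (fun γ => {z | ψ' z = c.ext γ (ψ z)}) hVo ⟨x, hxV⟩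
      (fun γ => by
        have hco : ContinuousOn (fun z => ψ' z - c.ext γ (ψ z)) V := fun z hz => by
          have hl := (hVsub z hz).1
          exact (hl.2.contDiffAt.continuousAt.sub (ContinuousAt.comp (f := ψ)
            (contDiffAt_ext γ.2 hl.1.mem).continuousAt
            hl.1.contDiffAt.continuousAt)).continuousWithinAt
        have : V \ {z | ψ' z = c.ext γ (ψ z)}
            = V ∩ (fun z => ψ' z - c.ext γ (ψ z)) ⁻¹' {0}ᶜ := by
          ext z; simp [sub_eq_zero]
        rw [this]
        exact hco.isOpen_inter_preimage hVo isOpen_compl_singleton)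
      (fun z hz => by
        have hl := (hVsub z hz).1
        obtain ⟨γ, hγ, hγz⟩ := exists_ext_eq hl.1.mem hl.2.mem (hl.1.map_eq.trans hl.2.map_eq.symm)
        exact ⟨⟨γ, hγ⟩, @Finset.mem_univ c.Γ (Fintype.ofFinite _) _, hγz.symm⟩)
    have hl := hVsub z (hV'V hz)
    refine ⟨z, hl.2, γ, γ.2, hV' hz, ?_⟩
    have heq : ψ' =ᶠ[𝓝 z] c.ext γ ∘ ψ := by
      filter_upwards [hV'o.mem_nhds hz] with w hw
      exact hV' hw
    rw [heq.fderiv_eq]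
    exact hl.1.1.fderiv_comp (contDiffAt_ext γ.2 hl.1.1.mem)
  -- each of the finitely many conditions is closed, so one of them persists in the limit
  by_contra hne
  push Not at hne
  have hall : ∀ γ : c.Γ, ∀ᶠ z in 𝓝 x, ¬ JetEq c ψ ψ' γ z := fun γ => by
    by_contra hcon
    exact hne γ γ.2 (JetEq.of_frequently h h' γ.2 hcon)
  refine hfr ((eventually_all.2 hall).mono fun z hz => ?_)
  rintro ⟨γ, hγ, hj⟩
  exact hz ⟨γ, hγ⟩ hj

/-- Two local smooth lifts of the same map differ by an element of the group of the chart, if one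
of them is a submersion. -/
theorem exists_eventually_eq_ext {c : OrbifoldChart m Y} {F : X → Y} {σ : Euc k → X}
    {ψ ψ' : Euc k → Euc m} {x : Euc k} (h : IsLocalLift F σ c ψ x) (h' : IsLocalLift F σ c ψ' x)
    (hs : Function.Surjective (fderiv ℝ ψ x)) :
    ∃ γ ∈ c.Γ, ∀ᶠ z in 𝓝 x, JetEq c ψ ψ' γ z := by
  have hfin : Finite c.Γ := c.finite_Γ
  obtain ⟨γ, hγ, hj⟩ := exists_jetEq h h'
  refine ⟨γ, hγ, ?_⟩
  have hall : ∀ δ : c.Γ, ∀ᶠ z in 𝓝 x, JetEq c ψ ψ' δ z → (δ : Equiv.Perm c.U) = γ := fun δ => by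
    by_contra hcon
    have hcon : ∃ᶠ z in 𝓝 x, ¬(JetEq c ψ ψ' δ z → (δ : Equiv.Perm c.U) = γ) :=
      not_eventually.1 hcon
    have hδ := JetEq.of_frequently h h' δ.2 (hcon.mono fun z hz => (Classical.not_imp.1 hz).1)
    obtain ⟨z, hz⟩ := hcon.exists
    refine hz fun _ => eq_of_jet δ.2 hγ h.mem (hδ.1.symm.trans hj.1) ?_
    refine ContinuousLinearMap.ext fun v => ?_
    obtain ⟨w, rfl⟩ := hs v
    exact congrArg (fun L : Euc k →L[ℝ] Euc m => L w) (hδ.2.symm.trans hj.2)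
  filter_upwards [eventually_all.2 hall, h.eventually, h'.eventually] with z hz h1 h2
  obtain ⟨δ, hδ, hjz⟩ := exists_jetEq h1 h2
  have := hz ⟨δ, hδ⟩ hjz
  exact this ▸ hjz

/-- Local inverses of local smooth lifts of the identity. -/
theorem IsLocalLift.exists_inverse {σ : Euc m → Y} {c : OrbifoldChart m Y} {η : Euc m → Euc m}
    {x : Euc m} (h : IsLocalLift id σ c η x) (hd : (fderiv ℝ η x).det ≠ 0) :
    ∃ ζ : Euc m → Euc m, ζ (η x) = x ∧
      (∀ᶠ w in 𝓝 (η x), ContDiffAt ℝ ∞ ζ w ∧ η (ζ w) = w ∧ σ (ζ w) = c.φ w) ∧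
      (∀ᶠ z in 𝓝 x, ζ (η z) = z) ∧
      (fderiv ℝ ζ (η x)).comp (fderiv ℝ η x) = ContinuousLinearMap.id ℝ _ ∧
      (fderiv ℝ η x).comp (fderiv ℝ ζ (η x)) = ContinuousLinearMap.id ℝ _ := by
  obtain ⟨ζ, h1, h2, h3⟩ := exists_smooth_local_inverse (h.mono fun z hz => hz.1) hd
  have hζ := h2.self_of_nhds.1
  have hη := h.contDiffAt
  refine ⟨ζ, h1, ?_, h3, ?_, ?_⟩
  · have h4 : ∀ᶠ w in 𝓝 (η x), c.φ (η (ζ w)) = σ (ζ w) := by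
      refine Tendsto.eventually (p := fun z => c.φ (η z) = σ z) hζ.continuousAt ?_
      rw [h1]
      exact h.mono fun z hz => hz.2.2
    filter_upwards [h2, h4] with w hw hw'
    exact ⟨hw.1, hw.2, by rw [← hw', hw.2]⟩
  · have : ζ ∘ η =ᶠ[𝓝 x] id := h3
    rw [← _root_.fderiv_comp x hζ.differentiableAt_smooth hη.differentiableAt_smooth,
      this.fderiv_eq, fderiv_id]
  · have : η ∘ ζ =ᶠ[𝓝 (η x)] id := h2.mono fun w hw => hw.2
    have h5 := _root_.fderiv_comp (g := η) (η x) (by rw [h1]; exact hη.differentiableAt_smooth)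
      hζ.differentiableAt_smooth
    rw [this.fderiv_eq, fderiv_id, h1] at h5
    exact h5.symm

end LocalLifts

open OrbifoldChart

/-! ### Frames in parametrizations of an orbifold -/

theorem fderiv_comp_inverse {m : ℕ} {η ζ : Euc m → Euc m} {w : Euc m}
    (hη : ContDiffAt ℝ ∞ η (ζ w)) (hζ : ContDiffAt ℝ ∞ ζ w) (h : ∀ᶠ w' in 𝓝 w, η (ζ w') = w') :
    (fderiv ℝ η (ζ w)).comp (fderiv ℝ ζ w) = ContinuousLinearMap.id ℝ _ := by
  have h1 : η ∘ ζ =ᶠ[𝓝 w] id := h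
  rw [← fderiv_comp w hη.differentiableAt_smooth hζ.differentiableAt_smooth, h1.fderiv_eq,
    fderiv_id]

theorem comp_cancel_right {m l : ℕ} {A B : Euc m →L[ℝ] Euc l} {C : Euc m →L[ℝ] Euc m}
    (hC : C.det ≠ 0) (h : A.comp C = B.comp C) : A = B := by
  have h1 := congrArg (fun L : Euc m →L[ℝ] Euc l => L.comp (Ring.inverse C)) h
  simpa only [ContinuousLinearMap.comp_assoc, GLPlus.comp_inverse hC,
    ContinuousLinearMap.comp_id] using h1

theorem comp_cancel_left {m l : ℕ} {A B : Euc l →L[ℝ] Euc m} {C : Euc m →L[ℝ] Euc m}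
    (hC : C.det ≠ 0) (h : C.comp A = C.comp B) : A = B := by
  have h1 := congrArg (fun L : Euc l →L[ℝ] Euc m => (Ring.inverse C).comp L) h
  simpa only [← ContinuousLinearMap.comp_assoc, GLPlus.inverse_comp hC,
    ContinuousLinearMap.id_comp] using h1

theorem tendsto_clm_comp {α : Type*} {l : Filter α} {m k j : ℕ} {f : α → Euc k →L[ℝ] Euc j}
    {g : α → Euc m →L[ℝ] Euc k} {A : Euc k →L[ℝ] Euc j} {B : Euc m →L[ℝ] Euc k}
    (hf : Tendsto f l (𝓝 A)) (hg : Tendsto g l (𝓝 B)) :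
    Tendsto (fun x => (f x).comp (g x)) l (𝓝 (A.comp B)) :=
  ((isBoundedBilinearMap_comp (𝕜 := ℝ) (E := Euc m) (F := Euc k) (G := Euc j)).continuous.tendsto
    (A, B)).comp (hf.prodMk_nhds hg)

namespace OrientedOrbifold

variable {m : ℕ} {X Y : Type u} [TopologicalSpace X] [TopologicalSpace Y]

/-- The frame in a chart `c` of the atlas given by a point and a linear map. -/
def frameRep (O : OrientedOrbifold m X) {c : OrbifoldChart m X} (hc : c ∈ O.atlas) {x : Euc m}
    (hx : x ∈ c.U) {A : Euc m →L[ℝ] Euc m} (hA : 0 < A.det) : O.FrameRep :=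
  ⟨⟨c, hc⟩, ⟨(x, A), hx, hA⟩⟩

variable {O : OrientedOrbifold m X}

namespace FrameRep

theorem chart_mem (a : O.FrameRep) : a.chart ∈ O.atlas := a.1.2

theorem pt_mem (a : O.FrameRep) : a.pt ∈ a.chart.U := a.2.2.1

theorem frame_det_pos (a : O.FrameRep) : 0 < a.frame.det := a.2.2.2

theorem Rel.refl (a : O.FrameRep) : a.Rel a :=
  ⟨id, isLocalLift_id _ a.pt_mem, rfl, by
    rw [fderiv_id]; exact (ContinuousLinearMap.id_comp _).symm⟩

end FrameRep

/-- The frame `b` of the orbifold is the image of the frame `C` of `σ` at `x` under the differential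
of `F`. -/
def PushesTo {l : ℕ} {Z : Type u} (F : Z → X) (σ : Euc l → Z) (x : Euc l) (C : Euc m →L[ℝ] Euc l)
    (b : O.FrameRep) : Prop :=
  ∃ ψ : Euc l → Euc m, IsLocalLift F σ b.chart ψ x ∧ ψ x = b.pt ∧
    b.frame = (fderiv ℝ ψ x).comp C

section PushesTo

variable {l : ℕ} {Z : Type u} {F : Z → X} {σ : Euc l → Z} {x : Euc l} {C : Euc m →L[ℝ] Euc l}

theorem PushesTo.rel {b b' : O.FrameRep} (h : PushesTo F σ x C b) (hb : b.Rel b') :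
    PushesTo F σ x C b' := by
  obtain ⟨ψ, h1, h2, h3⟩ := h
  obtain ⟨μ, k1, k2, k3⟩ := hb
  rw [← h2] at k1 k2 k3
  refine ⟨μ ∘ ψ, h1.comp k1, k2, ?_⟩
  rw [k3, h3, h1.fderiv_comp k1.contDiffAt]
  rfl

theorem PushesTo.unique {b b' : O.FrameRep} (h : PushesTo F σ x C b) (h' : PushesTo F σ x C b') :
    b.Rel b' := by
  obtain ⟨ψ, h1, h2, h3⟩ := h
  obtain ⟨ψ', k1, k2, k3⟩ := h'
  obtain ⟨μ, m1, m2, -⟩ :=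
    O.compatible b.chart b.chart_mem b'.chart b'.chart_mem (ψ x) h1.mem (ψ' x)
    k1.mem (h1.map_eq.trans k1.map_eq.symm)
  obtain ⟨γ, hγ, hj⟩ := exists_jetEq (c := b'.chart) (F := F) (σ := σ) (h1.comp m1) k1
  have hmem : (μ ∘ ψ) x ∈ b'.chart.U := m1.mem
  have e := (isLocalLift_ext hγ m1.mem)
  refine ⟨b'.chart.ext γ ∘ μ, ?_, ?_, ?_⟩
  · rw [← h2]
    exact m1.comp e
  · rw [← h2, ← k2]
    exact hj.1.symm
  · rw [k3, h3, hj.2, h1.fderiv_comp m1.contDiffAt, ← h2, m1.fderiv_comp (contDiffAt_ext hγ m1.mem)]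
    rfl

end PushesTo

namespace FrameRep

theorem Rel.trans {a b c : O.FrameRep} (h : a.Rel b) (k : b.Rel c) : a.Rel c :=
  PushesTo.rel (F := id) (σ := a.chart.φ) h k

theorem Rel.symm {a b : O.FrameRep} (h : a.Rel b) : b.Rel a := by
  obtain ⟨ψ, h1, h2, h3⟩ := h
  have hd : (fderiv ℝ ψ a.pt).det ≠ 0 := by
    have := b.frame_det_pos
    rw [h3, GLPlus.det_comp] at this
    exact left_ne_zero_of_mul this.ne'
  obtain ⟨ζ, k1, k2, -, k4, -⟩ := h1.exists_inverse hd
  rw [h2] at k1 k2 k4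
  refine ⟨ζ, ?_, k1, ?_⟩
  · have h5 : ∀ᶠ w in 𝓝 b.pt, ζ w ∈ a.chart.U := by
      refine k2.self_of_nhds.1.continuousAt.eventually_mem ?_
      rw [k1]
      exact a.chart.isOpen_U.mem_nhds a.pt_mem
    filter_upwards [k2, h5] with w hw hw'
    exact ⟨hw.1, hw', hw.2.2⟩
  · rw [h3, ← ContinuousLinearMap.comp_assoc, k4, ContinuousLinearMap.id_comp]

theorem mk_eq_iff {a b : O.FrameRep} : a.mk = b.mk ↔ a.Rel b := by
  refine ⟨fun h => ?_, fun h => Quot.sound h⟩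
  exact (Equivalence.eqvGen_iff ⟨Rel.refl, Rel.symm, Rel.trans⟩).1 (Quot.eqvGen_exact h)

theorem exists_mk (B : O.FrameBundle) : ∃ b : O.FrameRep, b.mk = B := Quot.exists_rep B

end FrameRep

/-- The foot point of a frame. -/
def FrameBundle.base (B : O.FrameBundle) : X :=
  Quot.lift (fun b : O.FrameRep => b.chart.φ b.pt) (fun a b h => by
    obtain ⟨ψ, h1, h2, -⟩ := h
    have := h1.map_eq
    rw [h2] at this
    exact this.symm) B

theorem base_mk (b : O.FrameRep) : b.mk.base = b.chart.φ b.pt := rfl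

/-- `σ` is, on the open set `S`, a parametrization of the orbifold that is compatible with the
atlas; the sign of `ε` tells if it preserves the orientation. -/
structure IsOrientedParam (O : OrientedOrbifold m X) (σ : Euc m → X) (S : Set (Euc m)) (ε : ℝ) :
    Prop where
  isOpen : IsOpen S
  exists_lift : ∀ d ∈ O.atlas, ∀ x ∈ S, ∀ y ∈ d.U, σ x = d.φ y →
    ∃ ψ, IsLocalLift id σ d ψ x ∧ ψ x = y
  det_pos : ∀ d ∈ O.atlas, ∀ x ∈ S, ∀ ψ : Euc m → Euc m, IsLocalLift id σ d ψ x →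
    0 < ε * (fderiv ℝ ψ x).det

/-- The domain of the frames over a parametrization. -/
abbrev ParamFrames (S : Set (Euc m)) (ε : ℝ) : Type :=
  {a : Euc m × (Euc m →L[ℝ] Euc m) // a.1 ∈ S ∧ 0 < ε * a.2.det}

theorem isOpen_paramFrames {S : Set (Euc m)} (hS : IsOpen S) (ε : ℝ) :
    IsOpen {a : Euc m × (Euc m →L[ℝ] Euc m) | a.1 ∈ S ∧ 0 < ε * a.2.det} :=
  (hS.preimage continuous_fst).inter (isOpen_lt continuous_const
    (continuous_const.mul (GLPlus.continuous_det.comp continuous_snd)))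

theorem det_ratio_pos {σ : Euc m → X} {d d' : OrbifoldChart m X} (hd : d ∈ O.atlas)
    (hd' : d' ∈ O.atlas) {x : Euc m} {ψ ψ' : Euc m → Euc m} (h : IsLocalLift id σ d ψ x)
    (h' : IsLocalLift id σ d' ψ' x) :
    ∃ r : ℝ, 0 < r ∧ (fderiv ℝ ψ' x).det = r * (fderiv ℝ ψ x).det := by
  obtain ⟨μ, m1, m2, m3⟩ := O.compatible d hd d' hd' (ψ x) h.mem (ψ' x) h'.mem
    (h.map_eq.trans h'.map_eq.symm)
  have hcomp : IsLocalLift id σ d' (μ ∘ ψ) x := h.comp m1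
  obtain ⟨γ, hγ, hj⟩ := exists_jetEq hcomp h'
  have p1 := O.oriented d hd d' hd' (ψ x) h.mem μ m1 m3
  have p2 := O.oriented d' hd' d' hd' _ hcomp.mem _ (isLocalLift_ext hγ hcomp.mem)
    (fderiv_ext_bijective hγ hcomp.mem)
  refine ⟨_, mul_pos p2 p1, ?_⟩
  rw [hj.2, GLPlus.det_comp, h.fderiv_comp m1.contDiffAt, GLPlus.det_comp, mul_assoc]

theorem isOrientedParam_chart {c : OrbifoldChart m X} (hc : c ∈ O.atlas) :
    IsOrientedParam O c.φ c.U 1 where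
  isOpen := c.isOpen_U
  exists_lift d hd x hx y hy h := by
    obtain ⟨ψ, h1, h2, -⟩ := O.compatible c hc d hd x hx y hy h
    exact ⟨ψ, h1, h2⟩
  det_pos d hd x hx ψ h := by
    obtain ⟨r, hr, he⟩ := det_ratio_pos (O := O) hc hd (isLocalLift_id c hx) h
    rw [he, fderiv_id, GLPlus.det_id, one_mul, mul_one]
    exact hr

/-- A compatible parametrization with a connected domain either preserves or reverses the
orientation. -/
theorem exists_isOrientedParam {σ : Euc m → X} {S : Set (Euc m)} (hS : IsOpen S)
    (hconn : IsPreconnected S) (hcomp : ∀ d ∈ O.atlas, IsCompatible σ S d) :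
    ∃ ε : ℝ, ε ≠ 0 ∧ IsOrientedParam O σ S ε := by
  have hlift : ∀ d ∈ O.atlas, ∀ x ∈ S, ∀ y ∈ d.U, σ x = d.φ y →
      ∃ ψ, IsLocalLift id σ d ψ x ∧ ψ x = y := fun d hd x hx y hy h => by
    obtain ⟨ψ, h1, h2, -⟩ := hcomp d hd x hx y hy h
    exact ⟨ψ, h1, h2⟩
  -- `A ε` is the set of the points where lifts to oriented charts have a determinant of sign `ε`
  let A : ℝ → Set (Euc m) := fun ε => {x | ∃ d ∈ O.atlas, ∃ ψ : Euc m → Euc m,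
    IsLocalLift id σ d ψ x ∧ 0 < ε * (fderiv ℝ ψ x).det}
  have hAo : ∀ ε, IsOpen (A ε) := fun ε => isOpen_iff_mem_nhds.2 fun x hx => by
    obtain ⟨d, hd, ψ, h1, h2⟩ := hx
    have hc : ContinuousAt (fun z => ε * (fderiv ℝ ψ z).det) x :=
      continuousAt_const.mul (GLPlus.continuous_det.continuousAt.comp
        (continuousAt_fderiv h1.contDiffAt))
    filter_upwards [h1.eventually, hc.eventually (lt_mem_nhds h2)] with z hz hz'
    exact ⟨d, hd, ψ, hz, hz'⟩
  have hcov : S ⊆ A 1 ∪ A (-1) := fun x hx => by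
    obtain ⟨d, hd, y, hy, hxy⟩ := O.covers (σ x)
    obtain ⟨ψ, h1, h2, h3⟩ := hcomp d hd x hx y hy hxy.symm
    rcases lt_or_gt_of_ne (det_ne_zero_of_bijective h3) with h | h
    · exact Or.inr ⟨d, hd, ψ, h1, by linarith⟩
    · exact Or.inl ⟨d, hd, ψ, h1, by linarith⟩
  have hall : ∀ ε, S ⊆ A ε → IsOrientedParam O σ S ε := fun ε hε =>
    ⟨hS, hlift, fun d hd x hx ψ hψ => by
      obtain ⟨d', hd', ψ', h1, h2⟩ := hε hx
      obtain ⟨r, hr, he⟩ := det_ratio_pos (O := O) hd' hd h1 hψ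
      rw [he, mul_left_comm]
      exact mul_pos hr h2⟩
  have hdisj : S ∩ (A 1 ∩ A (-1)) = ∅ := by
    refine Set.eq_empty_iff_forall_notMem.2 ?_
    rintro x ⟨-, ⟨d, hd, ψ, h1, h2⟩, ⟨d', hd', ψ', k1, k2⟩⟩
    obtain ⟨r, hr, he⟩ := det_ratio_pos (O := O) hd hd' h1 k1
    rw [he] at k2
    nlinarith [mul_pos hr (show 0 < (fderiv ℝ ψ x).det by linarith)]
  rcases isPreconnected_iff_subset_of_disjoint.1 hconn _ _ (hAo 1) (hAo (-1)) hcov hdisj with h | h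
  · exact ⟨1, one_ne_zero, hall 1 h⟩
  · exact ⟨-1, by norm_num, hall _ h⟩

section ParamFrame

variable {σ σ' : Euc m → X} {S S' : Set (Euc m)} {ε ε' : ℝ}

namespace IsOrientedParam

theorem exists_pushesTo (h : IsOrientedParam O σ S ε) (a : ParamFrames S ε) :
    ∃ b : O.FrameRep, PushesTo id σ a.1.1 a.1.2 b := by
  obtain ⟨d, hd, y, hy, hxy⟩ := O.covers (σ a.1.1)
  obtain ⟨ψ, h1, h2⟩ := h.exists_lift d hd a.1.1 a.2.1 y hy hxy.symm
  have hdet : 0 < ((fderiv ℝ ψ a.1.1).comp a.1.2).det := by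
    rw [GLPlus.det_comp]
    have p1 := h.det_pos d hd a.1.1 a.2.1 ψ h1
    have p2 := a.2.2
    have h3 := mul_pos p1 p2
    have h4 : 0 < ε ^ 2 := by
      have : ε ≠ 0 := by rintro rfl; simp at p2
      positivity
    refine pos_of_mul_pos_right (a := ε ^ 2) ?_ h4.le
    nlinarith
  exact ⟨O.frameRep hd hy hdet, ψ, h1, h2, rfl⟩

/-- The frame of the orbifold given by a frame of `ℝᵐ` in the domain of a parametrization. -/
def toFrame (h : IsOrientedParam O σ S ε) (a : ParamFrames S ε) : O.FrameBundle :=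
  (h.exists_pushesTo a).choose.mk

theorem mk_eq_toFrame_iff (h : IsOrientedParam O σ S ε) {a : ParamFrames S ε} {b : O.FrameRep} :
    b.mk = h.toFrame a ↔ PushesTo id σ a.1.1 a.1.2 b := by
  have hs := (h.exists_pushesTo a).choose_spec
  constructor
  · intro hb
    exact hs.rel (FrameRep.mk_eq_iff.1 hb).symm
  · intro hb
    exact FrameRep.mk_eq_iff.2 (hb.unique hs)

theorem base_toFrame (h : IsOrientedParam O σ S ε) (a : ParamFrames S ε) :
    (h.toFrame a).base = σ a.1.1 := by
  obtain ⟨b, hb⟩ := h.exists_pushesTo a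
  rw [← h.mk_eq_toFrame_iff.2 hb, base_mk]
  obtain ⟨ψ, h1, h2, -⟩ := hb
  rw [← h2]
  exact h1.map_eq

theorem det_lift_ne_zero (h : IsOrientedParam O σ S ε) {d : OrbifoldChart m X} (hd : d ∈ O.atlas)
    {x : Euc m} (hx : x ∈ S) {ψ : Euc m → Euc m} (hψ : IsLocalLift id σ d ψ x) :
    (fderiv ℝ ψ x).det ≠ 0 :=
  right_ne_zero_of_mul (h.det_pos d hd x hx ψ hψ).ne'

theorem ne_zero_sign (a : ParamFrames S ε) : ε ≠ 0 := left_ne_zero_of_mul a.2.2.ne'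

theorem frame_det_ne_zero (a : ParamFrames S ε) : a.1.2.det ≠ 0 := right_ne_zero_of_mul a.2.2.ne'

/-- Two frames in parametrizations give the same frame of the orbifold if and only if a change of
parametrizations carries the one to the other. -/
theorem toFrame_eq_iff (h : IsOrientedParam O σ S ε) (h' : IsOrientedParam O σ' S' ε')
    {a : ParamFrames S ε} {a' : ParamFrames S' ε'} :
    h.toFrame a = h'.toFrame a' ↔ ∃ β : Euc m → Euc m,
      (∀ᶠ w in 𝓝 a.1.1, ContDiffAt ℝ ∞ β w ∧ σ' (β w) = σ w) ∧ β a.1.1 = a'.1.1 ∧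
        a'.1.2 = (fderiv ℝ β a.1.1).comp a.1.2 := by
  constructor
  · intro he
    obtain ⟨b, hb⟩ := h.exists_pushesTo a
    have hb' := h'.mk_eq_toFrame_iff.1 ((h.mk_eq_toFrame_iff.2 hb).trans he)
    obtain ⟨ψ, h1, h2, h3⟩ := hb
    obtain ⟨ψ', k1, k2, k3⟩ := hb'
    have hd := h'.det_lift_ne_zero b.chart_mem a'.2.1 k1
    obtain ⟨ζ, z1, z2, -, z4, -⟩ := k1.exists_inverse hd
    rw [k2, ← h2] at z1 z2 z4
    refine ⟨ζ ∘ ψ, ?_, z1, ?_⟩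
    · filter_upwards [h1, h1.contDiffAt.continuousAt.eventually z2] with w hw hw'
      exact ⟨hw'.1.comp w hw.1, hw'.2.2.trans hw.2.2⟩
    · rw [h1.fderiv_comp z2.self_of_nhds.1, ContinuousLinearMap.comp_assoc, ← h3, k3,
        ← ContinuousLinearMap.comp_assoc, z4, ContinuousLinearMap.id_comp]
  · rintro ⟨β, b1, b2, b3⟩
    obtain ⟨b, hb⟩ := h'.exists_pushesTo a'
    rw [← h'.mk_eq_toFrame_iff.2 hb]
    refine (h.mk_eq_toFrame_iff.2 ?_).symm
    obtain ⟨ψ', k1, k2, k3⟩ := hb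
    rw [← b2] at k1 k2 k3
    refine ⟨ψ' ∘ β, k1.precomp (b1.mono fun w hw => hw.1) (b1.mono fun w hw => hw.2), k2, ?_⟩
    rw [k3, b3, _root_.fderiv_comp _ k1.contDiffAt.differentiableAt_smooth
      b1.self_of_nhds.1.differentiableAt_smooth]
    rfl

/-- Every frame at a point in the image of a parametrization is obtained from it. -/
theorem exists_toFrame_eq (h : IsOrientedParam O σ S ε) (hε : ε ≠ 0) {B : O.FrameBundle}
    {x : Euc m} (hx : x ∈ S) (hB : B.base = σ x) : ∃ a : ParamFrames S ε, a.1.1 = x ∧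
      h.toFrame a = B := by
  obtain ⟨b, rfl⟩ := FrameRep.exists_mk B
  obtain ⟨ψ, h1, h2⟩ := h.exists_lift b.chart b.chart_mem x hx b.pt b.pt_mem
    (hB.symm.trans (base_mk b))
  have hd := h.det_lift_ne_zero b.chart_mem hx h1
  have hpos : 0 < ε * ((Ring.inverse (fderiv ℝ ψ x)).comp b.frame).det := by
    rw [GLPlus.det_comp, GLPlus.det_inverse hd]
    have p1 := h.det_pos b.chart b.chart_mem x hx ψ h1
    have p2 := b.frame_det_pos
    have : ε * ((fderiv ℝ ψ x).det⁻¹ * b.frame.det)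
        = (ε * (fderiv ℝ ψ x).det) * (((fderiv ℝ ψ x).det⁻¹) ^ 2 * b.frame.det) := by
      field_simp
    rw [this]
    positivity
  refine ⟨⟨(x, (Ring.inverse (fderiv ℝ ψ x)).comp b.frame), hx, hpos⟩, rfl, ?_⟩
  refine (h.mk_eq_toFrame_iff.2 ⟨ψ, h1, h2, ?_⟩).symm
  change b.frame = (fderiv ℝ ψ x).comp ((Ring.inverse (fderiv ℝ ψ x)).comp b.frame)
  rw [← ContinuousLinearMap.comp_assoc, GLPlus.comp_inverse hd, ContinuousLinearMap.id_comp]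

theorem continuous_toFrame (h : IsOrientedParam O σ S ε) : Continuous h.toFrame := by
  refine continuous_iff_continuousAt.2 fun a₀ => ?_
  obtain ⟨b, hb⟩ := h.exists_pushesTo a₀
  obtain ⟨ψ, h1, h2, h3⟩ := hb
  let V : Set (ParamFrames S ε) := {a | IsLocalLift id σ b.chart ψ a.1.1}
  have hVo : IsOpen V := by
    have : IsOpen {z | IsLocalLift id σ b.chart ψ z} := isOpen_setOfPred_eventually_nhds
    exact this.preimage (continuous_fst.comp continuous_subtype_val)
  have haV : a₀ ∈ V := h1
  have hdet : ∀ a : V, 0 < ((fderiv ℝ ψ a.1.1.1).comp a.1.1.2).det := fun a => by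
    rw [GLPlus.det_comp]
    have h3 := mul_pos (h.det_pos b.chart b.chart_mem a.1.1.1 a.1.2.1 ψ a.2) a.1.2.2
    have h4 : 0 < ε ^ 2 := by have := ne_zero_sign a₀; positivity
    refine pos_of_mul_pos_right (a := ε ^ 2) ?_ h4.le
    nlinarith
  have key : ContinuousOn h.toFrame V := by
    rw [continuousOn_iff_continuous_domRestrict]
    let R : V → O.FrameRep := fun a => O.frameRep b.chart_mem (IsLocalLift.mem a.2) (hdet a)
    have hR : ∀ a : V, h.toFrame a.1 = (R a).mk := fun a =>
      (h.mk_eq_toFrame_iff (a := a.1) (b := R a)).2 ⟨ψ, a.2, rfl, rfl⟩ |>.symm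
    have hRc : Continuous R := by
      refine (continuous_sigmaMk (σ := fun c : O.atlas => {a : Euc m × (Euc m →L[ℝ] Euc m) //
        a.1 ∈ c.1.U ∧ 0 < a.2.det}) (i := ⟨b.chart, b.chart_mem⟩)).comp (Continuous.subtype_mk ?_ _)
      refine continuous_iff_continuousAt.2 fun a => ?_
      have hf : ContinuousAt (fun a : V => a.1.1.1) a :=
        (continuous_fst.comp (continuous_subtype_val.comp continuous_subtype_val)).continuousAt
      have hs : ContinuousAt (fun a : V => a.1.1.2) a :=
        (continuous_snd.comp (continuous_subtype_val.comp continuous_subtype_val)).continuousAt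
      have hl : ContDiffAt ℝ ∞ ψ a.1.1.1 := IsLocalLift.contDiffAt a.2
      exact (ContinuousAt.comp (f := fun a : V => a.1.1.1) hl.continuousAt hf).prodMk
        ((ContinuousAt.comp (f := fun a : V => a.1.1.1) (continuousAt_fderiv hl) hf).clm_comp hs)
    exact (continuous_quot_mk.comp hRc).congr fun a => (hR a).symm
  exact key.continuousAt (hVo.mem_nhds haV)

theorem isOpenMap_toFrame (h : IsOrientedParam O σ S ε) : IsOpenMap h.toFrame := by
  intro V hV
  change IsOpen (FrameRep.mk ⁻¹' (h.toFrame '' V))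
  refine isOpen_sigma_iff.2 fun c => isOpen_iff_mem_nhds.2 ?_
  rintro b₀ ⟨a, haV, hab⟩
  obtain ⟨ψ, h1, h2, h3⟩ := h.mk_eq_toFrame_iff.1 hab.symm
  have hd := h.det_lift_ne_zero c.2 a.2.1 h1
  obtain ⟨ζ, z1, z2, -, z4, -⟩ := h1.exists_inverse hd
  rw [h2] at z1 z2 z4
  have hb1 : FrameRep.pt (O := O) ⟨c, b₀⟩ = b₀.1.1 := rfl
  have hb2 : FrameRep.frame (O := O) ⟨c, b₀⟩ = b₀.1.2 := rfl
  have hc1 : FrameRep.chart (O := O) ⟨c, b₀⟩ = c.1 := rfl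
  rw [hb1] at z1 z2 z4
  -- the inverse of the lift carries frames of the chart near `b₀` to frames of the parametrization
  let G : Euc m × (Euc m →L[ℝ] Euc m) → Euc m × (Euc m →L[ℝ] Euc m) :=
    fun p => (ζ p.1, (fderiv ℝ ζ p.1).comp p.2)
  have hGc : ContinuousAt G b₀.1 :=
    (ContinuousAt.comp (f := Prod.fst) z2.self_of_nhds.1.continuousAt continuousAt_fst).prodMk
      ((ContinuousAt.comp (f := Prod.fst) (continuousAt_fderiv z2.self_of_nhds.1)
        continuousAt_fst).clm_comp continuousAt_snd)
  have hG0 : G b₀.1 = a.1 := by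
    refine Prod.ext z1 ?_
    change (fderiv ℝ ζ b₀.1.1).comp b₀.1.2 = a.1.2
    rw [← hb2, h3, ← ContinuousLinearMap.comp_assoc, z4, ContinuousLinearMap.id_comp]
  have hVo : IsOpen (Subtype.val '' V) :=
    (isOpen_paramFrames h.isOpen ε).isOpenEmbedding_subtypeVal.isOpenMap V hV
  have e1 : ∀ᶠ p in 𝓝 b₀.1, G p ∈ Subtype.val '' V :=
    hGc.eventually_mem (hVo.mem_nhds (by rw [hG0]; exact ⟨a, haV, rfl⟩))
  have e2 : ∀ᶠ w in 𝓝 b₀.1.1, IsLocalLift id σ c.1 ψ (ζ w) := by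
    refine Tendsto.eventually (p := fun z => IsLocalLift id σ c.1 ψ z)
      z2.self_of_nhds.1.continuousAt ?_
    rw [z1]
    exact h1.eventually
  have e3 : ∀ᶠ w in 𝓝 b₀.1.1, ψ (ζ w) = w ∧
      (fderiv ℝ ψ (ζ w)).comp (fderiv ℝ ζ w) = ContinuousLinearMap.id ℝ _ := by
    filter_upwards [e2, eventually_eventually_nhds.2 z2] with w hw hw'
    exact ⟨hw'.self_of_nhds.2.1, fderiv_comp_inverse hw.contDiffAt hw'.self_of_nhds.1
      (hw'.mono fun _ h => h.2.1)⟩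
  have e23 : ∀ᶠ p in 𝓝 b₀.1, IsLocalLift id σ c.1 ψ (ζ p.1) ∧ ψ (ζ p.1) = p.1 ∧
      (fderiv ℝ ψ (ζ p.1)).comp (fderiv ℝ ζ p.1) = ContinuousLinearMap.id ℝ _ :=
    (continuousAt_fst (p := b₀.1)).eventually (e2.and e3)
  have e := (continuous_subtype_val (p := fun a : Euc m × (Euc m →L[ℝ] Euc m) =>
    a.1 ∈ c.1.U ∧ 0 < a.2.det)).continuousAt (x := b₀) |>.eventually (e1.and e23)
  filter_upwards [e] with p hp
  obtain ⟨⟨a', ha'V, ha'⟩, p1, p2, p3⟩ := hp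
  refine ⟨a', ha'V, (h.mk_eq_toFrame_iff.2 ⟨ψ, ?_, ?_, ?_⟩).symm⟩
  · rw [ha']; exact p1
  · rw [ha']; exact p2
  · rw [ha']
    change p.1.2 = (fderiv ℝ ψ (ζ p.1.1)).comp ((fderiv ℝ ζ p.1.1).comp p.1.2)
    rw [← ContinuousLinearMap.comp_assoc, p3, ContinuousLinearMap.id_comp]

/-- The chart groups act freely on frames, so distinct nearby frames of a parametrization are
distinct frames of the orbifold. -/
theorem eventually_injective_toFrame (h : IsOrientedParam O σ S ε) (a₀ : ParamFrames S ε) :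
    ∀ᶠ p : ParamFrames S ε × ParamFrames S ε in 𝓝 (a₀, a₀),
      h.toFrame p.1 = h.toFrame p.2 → p.1 = p.2 := by
  obtain ⟨b, ψ, h1, h2, h3⟩ := h.exists_pushesTo a₀
  have hfin : Finite b.chart.Γ := b.chart.finite_Γ
  have hd := h.det_lift_ne_zero b.chart_mem a₀.2.1 h1
  obtain ⟨ζ, z1, z2, z3, z4, -⟩ := h1.exists_inverse hd
  have hf1 : Tendsto (fun p : ParamFrames S ε × ParamFrames S ε => p.1.1.1) (𝓝 (a₀, a₀))
      (𝓝 a₀.1.1) := (continuous_fst.comp (continuous_subtype_val.comp continuous_fst)).tendsto _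
  have hf2 : Tendsto (fun p : ParamFrames S ε × ParamFrames S ε => p.2.1.1) (𝓝 (a₀, a₀))
      (𝓝 a₀.1.1) := (continuous_fst.comp (continuous_subtype_val.comp continuous_snd)).tendsto _
  have hs1 : Tendsto (fun p : ParamFrames S ε × ParamFrames S ε => p.1.1.2) (𝓝 (a₀, a₀))
      (𝓝 a₀.1.2) := (continuous_snd.comp (continuous_subtype_val.comp continuous_fst)).tendsto _
  have hs2 : Tendsto (fun p : ParamFrames S ε × ParamFrames S ε => p.2.1.2) (𝓝 (a₀, a₀))
      (𝓝 a₀.1.2) := (continuous_snd.comp (continuous_subtype_val.comp continuous_snd)).tendsto _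
  have hψ := h1.contDiffAt
  have hdψ := continuousAt_fderiv hψ
  let Good : Equiv.Perm b.chart.U → ParamFrames S ε × ParamFrames S ε → Prop := fun γ p =>
    ψ p.2.1.1 = b.chart.ext γ (ψ p.1.1.1) ∧ (fderiv ℝ ψ p.2.1.1).comp p.2.1.2
      = (fderiv ℝ (b.chart.ext γ) (ψ p.1.1.1)).comp ((fderiv ℝ ψ p.1.1.1).comp p.1.1.2)
  -- otherwise, in the limit `γ` fixes the frame at `a₀`
  have hno : ∀ γ : b.chart.Γ, ∀ᶠ p in 𝓝 (a₀, a₀), Good γ p → (γ : Equiv.Perm b.chart.U) = 1 := by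
    intro γ
    by_contra hcon
    have hcon := not_eventually.1 hcon
    have hfr : ∃ᶠ p in 𝓝 (a₀, a₀), Good γ p := hcon.mono fun p hp => (Classical.not_imp.1 hp).1
    obtain ⟨p, hp⟩ := hcon.exists
    refine hp fun _ => ?_
    have he := contDiffAt_ext γ.2 h1.mem
    have t1 : Tendsto (fun p : ParamFrames S ε × ParamFrames S ε => ψ p.1.1.1) (𝓝 (a₀, a₀))
      (𝓝 (ψ a₀.1.1)) := hψ.continuousAt.tendsto.comp hf1
    have q1 : ψ a₀.1.1 = b.chart.ext γ (ψ a₀.1.1) :=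
      tendsto_nhds_unique_of_frequently_eq (hψ.continuousAt.tendsto.comp hf2)
        (he.continuousAt.tendsto.comp t1) (hfr.mono fun p hp => hp.1)
    have q2 : (fderiv ℝ ψ a₀.1.1).comp a₀.1.2
        = (fderiv ℝ (b.chart.ext γ) (ψ a₀.1.1)).comp ((fderiv ℝ ψ a₀.1.1).comp a₀.1.2) :=
      tendsto_nhds_unique_of_frequently_eq (tendsto_clm_comp (hdψ.tendsto.comp hf2) hs2)
        (tendsto_clm_comp ((continuousAt_fderiv he).tendsto.comp t1)
          (tendsto_clm_comp (hdψ.tendsto.comp hf1) hs1))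
        (hfr.mono fun p hp => hp.2)
    refine eq_one_of_jet γ.2 h1.mem q1.symm (comp_cancel_right
      (C := (fderiv ℝ ψ a₀.1.1).comp a₀.1.2) ?_ ?_)
    · rw [GLPlus.det_comp]
      exact mul_ne_zero hd (frame_det_ne_zero a₀)
    · rw [← q2, ContinuousLinearMap.id_comp]
  filter_upwards [eventually_all.2 hno, hf1.eventually h1.eventually, hf2.eventually h1.eventually,
    hf1.eventually z3, hf2.eventually z3] with p hp l1 l2 i1 i2 heq
  obtain ⟨b₁, ψ₁, k1, k2, k3⟩ := h.exists_pushesTo p.1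
  obtain ⟨ψ₂, m1, m2, m3⟩ := h.mk_eq_toFrame_iff.1
    ((h.mk_eq_toFrame_iff.2 ⟨ψ₁, k1, k2, k3⟩).trans heq)
  obtain ⟨β, b1, b2, b3⟩ := (h.toFrame_eq_iff h).1 heq
  -- the change of parametrizations, seen in the chart, is given by an element of the chart group
  have hl : IsLocalLift id σ b.chart (ψ ∘ β) p.1.1.1 := by
    refine IsLocalLift.precomp (σ := σ) ?_ (b1.mono fun w hw => hw.1) (b1.mono fun w hw => hw.2)
    rw [b2]
    exact l2
  obtain ⟨γ, hγ, hj⟩ := exists_jetEq l1 hl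
  have hd2 : fderiv ℝ (ψ ∘ β) p.1.1.1 = (fderiv ℝ ψ p.2.1.1).comp (fderiv ℝ β p.1.1.1) := by
    rw [← b2]
    exact _root_.fderiv_comp _ (by rw [b2]; exact l2.contDiffAt.differentiableAt_smooth)
      b1.self_of_nhds.1.differentiableAt_smooth
  have hg : Good γ p := by
    refine ⟨?_, ?_⟩
    · rw [← b2]; exact hj.1
    · rw [b3, ← ContinuousLinearMap.comp_assoc, ← hd2, hj.2]
      rfl
  have h1γ := hp ⟨γ, hγ⟩ hg
  change γ = 1 at h1γ
  have e1 := hg.1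
  have e2 := hg.2
  rw [h1γ, ext_one l1.mem] at e1
  rw [h1γ, fderiv_ext_one l1.mem, ContinuousLinearMap.id_comp] at e2
  have hpt : p.1.1.1 = p.2.1.1 := by rw [← i1, ← i2, e1]
  rw [hpt] at e2
  exact Subtype.ext (Prod.ext hpt (comp_cancel_left
    (h.det_lift_ne_zero b.chart_mem p.2.2.1 l2) e2.symm))

/-- Frames of a parametrization are local coordinates of the frame bundle. -/
theorem isLocalHomeomorph_toFrame (h : IsOrientedParam O σ S ε) :
    IsLocalHomeomorph h.toFrame := by
  rw [isLocalHomeomorph_iff_isOpenEmbedding_restrict]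
  intro a₀
  have he := h.eventually_injective_toFrame a₀
  rw [nhds_prod_eq] at he
  obtain ⟨V, hV, hinj⟩ := (eventually_prod_self_iff (r := fun x y : ParamFrames S ε =>
    h.toFrame x = h.toFrame y → x = y)).1 he
  obtain ⟨V', hV'V, hV'o, haV'⟩ := mem_nhds_iff.1 hV
  refine ⟨V', hV'o.mem_nhds haV', ?_⟩
  refine IsOpenEmbedding.of_continuous_injective_isOpenMap
    (h.continuous_toFrame.comp continuous_subtype_val) ?_ ?_
  · intro x y hxy
    exact Subtype.ext (hinj x.1 (hV'V x.2) y.1 (hV'V y.2) hxy)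
  · exact h.isOpenMap_toFrame.comp hV'o.isOpenEmbedding_subtypeVal.isOpenMap

/-- Local sections of `toFrame`. -/
theorem exists_local_inverse (h : IsOrientedParam O σ S ε) (a₀ : ParamFrames S ε) :
    ∃ e : OpenPartialHomeomorph (ParamFrames S ε) O.FrameBundle, a₀ ∈ e.source ∧
      h.toFrame = e :=
  h.isLocalHomeomorph_toFrame a₀

/-- The right action of `GL₊(m)` on the frames of a parametrization. -/
def _root_.OrientedOrbifold.ParamFrames.rotate (a : ParamFrames S ε) (R : GLPlus m) :
    ParamFrames S ε :=
  ⟨(a.1.1, a.1.2.comp R.1), a.2.1, by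
    rw [GLPlus.det_comp, ← mul_assoc]
    exact mul_pos a.2.2 R.2⟩

theorem toFrame_rotate (h : IsOrientedParam O σ S ε) (a : ParamFrames S ε) (R : GLPlus m) :
    (h.toFrame a).rotate R = h.toFrame (a.rotate R) := by
  obtain ⟨b, hb⟩ := h.exists_pushesTo a
  rw [← h.mk_eq_toFrame_iff.2 hb]
  change (b.rotate R).mk = _
  refine h.mk_eq_toFrame_iff.2 ?_
  obtain ⟨ψ, h1, h2, h3⟩ := hb
  refine ⟨ψ, h1, h2, ?_⟩
  change b.frame.comp R.1 = _
  rw [h3]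
  rfl

end IsOrientedParam

/-- A frame in a chart of the atlas, as a frame of the parametrization given by the chart. -/
def FrameRep.toParam (b : O.FrameRep) : ParamFrames b.chart.U 1 :=
  ⟨(b.pt, b.frame), b.pt_mem, by rw [one_mul]; exact b.frame_det_pos⟩

theorem FrameRep.toFrame_toParam (b : O.FrameRep) :
    (isOrientedParam_chart b.chart_mem).toFrame b.toParam = b.mk :=
  ((isOrientedParam_chart b.chart_mem).mk_eq_toFrame_iff (a := b.toParam)).2
    (FrameRep.Rel.refl b) |>.symm

theorem FrameBundle.rotate_mul (B : O.FrameBundle) (R R' : GLPlus m) :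
    B.rotate (R * R') = (B.rotate R).rotate R' := by
  obtain ⟨b, rfl⟩ := FrameRep.exists_mk B
  rfl

@[simp] theorem FrameBundle.rotate_one (B : O.FrameBundle) : B.rotate 1 = B := by
  obtain ⟨b, rfl⟩ := FrameRep.exists_mk B
  rfl

theorem FrameBundle.continuous_rotate :
    Continuous (fun q : O.FrameBundle × GLPlus m => q.1.rotate q.2) := by
  refine continuous_iff_continuousAt.2 fun ⟨B₀, R₀⟩ => ?_
  obtain ⟨b, rfl⟩ := FrameRep.exists_mk B₀
  have h := isOrientedParam_chart b.chart_mem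
  obtain ⟨e, he, hee⟩ := h.exists_local_inverse b.toParam
  have hB : e b.toParam = b.mk := by rw [← hee, b.toFrame_toParam]
  have hmem : b.mk ∈ e.target := hB ▸ e.map_source he
  have hc : ContinuousAt (fun q : O.FrameBundle × GLPlus m =>
      h.toFrame ((e.symm q.1).rotate q.2)) (b.mk, R₀) := by
    refine ContinuousAt.comp (f := fun q : O.FrameBundle × GLPlus m => (e.symm q.1).rotate q.2)
      h.continuous_toFrame.continuousAt ?_
    refine Topology.IsInducing.subtypeVal.continuousAt_iff.2 ?_
    have hs : ContinuousAt (fun q : O.FrameBundle × GLPlus m => (e.symm q.1).1) (b.mk, R₀) :=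
      continuous_subtype_val.continuousAt.comp (ContinuousAt.comp (f := Prod.fst)
        (e.continuousAt_symm hmem) continuousAt_fst)
    exact (continuous_fst.continuousAt.comp hs).prodMk
      ((continuous_snd.continuousAt.comp hs).clm_comp
      (continuous_subtype_val.continuousAt.comp continuousAt_snd))
  refine hc.congr ?_
  filter_upwards [(continuousAt_fst (p := (b.mk, R₀))).eventually_mem
    (e.open_target.mem_nhds hmem)] with q hq
  rw [← h.toFrame_rotate, hee, e.right_inv hq]

end ParamFrame

end OrientedOrbifold

/-! ### Frames in a local trivialization of a circle orbibundle -/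

namespace OrientedOrbifold

section PushFrame

variable {m : ℕ} {X : Type u} [TopologicalSpace X] {O : OrientedOrbifold m X} {F : X → X}

theorem pushFrame_mk_iff {a b : O.FrameRep} :
    O.PushFrame F a.mk b.mk ↔ PushesTo F a.chart.φ a.pt a.frame b := by
  constructor
  · rintro ⟨a', b', ha, hb, ψ, h1, h2, h3⟩
    obtain ⟨μ, m1, m2, m3⟩ := FrameRep.mk_eq_iff.1 ha.symm
    refine PushesTo.rel (b := b') ?_ (FrameRep.mk_eq_iff.1 hb)
    rw [← m2] at h1 h2 h3
    refine ⟨ψ ∘ μ, m1.comp h1, h2, ?_⟩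
    rw [h3, m3, m1.fderiv_comp h1.contDiffAt]
    rfl
  · rintro ⟨ψ, h⟩
    exact ⟨a, b, rfl, rfl, ψ, h⟩

theorem PushFrame.unique {A B B' : O.FrameBundle} (h : O.PushFrame F A B)
    (h' : O.PushFrame F A B') : B = B' := by
  obtain ⟨a, rfl⟩ := FrameRep.exists_mk A
  obtain ⟨b, rfl⟩ := FrameRep.exists_mk B
  obtain ⟨b', rfl⟩ := FrameRep.exists_mk B'
  exact FrameRep.mk_eq_iff.2 ((pushFrame_mk_iff.1 h).unique (pushFrame_mk_iff.1 h'))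

/-- Differentials, computed in parametrizations. -/
theorem pushFrame_toFrame {σ σ' : Euc m → X} {S S' : Set (Euc m)} {ε ε' : ℝ}
    (h : IsOrientedParam O σ S ε) (h' : IsOrientedParam O σ' S' ε') {a : ParamFrames S ε}
    {a' : ParamFrames S' ε'} {β : Euc m → Euc m}
    (hβ : ∀ᶠ w in 𝓝 a.1.1, ContDiffAt ℝ ∞ β w ∧ σ' (β w) = F (σ w)) (h0 : β a.1.1 = a'.1.1)
    (h1 : a'.1.2 = (fderiv ℝ β a.1.1).comp a.1.2) :
    O.PushFrame F (h.toFrame a) (h'.toFrame a') := by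
  obtain ⟨b, hb⟩ := h.exists_pushesTo a
  obtain ⟨b', hb'⟩ := h'.exists_pushesTo a'
  rw [← h.mk_eq_toFrame_iff.2 hb, ← h'.mk_eq_toFrame_iff.2 hb', pushFrame_mk_iff]
  obtain ⟨ψ, p1, p2, p3⟩ := hb
  obtain ⟨ψ', q1, q2, q3⟩ := hb'
  obtain ⟨ζ, z1, z2, -, z4, -⟩ := p1.exists_inverse (h.det_lift_ne_zero b.chart_mem a.2.1 p1)
  rw [p2] at z1 z2 z4
  rw [← z1] at hβ h0 h1
  have hζ := z2.self_of_nhds.1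
  have hβc := hβ.self_of_nhds.1
  rw [← h0] at q1 q2 q3
  refine ⟨ψ' ∘ (β ∘ ζ), ?_, q2, ?_⟩
  · refine IsLocalLift.precomp (β := β ∘ ζ) ?_ ?_ ?_ (F := id) (σ := σ') (τ := F ∘ b.chart.φ)
    · exact q1
    · filter_upwards [hζ.continuousAt.eventually hβ, z2] with w hw hw'
      exact hw.1.comp w hw'.1
    · filter_upwards [hζ.continuousAt.eventually hβ, z2] with w hw hw'
      rw [Function.comp_apply, hw.2, hw'.2.2]
      rfl
  · rw [_root_.fderiv_comp b.pt (f := β ∘ ζ) q1.contDiffAt.differentiableAt_smooth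
      (hβc.comp _ hζ).differentiableAt_smooth, _root_.fderiv_comp _ hβc.differentiableAt_smooth
      hζ.differentiableAt_smooth, q3, h1, z1, p3, ContinuousLinearMap.comp_assoc,
      ContinuousLinearMap.comp_assoc, ← ContinuousLinearMap.comp_assoc _ (fderiv ℝ ψ a.1.1) a.1.2,
      z4, ContinuousLinearMap.id_comp, Function.comp_apply, z1]

end PushFrame

end OrientedOrbifold

open OrientedOrbifold

/-- The coordinates `(v₁, …, vₙ)` and `v₀` of `v`, as the base and fibre coordinates. -/
def eucSplit (n : ℕ) : Euc (n + 1) →L[ℝ] Euc n × ℝ := (eucTail n).prod (EuclideanSpace.proj 0)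

theorem eucSplit_apply {n : ℕ} (v : Euc (n + 1)) : eucSplit n v = (eucTail n v, v 0) := rfl

theorem eucSplit_bijective (n : ℕ) : Function.Bijective (eucSplit n) := by
  constructor
  · intro v w h
    rw [eucSplit_apply, eucSplit_apply, Prod.mk.injEq] at h
    rw [← eucFirst_add_eucIncl v, ← eucFirst_add_eucIncl w, h.1, h.2]
  · rintro ⟨x, r⟩
    refine ⟨r • eucFirst n + eucIncl n x, ?_⟩
    rw [eucSplit_apply]
    simp

theorem clm_eq_of_first_of_incl {n m : ℕ} {A B : Euc (n + 1) →L[ℝ] Euc m}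
    (h0 : A (eucFirst n) = B (eucFirst n)) (h1 : A.comp (eucIncl n) = B.comp (eucIncl n)) :
    A = B := by
  ext1 v
  have h2 := congrArg (fun L : Euc n →L[ℝ] Euc m => L (eucTail n v)) h1
  change A (eucIncl n _) = B (eucIncl n _) at h2
  rw [← eucFirst_add_eucIncl v]
  simp only [map_add, map_smul, h0, h2]

section Trivialization

variable {n : ℕ} {M N : Type u} [TopologicalSpace M] [TopologicalSpace N] [MulAction Circle M]
  {OM : OrientedOrbifold (n + 1) M} {ON : OrientedOrbifold n N} {f : M → N}

/-- The parametrization `(θ, x) ↦ Φ(x, e^{iθ})` of the total space given by a local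
trivialization. -/
def OrbibundleTrivialization.param {c : OrbifoldChart n N} (T : OrbibundleTrivialization OM f c)
    (w : Euc (n + 1)) : M :=
  T.Φ (eucTail n w) (Circle.exp (w 0))

theorem OrbibundleTrivialization.isCompatible_param {c : OrbifoldChart n N}
    (T : OrbibundleTrivialization OM f c) {d : OrbifoldChart (n + 1) M} (hd : d ∈ OM.atlas) :
    IsCompatible T.param (eucTail n ⁻¹' c.U) d := by
  intro z hz y hy h
  obtain ⟨ψ, h1, h2, h3⟩ := T.compatible d hd (eucSplit n z) ⟨hz, mem_univ _⟩ y hy h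
  refine ⟨ψ ∘ eucSplit n, ?_, h2, ?_⟩
  · have := (eucSplit n).continuous.continuousAt.eventually h1
    filter_upwards [this] with w hw
    exact ⟨hw.1.comp w (eucSplit n).contDiff.contDiffAt, hw.2.1, hw.2.2⟩
  · rw [fderiv_comp z (h1.self_of_nhds.1.differentiableAt (by simp))
      (eucSplit n).differentiableAt, ContinuousLinearMap.fderiv]
    exact h3.comp (eucSplit_bijective n)

variable (OM ON f) in
/-- A local trivialization over a chart of the base, with the signs that compare the orientations
of the chart `c` and of the parametrization of the total space with those of `N` and `M`. -/
structure BundleChart : Type u where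
  c : OrbifoldChart n N
  T : OrbibundleTrivialization OM f c
  εN : ℝ
  εM : ℝ
  εN_ne_zero : εN ≠ 0
  εM_ne_zero : εM ≠ 0
  param_N : IsOrientedParam ON c.φ c.U εN
  param_M : IsOrientedParam OM T.param (eucTail n ⁻¹' c.U) εM

theorem IsCircleOrbibundle.exists_bundleChart (hf : IsCircleOrbibundle OM ON f) (p : N) :
    ∃ D : BundleChart OM ON f, p ∈ D.c.φ '' D.c.U := by
  obtain ⟨c, hp, hc, ⟨T⟩⟩ := hf p
  have hpre : IsPreconnected (eucTail n ⁻¹' c.U) := by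
    have h1 : eucTail n ⁻¹' c.U
        = (fun q : Euc n × ℝ => q.2 • eucFirst n + eucIncl n q.1) '' (c.U ×ˢ univ) := by
      ext v
      constructor
      · intro hv
        exact ⟨(eucTail n v, v 0), ⟨hv, mem_univ _⟩, eucFirst_add_eucIncl v⟩
      · rintro ⟨q, hq, rfl⟩
        simpa using hq.1
    rw [h1]
    refine (c.isConnected_U.isPreconnected.prod isPreconnected_univ).image _ ?_
    fun_prop
  obtain ⟨εN, h1, h2⟩ := exists_isOrientedParam (O := ON) c.isOpen_U
    c.isConnected_U.isPreconnected hc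
  obtain ⟨εM, h3, h4⟩ := exists_isOrientedParam (O := OM)
    (c.isOpen_U.preimage (eucTail n).continuous) hpre fun d hd => T.isCompatible_param hd
  exact ⟨⟨c, T, εN, εM, h1, h3, h2, h4⟩, hp⟩

namespace BundleChart

variable (D : BundleChart OM ON f)

/-- The frames of the total space in a trivialization. -/
abbrev FramesM : Type := ParamFrames (eucTail n ⁻¹' D.c.U) D.εM

/-- The frames of the base in a trivialization. -/
abbrev FramesN : Type := ParamFrames D.c.U D.εN

/-- The frame of the total space given by a frame in a trivialization. -/
abbrev frameM : D.FramesM → OM.FrameBundle := D.param_M.toFrame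

/-- The frame of the base given by a frame in a trivialization. -/
abbrev frameN : D.FramesN → ON.FrameBundle := D.param_N.toFrame

theorem f_param {w : Euc (n + 1)} (hw : eucTail n w ∈ D.c.U) :
    f (D.T.param w) = D.c.φ (eucTail n w) := D.T.lies_over _ hw _

theorem exists_frameM {B : OM.FrameBundle} (hB : f B.base ∈ D.c.φ '' D.c.U) :
    ∃ a : D.FramesM, D.frameM a = B := by
  obtain ⟨x, hx, t, ht⟩ := D.T.surj B.base hB
  obtain ⟨θ, rfl⟩ := Circle.exp_surjective t
  have h1 : eucTail n (θ • eucFirst n + eucIncl n x) = x := by simp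
  have h2 : (θ • eucFirst n + eucIncl n x) 0 = θ := by simp
  obtain ⟨a, -, ha⟩ := D.param_M.exists_toFrame_eq D.εM_ne_zero (B := B)
    (x := θ • eucFirst n + eucIncl n x) (by rw [mem_preimage, h1]; exact hx) (by
      rw [OrbibundleTrivialization.param, h1, h2, ht])
  exact ⟨a, ha⟩

theorem exists_lift_tail {d : OrbifoldChart n N} (hd : d ∈ ON.atlas) {z : Euc (n + 1)}
    (hz : eucTail n z ∈ D.c.U) {ψ : Euc (n + 1) → Euc n} (hψ : IsLocalLift f D.T.param d ψ z) :
    ∃ η : Euc n → Euc n, IsLocalLift id D.c.φ d η (eucTail n z) ∧ η (eucTail n z) = ψ z ∧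
      fderiv ℝ ψ z = (fderiv ℝ η (eucTail n z)).comp (eucTail n) := by
  obtain ⟨η, h1, h2⟩ := D.param_N.exists_lift d hd (eucTail n z) hz (ψ z) hψ.mem
    ((D.f_param hz).symm.trans hψ.map_eq.symm)
  have hc : ContinuousAt (eucTail n) z := (eucTail n).continuous.continuousAt
  have hl : IsLocalLift f D.T.param d (η ∘ eucTail n) z := by
    filter_upwards [hc.eventually h1, hc.eventually (D.c.isOpen_U.mem_nhds hz)] with w hw hw'
    exact ⟨hw.1.comp w (eucTail n).contDiff.contDiffAt, hw.2.1,
      hw.2.2.trans (D.f_param hw').symm⟩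
  obtain ⟨γ, hγ, hj⟩ := exists_jetEq hl hψ
  refine ⟨d.ext γ ∘ η, h1.comp (isLocalLift_ext hγ h1.mem), hj.1.symm, ?_⟩
  rw [hj.2, h1.fderiv_comp (contDiffAt_ext hγ h1.mem), fderiv_comp z
    h1.contDiffAt.differentiableAt_smooth (eucTail n).differentiableAt, ContinuousLinearMap.fderiv]
  rfl

/-- Adapted frames and their projections in a trivialization. -/
theorem frameProjects_iff {a : D.FramesM} {A : ON.FrameBundle} :
    FrameProjects f (D.frameM a) A ↔ eucTail n (a.1.2 (eucFirst n)) = 0 ∧ ∃ a' : D.FramesN,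
      a'.1 = (eucTail n a.1.1, ((eucTail n).comp a.1.2).comp (eucIncl n)) ∧ D.frameN a' = A := by
  constructor
  · rintro ⟨b, r, hb, rfl, ψ, h1, h2, h3, h4⟩
    obtain ⟨μ, m1, m2, m3⟩ := D.param_M.mk_eq_toFrame_iff.1 hb
    rw [← m2] at h1 h2 h3 h4
    have hl : IsLocalLift f D.T.param r.chart (ψ ∘ μ) a.1.1 := m1.comp h1
    obtain ⟨η, e1, e2, e3⟩ := D.exists_lift_tail r.chart_mem a.2.1 hl
    have hd := D.param_N.det_lift_ne_zero r.chart_mem a.2.1 e1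
    have h5 : (fderiv ℝ ψ (μ a.1.1)).comp b.frame
        = (fderiv ℝ η (eucTail n a.1.1)).comp ((eucTail n).comp a.1.2) := by
      rw [m3, ← ContinuousLinearMap.comp_assoc, ← m1.fderiv_comp h1.contDiffAt, e3,
        ContinuousLinearMap.comp_assoc]
    have h6 : r.frame = (fderiv ℝ η (eucTail n a.1.1)).comp
        (((eucTail n).comp a.1.2).comp (eucIncl n)) := by
      rw [← h4, h5, ContinuousLinearMap.comp_assoc]
    have h7 : eucTail n (a.1.2 (eucFirst n)) = 0 := by
      have h8 := congrArg (fun L : Euc (n + 1) →L[ℝ] Euc n => L (eucFirst n)) h5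
      refine (bijective_of_det_ne_zero hd).1 ?_
      rw [map_zero, ← h3]
      exact h8.symm
    -- `η` has a derivative of sign `εN`, and `r.frame` is positively oriented
    have h9 : 0 < D.εN * (((eucTail n).comp a.1.2).comp (eucIncl n)).det := by
      have p1 := D.param_N.det_pos r.chart r.chart_mem _ a.2.1 η e1
      have p2 := r.frame_det_pos
      rw [h6, GLPlus.det_comp] at p2
      have p3 : 0 < (fderiv ℝ η (eucTail n a.1.1)).det ^ 2 := by positivity
      refine pos_of_mul_pos_right ?_ p3.le
      nlinarith [mul_pos p1 p2]
    refine ⟨h7, ⟨(eucTail n a.1.1, ((eucTail n).comp a.1.2).comp (eucIncl n)), a.2.1, h9⟩, rfl, ?_⟩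
    exact (D.param_N.mk_eq_toFrame_iff.2 ⟨η, e1, e2.trans h2, h6⟩).symm
  · rintro ⟨h0, a', ha', rfl⟩
    obtain ⟨b, hb⟩ := D.param_M.exists_pushesTo a
    obtain ⟨r, hr⟩ := D.param_N.exists_pushesTo a'
    refine ⟨b, r, D.param_M.mk_eq_toFrame_iff.2 hb, D.param_N.mk_eq_toFrame_iff.2 hr, ?_⟩
    obtain ⟨μ, m1, m2, m3⟩ := hb
    obtain ⟨η, e1, e2, e3⟩ := hr
    rw [ha'] at e1 e2 e3
    change IsLocalLift _ _ _ η (eucTail n a.1.1) at e1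
    change η (eucTail n a.1.1) = _ at e2
    change _ = (fderiv ℝ η (eucTail n a.1.1)).comp _ at e3
    obtain ⟨ζ, z1, z2, -, z4, -⟩ :=
      m1.exists_inverse (D.param_M.det_lift_ne_zero b.chart_mem a.2.1 m1)
    rw [m2] at z1 z2 z4
    have hζ := z2.self_of_nhds.1
    have hT : ContDiffAt ℝ ∞ (eucTail n) (ζ b.pt) := (eucTail n).contDiff.contDiffAt
    have hc : ContinuousAt (fun w => eucTail n (ζ w)) b.pt :=
      ContinuousAt.comp (g := eucTail n) (eucTail n).continuous.continuousAt hζ.continuousAt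
    have hfd : fderiv ℝ (η ∘ (eucTail n ∘ ζ)) b.pt
        = (fderiv ℝ η (eucTail n a.1.1)).comp ((eucTail n).comp (fderiv ℝ ζ b.pt)) := by
      rw [fderiv_comp _ (by
          rw [Function.comp_apply, z1]
          exact e1.contDiffAt.differentiableAt_smooth)
        (hT.comp _ hζ).differentiableAt_smooth, fderiv_comp _ hT.differentiableAt_smooth
        hζ.differentiableAt_smooth, ContinuousLinearMap.fderiv, Function.comp_apply, z1]
    have hfb : (fderiv ℝ (η ∘ (eucTail n ∘ ζ)) b.pt).comp b.frame
        = (fderiv ℝ η (eucTail n a.1.1)).comp ((eucTail n).comp a.1.2) := by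
      rw [hfd, m3, ContinuousLinearMap.comp_assoc, ContinuousLinearMap.comp_assoc,
        ← ContinuousLinearMap.comp_assoc _ _ a.1.2, z4, ContinuousLinearMap.id_comp]
    -- in the chart `b.chart`, the map `f` is the projection to `ℝⁿ` in the trivialization
    refine ⟨η ∘ (eucTail n ∘ ζ), ?_, by rw [← e2, ← z1]; rfl, ?_, ?_⟩
    · have t1 : ∀ᶠ w in 𝓝 b.pt, ContDiffAt ℝ ∞ η (eucTail n (ζ w)) ∧
          η (eucTail n (ζ w)) ∈ r.chart.U ∧
          r.chart.φ (η (eucTail n (ζ w))) = id (D.c.φ (eucTail n (ζ w))) := by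
        refine hc.eventually (p := fun y => ContDiffAt ℝ ∞ η y ∧ η y ∈ r.chart.U ∧
          r.chart.φ (η y) = id (D.c.φ y)) ?_
        beta_reduce
        rw [z1]
        exact e1
      have t2 : ∀ᶠ w in 𝓝 b.pt, eucTail n (ζ w) ∈ D.c.U := by
        refine hc.eventually_mem (D.c.isOpen_U.mem_nhds ?_)
        rw [z1]
        exact a.2.1
      filter_upwards [t1, t2, z2] with w k1 k2 k3
      refine ⟨k1.1.comp w ((eucTail n).contDiff.contDiffAt.comp w k3.1), k1.2.1, ?_⟩
      rw [← k3.2.2, D.f_param k2]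
      exact k1.2.2
    · have h8 := congrArg (fun L : Euc (n + 1) →L[ℝ] Euc n => L (eucFirst n)) hfb
      refine Eq.trans h8 ?_
      change (fderiv ℝ η (eucTail n a.1.1)) (eucTail n (a.1.2 (eucFirst n))) = 0
      rw [h0, map_zero]
    · rw [hfb, e3, ContinuousLinearMap.comp_assoc]

end BundleChart

end Trivialization

/-- The group of the frame changes of `ℝⁿ⁺¹ = ℝ × ℝⁿ` that act trivially on the quotient `ℝⁿ`
of the tangent space by the vertical line. -/
def verticalShears (n : ℕ) : Subgroup (GLPlus (n + 1)) where
  carrier := {a | ∀ v, eucTail n (a.1 v) = eucTail n v}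
  mul_mem' {a b} ha hb v := (ha _).trans (hb v)
  one_mem' _ := rfl
  inv_mem' {a} ha v := by rw [← ha, GLPlus.apply_inv_apply]

theorem eucTail_comp_eq {n m : ℕ} {L : Euc (n + 1) →L[ℝ] Euc m} (h : L (eucFirst n) = 0)
    (v : Euc (n + 1)) : L v = L (eucIncl n (eucTail n v)) := by
  conv_lhs => rw [← eucFirst_add_eucIncl v, map_add, map_smul, h, smul_zero, zero_add]

theorem eq_smul_eucFirst {n : ℕ} {v : Euc (n + 1)} (h : eucTail n v = 0) :
    v = v 0 • eucFirst n := by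
  conv_lhs => rw [← eucFirst_add_eucIncl v, h, map_zero, add_zero]

namespace OrientedOrbifold

variable {m : ℕ} {X : Type u} [TopologicalSpace X] {O : OrientedOrbifold m X}

theorem IsOrientedParam.det_change_pos {σ : Euc m → X} {S : Set (Euc m)} {ε : ℝ}
    (h : IsOrientedParam O σ S ε) {β : Euc m → Euc m} {x : Euc m} (hx : x ∈ S)
    (hβ : ∀ᶠ w in 𝓝 x, ContDiffAt ℝ ∞ β w ∧ σ (β w) = σ w) (hβx : β x ∈ S) :
    0 < (fderiv ℝ β x).det := by
  obtain ⟨d, hd, y, hy, hxy⟩ := O.covers (σ (β x))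
  obtain ⟨ψ, h1, -⟩ := h.exists_lift d hd (β x) hβx y hy hxy.symm
  have h2 : IsLocalLift id σ d (ψ ∘ β) x :=
    h1.precomp (hβ.mono fun w hw => hw.1) (hβ.mono fun w hw => hw.2)
  have p1 := h.det_pos d hd _ hβx ψ h1
  have p2 := h.det_pos d hd _ hx _ h2
  rw [_root_.fderiv_comp x h1.contDiffAt.differentiableAt_smooth
    hβ.self_of_nhds.1.differentiableAt_smooth, GLPlus.det_comp, ← mul_assoc] at p2
  exact pos_of_mul_pos_right p2 p1.le

namespace ParamFrames

variable {S : Set (Euc m)} {ε : ℝ}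

/-- The frame change that carries the linear map of `a` to that of `b`. -/
def ratio (a b : ParamFrames S ε) : GLPlus m :=
  ⟨(Ring.inverse a.1.2).comp b.1.2, by
    have ha := IsOrientedParam.frame_det_ne_zero a
    rw [GLPlus.det_comp, GLPlus.det_inverse ha]
    have p := mul_pos a.2.2 b.2.2
    have hε := IsOrientedParam.ne_zero_sign a
    have e : a.1.2.det⁻¹ * b.1.2.det
        = (ε * a.1.2.det * (ε * b.1.2.det)) * (a.1.2.det⁻¹ ^ 2 * ε⁻¹ ^ 2) := by
      field_simp
    rw [e]
    positivity⟩

theorem comp_ratio (a b : ParamFrames S ε) : a.1.2.comp (ratio a b).1 = b.1.2 := by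
  change a.1.2.comp ((Ring.inverse a.1.2).comp b.1.2) = _
  rw [← ContinuousLinearMap.comp_assoc,
    GLPlus.comp_inverse (IsOrientedParam.frame_det_ne_zero a), ContinuousLinearMap.id_comp]

theorem continuous_ratio :
    Continuous (fun p : ParamFrames S ε × ParamFrames S ε => ratio p.1 p.2) := by
  refine Continuous.subtype_mk (continuous_iff_continuousAt.2 fun p => ?_) _
  have h1 : ContinuousAt (fun p : ParamFrames S ε × ParamFrames S ε => p.1.1.2) p :=
    (continuous_snd.comp (continuous_subtype_val.comp continuous_fst)).continuousAt
  have h2 : ContinuousAt (fun p : ParamFrames S ε × ParamFrames S ε => p.2.1.2) p :=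
    (continuous_snd.comp (continuous_subtype_val.comp continuous_snd)).continuousAt
  have h3 : ContinuousAt (fun p : ParamFrames S ε × ParamFrames S ε => Ring.inverse p.1.1.2) p :=
    ContinuousAt.comp (g := Ring.inverse)
      (GLPlus.continuousAt_inverse (IsOrientedParam.frame_det_ne_zero p.1)) h1
  exact h3.clm_comp h2

theorem continuousAt_ratio {T : Type*} [TopologicalSpace T] {f g : T → ParamFrames S ε} {x : T}
    (hf : ContinuousAt f x) (hg : ContinuousAt g x) :
    ContinuousAt (fun y => ratio (f y) (g y)) x :=
  (continuous_ratio.tendsto (f x, g x)).comp (hf.prodMk hg)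

end ParamFrames

end OrientedOrbifold

section CircleBundle

variable {n : ℕ} {M N : Type u} [TopologicalSpace M] [TopologicalSpace N] [MulAction Circle M]
  {OM : OrientedOrbifold (n + 1) M} {ON : OrientedOrbifold n N} {f : M → N}

/-! ### The circle action on the frames -/

namespace BundleChart

variable (D : BundleChart OM ON f)

/-- Translation along the fibre in a trivialization. -/
def shift (a : D.FramesM) (θ : ℝ) : D.FramesM :=
  ⟨(a.1.1 + θ • eucFirst n, a.1.2), by
    change eucTail n (a.1.1 + θ • eucFirst n) ∈ D.c.U
    simpa using a.2.1, a.2.2⟩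

theorem continuous_shift : Continuous (fun p : D.FramesM × ℝ => D.shift p.1 p.2) := by
  refine Continuous.subtype_mk ?_ _
  fun_prop

theorem param_shift {w : Euc (n + 1)} (hw : eucTail n w ∈ D.c.U) (θ : ℝ) :
    D.T.param (w + θ • eucFirst n) = Circle.exp θ • D.T.param w := by
  have h1 : eucTail n (w + θ • eucFirst n) = eucTail n w := by simp
  have h2 : (w + θ • eucFirst n) 0 = θ + w 0 := by simp [add_comm]
  rw [OrbibundleTrivialization.param, h1, h2, Circle.exp_add, D.T.equivariant _ hw]
  rfl

theorem pushFrame_shift (a : D.FramesM) (θ : ℝ) :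
    OM.PushFrame (fun x => Circle.exp θ • x) (D.frameM a) (D.frameM (D.shift a θ)) := by
  have hd : fderiv ℝ (fun w : Euc (n + 1) => w + θ • eucFirst n) a.1.1
      = ContinuousLinearMap.id ℝ _ := by
    rw [fderiv_add_const]
    exact fderiv_id
  refine pushFrame_toFrame D.param_M D.param_M (β := fun w => w + θ • eucFirst n) ?_ rfl ?_
  · filter_upwards [D.param_M.isOpen.mem_nhds a.2.1] with w hw
    exact ⟨contDiffAt_id.add contDiffAt_const, D.param_shift hw θ⟩
  · rw [hd]
    rfl

end BundleChart

namespace IsCircleOrbibundle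

theorem exists_pushFrame (hf : IsCircleOrbibundle OM ON f) (t : Circle) (B : OM.FrameBundle) :
    ∃ B', OM.PushFrame (fun x => t • x) B B' := by
  obtain ⟨D, hD⟩ := hf.exists_bundleChart (f B.base)
  obtain ⟨a, rfl⟩ := D.exists_frameM hD
  obtain ⟨θ, rfl⟩ := Circle.exp_surjective t
  exact ⟨_, D.pushFrame_shift a θ⟩

variable (hf : IsCircleOrbibundle OM ON f)

/-- The action of the circle on the frame bundle by differentials. -/
def circ (t : Circle) (B : OM.FrameBundle) : OM.FrameBundle := (hf.exists_pushFrame t B).choose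

theorem pushFrame_iff {t : Circle} {B B' : OM.FrameBundle} :
    OM.PushFrame (fun x => t • x) B B' ↔ B' = hf.circ t B := by
  have h := (hf.exists_pushFrame t B).choose_spec
  exact ⟨fun h' => h'.unique h, fun h' => h' ▸ h⟩

theorem circ_frameM (D : BundleChart OM ON f) (a : D.FramesM) (θ : ℝ) :
    hf.circ (Circle.exp θ) (D.frameM a) = D.frameM (D.shift a θ) :=
  (hf.pushFrame_iff.1 (D.pushFrame_shift a θ)).symm

theorem circ_one (B : OM.FrameBundle) : hf.circ 1 B = B := by
  obtain ⟨D, hD⟩ := hf.exists_bundleChart (f B.base)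
  obtain ⟨a, rfl⟩ := D.exists_frameM hD
  rw [← Circle.exp_zero, hf.circ_frameM]
  exact congrArg _ (Subtype.ext (Prod.ext (by simp [BundleChart.shift]) rfl))

theorem circ_mul (s t : Circle) (B : OM.FrameBundle) :
    hf.circ (s * t) B = hf.circ s (hf.circ t B) := by
  obtain ⟨D, hD⟩ := hf.exists_bundleChart (f B.base)
  obtain ⟨a, rfl⟩ := D.exists_frameM hD
  obtain ⟨θ, rfl⟩ := Circle.exp_surjective s
  obtain ⟨η, rfl⟩ := Circle.exp_surjective t
  rw [← Circle.exp_add, hf.circ_frameM, hf.circ_frameM, hf.circ_frameM]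
  exact congrArg _ (Subtype.ext (Prod.ext (by simp [BundleChart.shift, add_smul, add_assoc,
    add_comm (θ • eucFirst n)]) rfl))

theorem circ_rotate (t : Circle) (B : OM.FrameBundle) (R : GLPlus (n + 1)) :
    hf.circ t (B.rotate R) = (hf.circ t B).rotate R := by
  obtain ⟨D, hD⟩ := hf.exists_bundleChart (f B.base)
  obtain ⟨a, rfl⟩ := D.exists_frameM hD
  obtain ⟨θ, rfl⟩ := Circle.exp_surjective t
  rw [D.param_M.toFrame_rotate, hf.circ_frameM, hf.circ_frameM, D.param_M.toFrame_rotate]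
  rfl

theorem continuous_circ : Continuous (fun p : Circle × OM.FrameBundle => hf.circ p.1 p.2) := by
  refine continuous_iff_continuousAt.2 fun ⟨t₀, B₀⟩ => ?_
  obtain ⟨D, hD⟩ := hf.exists_bundleChart (f B₀.base)
  obtain ⟨a, rfl⟩ := D.exists_frameM hD
  obtain ⟨θ, rfl⟩ := Circle.exp_surjective t₀
  obtain ⟨e, he, hee⟩ := D.param_M.exists_local_inverse a
  have hB : D.frameM a = e a := congrFun hee a
  have hmem : D.frameM a ∈ e.target := hB ▸ e.map_source he
  -- the angle of `t`, close to `θ`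
  let α : Circle → ℝ := fun t => θ + Complex.arg ((t / Circle.exp θ : Circle) : ℂ)
  have hα : ∀ t, Circle.exp (α t) = t := fun t => by
    rw [Circle.exp_add, Circle.exp_arg, mul_div_cancel]
  have hαc : ContinuousAt α (Circle.exp θ) := by
    refine continuousAt_const.add (ContinuousAt.comp (g := Complex.arg)
      (f := fun t : Circle => ((t / Circle.exp θ : Circle) : ℂ)) ?_ ?_)
    · refine Complex.continuousAt_arg ?_
      simp
    · have h : Continuous fun t : Circle => t / Circle.exp θ := continuous_id.div_const _
      exact (Continuous.comp (g := ((↑) : Circle → ℂ)) continuous_induced_dom h).continuousAt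
  have hc : ContinuousAt (fun p : Circle × OM.FrameBundle =>
      D.frameM (D.shift (e.symm p.2) (α p.1))) (Circle.exp θ, D.frameM a) := by
    refine ContinuousAt.comp (f := fun p : Circle × OM.FrameBundle =>
      D.shift (e.symm p.2) (α p.1)) D.param_M.continuous_toFrame.continuousAt ?_
    refine ContinuousAt.comp (f := fun p : Circle × OM.FrameBundle => (e.symm p.2, α p.1))
      D.continuous_shift.continuousAt ?_
    exact (ContinuousAt.comp (f := Prod.snd) (e.continuousAt_symm hmem) continuousAt_snd).prodMk
      (ContinuousAt.comp (f := Prod.fst) (g := α) hαc continuousAt_fst)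
  refine hc.congr ?_
  filter_upwards [(continuousAt_snd (p := (Circle.exp θ, D.frameM a))).eventually_mem
    (e.open_target.mem_nhds hmem)] with p hp
  have h1 : D.frameM (e.symm p.2) = p.2 := (congrFun hee _).trans (e.right_inv hp)
  rw [← hf.circ_frameM, hα, h1]

end IsCircleOrbibundle

/-! ### Adapted frames form a principal bundle over the frames of the base -/

namespace BundleChart

variable (D : BundleChart OM ON f)

theorem adapted_sign {a : D.FramesM} (h0 : eucTail n (a.1.2 (eucFirst n)) = 0) :
    0 < D.εN * (((eucTail n).comp a.1.2).comp (eucIncl n)).det ↔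
      0 < D.εM * D.εN * (a.1.2 (eucFirst n)) 0 := by
  have hdet := det_eq_of_tail_comp (C := a.1.2) (A := ((eucTail n).comp a.1.2).comp (eucIncl n))
    (eucTail_comp_eq (L := (eucTail n).comp a.1.2) h0)
  have p := a.2.2
  rw [hdet] at p
  set r := (a.1.2 (eucFirst n)) 0
  set δ := (((eucTail n).comp a.1.2).comp (eucIncl n)).det
  have e : D.εN * δ * (D.εM * D.εN * r) = D.εM * (r * δ) * D.εN ^ 2 := by ring
  have h : 0 < D.εN * δ * (D.εM * D.εN * r) := by
    rw [e]
    have := D.εN_ne_zero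
    positivity
  exact ⟨fun h1 => pos_of_mul_pos_right h h1.le, fun h1 => pos_of_mul_pos_left h h1.le⟩

theorem exists_frameProjects {a : D.FramesM} (h0 : eucTail n (a.1.2 (eucFirst n)) = 0)
    (h1 : 0 < D.εM * D.εN * (a.1.2 (eucFirst n)) 0) :
    ∃ A : ON.FrameBundle, FrameProjects f (D.frameM a) A :=
  ⟨_, D.frameProjects_iff.2 ⟨h0, ⟨(eucTail n a.1.1, ((eucTail n).comp a.1.2).comp (eucIncl n)),
    a.2.1, (D.adapted_sign h0).2 h1⟩, rfl, rfl⟩⟩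

/-- An adapted frame over a frame of the base in a trivialization: the product frame. -/
def sect (a : D.FramesN) : D.FramesM :=
  ⟨(eucIncl n a.1.1, ((EuclideanSpace.proj 0 : Euc (n + 1) →L[ℝ] ℝ).smulRight
    ((D.εM * D.εN) • eucFirst n)) + (eucIncl n).comp (a.1.2.comp (eucTail n))), by
    change eucTail n (eucIncl n a.1.1) ∈ D.c.U
    rw [eucTail_eucIncl]
    exact a.2.1, by
    have hdet := det_eq_of_tail_comp (C := ((EuclideanSpace.proj 0 : Euc (n + 1) →L[ℝ] ℝ).smulRight
      ((D.εM * D.εN) • eucFirst n)) + (eucIncl n).comp (a.1.2.comp (eucTail n))) (A := a.1.2)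
      (fun v => by simp)
    have hp := a.2.2
    change 0 < D.εM * ContinuousLinearMap.det _
    rw [hdet]
    have e : (((EuclideanSpace.proj 0 : Euc (n + 1) →L[ℝ] ℝ).smulRight
      ((D.εM * D.εN) • eucFirst n)) + (eucIncl n).comp (a.1.2.comp (eucTail n))) (eucFirst n) 0
        = D.εM * D.εN := by simp
    rw [e]
    have := D.εM_ne_zero
    have e2 : D.εM * (D.εM * D.εN * a.1.2.det) = D.εM ^ 2 * (D.εN * a.1.2.det) := by ring
    rw [e2]
    positivity⟩

theorem tail_sect (a : D.FramesN) (v : Euc (n + 1)) :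
    eucTail n ((D.sect a).1.2 v) = a.1.2 (eucTail n v) := by
  simp [sect]

theorem continuous_sect : Continuous D.sect := by
  have h2 : Continuous fun a : D.FramesN => a.1.2 := continuous_snd.comp continuous_subtype_val
  refine Continuous.subtype_mk (Continuous.prodMk ?_ (continuous_const.add
    (continuous_const.clm_comp (h2.clm_comp continuous_const)))) _
  exact (eucIncl n).continuous.comp (continuous_fst.comp continuous_subtype_val)

theorem frameProjects_sect (a : D.FramesN) :
    FrameProjects f (D.frameM (D.sect a)) (D.frameN a) := by
  refine D.frameProjects_iff.2 ⟨by rw [tail_sect, eucTail_eucFirst, map_zero], a, ?_, rfl⟩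
  refine Prod.ext (eucTail_eucIncl _).symm ?_
  ext1 v
  change _ = eucTail n ((D.sect a).1.2 (eucIncl n v))
  rw [tail_sect, eucTail_eucIncl]

theorem ratio_mem_verticalShears {a b : D.FramesM} (ha : eucTail n (a.1.2 (eucFirst n)) = 0)
    (hb : eucTail n (b.1.2 (eucFirst n)) = 0)
    (h : ((eucTail n).comp a.1.2).comp (eucIncl n) = ((eucTail n).comp b.1.2).comp (eucIncl n))
    (hd : (((eucTail n).comp b.1.2).comp (eucIncl n)).det ≠ 0) :
    ParamFrames.ratio a b ∈ verticalShears n := by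
  intro v
  have h1 := congrArg (fun L : Euc (n + 1) →L[ℝ] Euc (n + 1) => eucTail n (L v))
    (ParamFrames.comp_ratio a b)
  change eucTail n (a.1.2 ((ParamFrames.ratio a b).1 v)) = eucTail n (b.1.2 v) at h1
  have h2 := eucTail_comp_eq (L := (eucTail n).comp a.1.2) ha ((ParamFrames.ratio a b).1 v)
  have h3 := eucTail_comp_eq (L := (eucTail n).comp b.1.2) hb v
  change eucTail n (a.1.2 _) = (((eucTail n).comp a.1.2).comp (eucIncl n)) _ at h2
  change eucTail n (b.1.2 _) = (((eucTail n).comp b.1.2).comp (eucIncl n)) _ at h3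
  rw [h2, h3, h] at h1
  exact (bijective_of_det_ne_zero hd).1 h1

theorem frameM_eq_circ_rotate (hf : IsCircleOrbibundle OM ON f) {a b : D.FramesM}
    (h : eucTail n a.1.1 = eucTail n b.1.1) :
    D.frameM b = (hf.circ (Circle.exp (b.1.1 0 - a.1.1 0)) (D.frameM a)).rotate
      (ParamFrames.ratio a b) := by
  rw [hf.circ_frameM, D.param_M.toFrame_rotate]
  refine congrArg _ (Subtype.ext (Prod.ext ?_ (ParamFrames.comp_ratio a b).symm))
  change b.1.1 = a.1.1 + (b.1.1 0 - a.1.1 0) • eucFirst n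
  conv_lhs => rw [← eucFirst_add_eucIncl b.1.1, ← h]
  conv_rhs => rw [← eucFirst_add_eucIncl a.1.1]
  simp only [sub_smul, PiLp.add_apply, PiLp.smul_apply, eucFirst_zero_coord, eucIncl_zero_coord,
    smul_eq_mul, mul_one, add_zero]
  abel

/-- A smooth argument of the cocycle of a trivialization. -/
theorem exists_cocycle_arg {γ : Equiv.Perm D.c.U} (hγ : γ ∈ D.c.Γ) {x : Euc n} (hx : x ∈ D.c.U) :
    ∃ l : Euc n → ℝ, ∀ᶠ y in 𝓝 x, ContDiffAt ℝ ∞ l y ∧ Circle.exp (l y) = D.T.a γ y := by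
  obtain ⟨θ, hθ⟩ := Circle.exp_surjective (D.T.a γ x)
  let q : Euc n → ℂ := fun y => (D.T.a γ y : ℂ) / (D.T.a γ x : ℂ)
  have hq : ∀ y, q y = ((D.T.a γ y / D.T.a γ x : Circle) : ℂ) := fun y => (Circle.coe_div _ _).symm
  have hqs : ∀ y ∈ D.c.U, ContDiffAt ℝ ∞ q y := fun y hy =>
    ((D.T.smooth_a γ hγ).contDiffAt (D.c.isOpen_U.mem_nhds hy)).div_const _
  have hq1 : q x ∈ Complex.slitPlane := by
    rw [hq, div_self', Circle.coe_one]
    exact Complex.one_mem_slitPlane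
  refine ⟨fun y => θ + Complex.arg (q y), ?_⟩
  filter_upwards [D.c.isOpen_U.mem_nhds hx,
    (hqs x hx).continuousAt.eventually_mem (Complex.isOpen_slitPlane.mem_nhds hq1)] with y hy hy'
  refine ⟨contDiffAt_const.add ?_, ?_⟩
  · have h1 : ContDiffAt ℝ ∞ (fun y => Complex.log (q y)) y :=
      ContDiffAt.comp y ((Complex.contDiffAt_log hy').restrict_scalars ℝ) (hqs y hy)
    refine ((Complex.imCLM.contDiff.contDiffAt (x := Complex.log (q y))).comp y
      h1).congr_of_eventuallyEq (Eventually.of_forall fun w => ?_)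
    exact (Complex.log_im (q w)).symm
  · rw [hq, Circle.exp_add, Circle.exp_arg, hθ, mul_div_cancel]

/-- The elements of the chart group act on the trivialization by bundle automorphisms, so they
identify frames of the total space. -/
theorem exists_deck {γ : Equiv.Perm D.c.U} (hγ : γ ∈ D.c.Γ) (a : D.FramesM) :
    ∃ b : D.FramesM, D.frameM b = D.frameM a ∧ eucTail n b.1.1 = D.c.ext γ (eucTail n a.1.1) ∧
      (eucTail n).comp b.1.2
        = (fderiv ℝ (D.c.ext γ) (eucTail n a.1.1)).comp ((eucTail n).comp a.1.2) := by
  have hx : eucTail n a.1.1 ∈ D.c.U := a.2.1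
  obtain ⟨l, hl⟩ := D.exists_cocycle_arg hγ hx
  -- the lift of the bundle automorphism `(x, t) ↦ (γ x, a_γ(x) t)` to `ℝⁿ × ℝ`
  let β : Euc (n + 1) → Euc (n + 1) := fun w =>
    (w 0 + l (eucTail n w)) • eucFirst n + eucIncl n (D.c.ext γ (eucTail n w))
  have hc : ContinuousAt (eucTail n) a.1.1 := (eucTail n).continuous.continuousAt
  have htail : ∀ w, eucTail n (β w) = D.c.ext γ (eucTail n w) := fun w => by simp [β]
  have hβ : ∀ᶠ w in 𝓝 a.1.1, ContDiffAt ℝ ∞ β w ∧ D.T.param (β w) = D.T.param w := by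
    filter_upwards [hc.eventually hl, hc.eventually (D.c.isOpen_U.mem_nhds hx)] with w hw hw'
    have hT : ContDiffAt ℝ ∞ (eucTail n) w := (eucTail n).contDiff.contDiffAt
    constructor
    · have h1 : ContDiffAt ℝ ∞ (fun w : Euc (n + 1) => w 0) w :=
        (EuclideanSpace.proj 0 : Euc (n + 1) →L[ℝ] ℝ).contDiff.contDiffAt
      have h2 : ContDiffAt ℝ ∞ (fun w => l (eucTail n w)) w := hw.1.comp w hT
      have h3 : ContDiffAt ℝ ∞ (fun w => D.c.ext γ (eucTail n w)) w :=
        (contDiffAt_ext hγ hw').comp w hT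
      exact ((h1.add h2).smul contDiffAt_const).add
        ((eucIncl n).contDiff.contDiffAt.comp w h3)
    · rw [OrbibundleTrivialization.param, OrbibundleTrivialization.param, htail]
      refine ((D.T.eq_iff ⟨_, hw'⟩ ⟨_, ext_mem hγ hw'⟩ _ _).2 ⟨γ, hγ, ?_, ?_⟩).symm
      · exact Subtype.ext (ext_apply' hγ hw').symm
      · have h0 : (β w) 0 = l (eucTail n w) + w 0 := by simp [β, add_comm]
        rw [h0, Circle.exp_add, hw.2]
  have hmem : β a.1.1 ∈ eucTail n ⁻¹' D.c.U := by
    rw [mem_preimage, htail]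
    exact ext_mem hγ hx
  have hdet := D.param_M.det_change_pos a.2.1 hβ hmem
  refine ⟨⟨(β a.1.1, (fderiv ℝ β a.1.1).comp a.1.2), hmem, ?_⟩, ?_, htail _, ?_⟩
  · change 0 < D.εM * ((fderiv ℝ β a.1.1).comp a.1.2).det
    rw [GLPlus.det_comp, mul_left_comm]
    exact mul_pos hdet a.2.2
  · exact ((D.param_M.toFrame_eq_iff D.param_M).2 ⟨β, hβ, rfl, rfl⟩).symm
  · have h1 : fderiv ℝ (eucTail n ∘ β) a.1.1 = (eucTail n).comp (fderiv ℝ β a.1.1) := by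
      rw [fderiv_comp _ (eucTail n).differentiableAt hβ.self_of_nhds.1.differentiableAt_smooth,
        ContinuousLinearMap.fderiv]
    have h2 : eucTail n ∘ β = D.c.ext γ ∘ eucTail n := funext htail
    rw [h2, fderiv_comp _ (contDiffAt_ext hγ hx).differentiableAt_smooth
      (eucTail n).differentiableAt, ContinuousLinearMap.fderiv] at h1
    change (eucTail n).comp ((fderiv ℝ β a.1.1).comp a.1.2) = _
    rw [← ContinuousLinearMap.comp_assoc, ← h1, ContinuousLinearMap.comp_assoc]

end BundleChart

end CircleBundle

/-! ### The circle and the vertical shears act simply transitively -/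

/-- Points with trivial isotropy are dense. -/
theorem OrbifoldChart.frequently_trivial_isotropy {m : ℕ} {X : Type u} [TopologicalSpace X]
    (c : OrbifoldChart m X) {x : Euc m} (hx : x ∈ c.U) :
    ∃ᶠ y in 𝓝 x, y ∈ c.U ∧ ∀ δ ∈ c.Γ, c.ext δ y = y → δ = 1 := by
  intro hev
  have hfin : Finite c.Γ := c.finite_Γ
  have hft := Fintype.ofFinite c.Γ
  obtain ⟨V, hVx, hVo, hxV⟩ := mem_nhds_iff.1 (inter_mem hev (c.isOpen_U.mem_nhds hx))
  classical
  obtain ⟨δ, hδ, V', hV', hV'o, ⟨y, hy⟩, hV'Z⟩ := exists_open_subset_of_finite_cover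
    (Finset.univ.filter fun δ : c.Γ => (δ : Equiv.Perm c.U) ≠ 1)
    (fun δ : c.Γ => {y | c.ext δ y = y}) hVo ⟨x, hxV⟩ (fun δ => by
      have hc : ContinuousOn (c.ext δ) V := fun y hy =>
        (contDiffAt_ext δ.2 (hVx hy).2).continuousAt.continuousWithinAt
      have h := (hc.prodMk continuousOn_id).isOpen_inter_preimage hVo
        (isClosed_diagonal (X := Euc m)).isOpen_compl
      convert h using 1
      ext y
      simp [mem_diagonal_iff])
    (fun y hy => by
      have h1 : ¬ (y ∈ c.U ∧ ∀ δ ∈ c.Γ, c.ext δ y = y → δ = 1) := (hVx hy).1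
      simp only [not_and, not_forall] at h1
      obtain ⟨δ, h2, h3, h4⟩ := h1 (hVx hy).2
      exact ⟨⟨δ, h2⟩, by simp [h4], h3⟩)
  have hyU := (hVx (hV' hy)).2
  have he : c.ext δ =ᶠ[𝓝 y] id := by
    filter_upwards [hV'o.mem_nhds hy] with w hw
    exact hV'Z hw
  refine (Finset.mem_filter.1 hδ).2 (eq_one_of_jet δ.2 hyU he.self_of_nhds ?_)
  rw [he.fderiv_eq, fderiv_id]

section CircleBundle

variable {n : ℕ} {M N : Type u} [TopologicalSpace M] [TopologicalSpace N] [MulAction Circle M]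
  {OM : OrientedOrbifold (n + 1) M} {ON : OrientedOrbifold n N} {f : M → N}

namespace BundleChart

variable (D : BundleChart OM ON f)

/-- A change of the trivialization that covers the identity on the base rotates the fibres by a
constant angle. -/
theorem eventually_eq_shift {β : Euc (n + 1) → Euc (n + 1)} {z : Euc (n + 1)}
    (hz : eucTail n z ∈ D.c.U)
    (hβ : ∀ᶠ w in 𝓝 z, ContDiffAt ℝ ∞ β w ∧ D.T.param (β w) = D.T.param w)
    (htail : ∀ᶠ w in 𝓝 z, eucTail n (β w) = eucTail n w) :
    Circle.exp ((β z) 0 - z 0) = 1 ∧ ∀ᶠ w in 𝓝 z, β w = w + ((β z) 0 - z 0) • eucFirst n := by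
  let v : Euc (n + 1) → ℝ := fun w => (β w) 0 - w 0
  have hv : ∀ w, ContDiffAt ℝ ∞ β w → ContinuousAt v w := fun w hw =>
    ((EuclideanSpace.proj 0 : Euc (n + 1) →L[ℝ] ℝ).continuous.continuousAt.comp hw.continuousAt).sub
      (EuclideanSpace.proj 0 : Euc (n + 1) →L[ℝ] ℝ).continuous.continuousAt
  have hc : ContinuousAt (eucTail n) z := (eucTail n).continuous.continuousAt
  -- over points with trivial isotropy, both points of the fibre agree; these points are dense
  have key : ∀ᶠ w in 𝓝 z, Circle.exp (v w) = 1 := by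
    filter_upwards [eventually_eventually_nhds.2 (hβ.and htail),
      hc.eventually (D.c.isOpen_U.mem_nhds hz)] with w hw hwU
    let j : Euc n → Euc (n + 1) := fun y => w 0 • eucFirst n + eucIncl n y
    have hj : Tendsto j (𝓝 (eucTail n w)) (𝓝 w) := by
      have h1 : ContinuousAt j (eucTail n w) := by
        simp only [j]
        fun_prop
      have h2 : j (eucTail n w) = w := eucFirst_add_eucIncl w
      have h3 := h1.tendsto
      rwa [h2] at h3
    have htj : ∀ y, eucTail n (j y) = y := fun y => by simp [j]
    have hf : ∃ᶠ y in 𝓝 (eucTail n w), Circle.exp (v (j y)) = 1 := by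
      refine ((D.c.frequently_trivial_isotropy hwU).and_eventually (hj.eventually hw)).mono ?_
      rintro y ⟨⟨hy, hiso⟩, h1, h2⟩
      have h3 := h1.2
      rw [OrbibundleTrivialization.param, OrbibundleTrivialization.param, h2, htj] at h3
      obtain ⟨δ, hδ, h4, h5⟩ := (D.T.eq_iff ⟨y, hy⟩ ⟨y, hy⟩ _ _).1 h3
      have h6 : δ = 1 := hiso δ hδ (by rw [ext_apply' hδ hy, h4])
      subst h6
      have h7 : D.T.a 1 y = 1 := by
        have := D.T.a_mul 1 hδ 1 hδ ⟨y, hy⟩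
        rw [mul_one] at this
        exact left_eq_mul.1 this
      rw [h7, one_mul] at h5
      rw [Circle.exp_sub, h5, div_self']
    exact tendsto_nhds_unique_of_frequently_eq
      ((Circle.exp.continuous.tendsto _).comp ((hv w hw.self_of_nhds.1.1).tendsto.comp hj))
      tendsto_const_nhds hf
  refine ⟨key.self_of_nhds, ?_⟩
  -- the continuous function `v` has values in `2πℤ`, so it is constant near `z`
  have hsmall : ∀ᶠ w in 𝓝 z, v w - v z ∈ Ioo (-Real.pi) Real.pi := by
    refine ((hv z hβ.self_of_nhds.1).sub continuousAt_const).eventually_mem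
      (isOpen_Ioo.mem_nhds ?_)
    change v z - v z ∈ _
    rw [sub_self]
    exact ⟨neg_lt_zero.2 Real.pi_pos, Real.pi_pos⟩
  filter_upwards [key, hsmall, htail] with w h1 h2 h3
  have h4 : Circle.exp (v w - v z) = 1 := by
    rw [Circle.exp_sub, h1, key.self_of_nhds, div_one]
  have h5 : v w - v z = 0 := by
    rw [← Circle.arg_exp h2.1 h2.2.le, h4]
    simp
  have h6 : (β w) 0 = w 0 + v z := by
    simp only [v] at h5 ⊢
    linarith
  conv_lhs => rw [← eucFirst_add_eucIncl (β w), h3, h6, add_smul]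
  conv_rhs => rw [← eucFirst_add_eucIncl w]
  simp only [v]
  abel

end BundleChart

theorem FrameProjects.exists_bundleChart (hf : IsCircleOrbibundle OM ON f) {B : OM.FrameBundle}
    {A : ON.FrameBundle} (h : FrameProjects f B A) : ∃ (D : BundleChart OM ON f) (a : D.FramesM)
      (a' : D.FramesN), D.frameM a = B ∧ D.frameN a' = A ∧ eucTail n (a.1.2 (eucFirst n)) = 0 ∧
        a'.1.1 = eucTail n a.1.1 ∧ a'.1.2 = ((eucTail n).comp a.1.2).comp (eucIncl n) := by
  obtain ⟨D, hD⟩ := hf.exists_bundleChart (f B.base)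
  obtain ⟨a, rfl⟩ := D.exists_frameM hD
  obtain ⟨h0, a', h1, h2⟩ := D.frameProjects_iff.1 h
  exact ⟨D, a, a', rfl, h2, h0, by rw [h1], by rw [h1]⟩

theorem FrameProjects.unique (hf : IsCircleOrbibundle OM ON f) {B : OM.FrameBundle}
    {A A' : ON.FrameBundle} (h : FrameProjects f B A) (h' : FrameProjects f B A') : A = A' := by
  obtain ⟨D, a, a', rfl, rfl, h0, h1, h2⟩ := h.exists_bundleChart hf
  obtain ⟨-, b, hb, rfl⟩ := D.frameProjects_iff.1 h'
  exact congrArg _ (Subtype.ext ((Prod.ext h1 h2).trans hb.symm))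

theorem FrameProjects.circ (hf : IsCircleOrbibundle OM ON f) {B : OM.FrameBundle}
    {A : ON.FrameBundle} (h : FrameProjects f B A) (t : Circle) :
    FrameProjects f (hf.circ t B) A := by
  obtain ⟨D, a, a', rfl, rfl, h0, h1, h2⟩ := h.exists_bundleChart hf
  obtain ⟨θ, rfl⟩ := Circle.exp_surjective t
  rw [hf.circ_frameM]
  refine D.frameProjects_iff.2 ⟨h0, a', Prod.ext (h1.trans ?_) h2, rfl⟩
  simp [BundleChart.shift]

theorem FrameProjects.rotate (hf : IsCircleOrbibundle OM ON f) {B : OM.FrameBundle}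
    {A : ON.FrameBundle} (h : FrameProjects f B A) {R : GLPlus (n + 1)} {R' : GLPlus n}
    (hR : ∀ v, eucTail n (R.1 v) = R'.1 (eucTail n v)) :
    FrameProjects f (B.rotate R) (A.rotate R') := by
  obtain ⟨D, a, a', rfl, rfl, h0, h1, h2⟩ := h.exists_bundleChart hf
  have hv : ∀ v, eucTail n (a.1.2 v) = a'.1.2 (eucTail n v) := fun v => by
    rw [h2]
    exact eucTail_comp_eq (L := (eucTail n).comp a.1.2) h0 v
  rw [D.param_M.toFrame_rotate, D.param_N.toFrame_rotate]
  refine D.frameProjects_iff.2 ⟨?_, a'.rotate R', Prod.ext h1 ?_, rfl⟩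
  · change eucTail n (a.1.2 (R.1 (eucFirst n))) = 0
    rw [hv, hR, eucTail_eucFirst, map_zero, map_zero]
  · ext1 v
    change a'.1.2 (R'.1 v) = eucTail n (a.1.2 (R.1 (eucIncl n v)))
    rw [hv, hR, eucTail_eucIncl]

theorem FrameProjects.shear (hf : IsCircleOrbibundle OM ON f) {B : OM.FrameBundle}
    {A : ON.FrameBundle} (h : FrameProjects f B A) {a : GLPlus (n + 1)}
    (ha : a ∈ verticalShears n) : FrameProjects f (B.rotate a) A := by
  have := h.rotate hf (R := a) (R' := 1) ha
  rwa [FrameBundle.rotate_one] at this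

/-- A rotation between adapted frames fixes the vertical direction. -/
theorem FrameProjects.rotation_eucFirst (hf : IsCircleOrbibundle OM ON f) {B : OM.FrameBundle}
    {A A' : ON.FrameBundle} (h : FrameProjects f B A) {R : GLPlus (n + 1)}
    (h' : FrameProjects f (B.rotate R) A') (hR : ∀ v, ‖R.1 v‖ = ‖v‖) :
    R.1 (eucFirst n) = eucFirst n := by
  obtain ⟨D, a, a', rfl, rfl, h0, h1, h2⟩ := h.exists_bundleChart hf
  have hs := (D.adapted_sign h0).1 (by rw [← h2]; exact a'.2.2)
  rw [D.param_M.toFrame_rotate] at h'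
  obtain ⟨k0, b', hb', -⟩ := D.frameProjects_iff.1 h'
  have ks := (D.adapted_sign k0).1 (by
    have := b'.2.2
    rwa [hb'] at this)
  have e1 := eq_smul_eucFirst h0
  have e2 := eq_smul_eucFirst k0
  change a.1.2 (R.1 (eucFirst n)) = _ at e2
  change 0 < D.εM * D.εN * (a.1.2 (R.1 (eucFirst n))) 0 at ks
  set r := (a.1.2 (eucFirst n)) 0
  set s := (a.1.2 (R.1 (eucFirst n))) 0 with hsd
  change a.1.2 (R.1 (eucFirst n)) = s • eucFirst n at e2
  have hr : r ≠ 0 := right_ne_zero_of_mul hs.ne'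
  -- both vertical vectors are positive multiples of the fibre direction
  have e3 : R.1 (eucFirst n) = (s / r) • eucFirst n := by
    refine (bijective_of_det_ne_zero (IsOrientedParam.frame_det_ne_zero a)).1 ?_
    rw [e2, map_smul, e1, smul_smul, div_mul_cancel₀ _ hr]
  have hpos : 0 < s / r := by
    have h3 := div_pos ks hs
    rwa [mul_div_mul_left _ _ (mul_ne_zero D.εM_ne_zero D.εN_ne_zero)] at h3
  have e4 := hR (eucFirst n)
  rw [e3, norm_smul, norm_eucFirst, mul_one, Real.norm_of_nonneg hpos.le] at e4
  rw [e3, e4, one_smul]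

/-- The circle and the vertical shears act transitively on the adapted frames over a frame. -/
theorem FrameProjects.exists_circ_shear (hf : IsCircleOrbibundle OM ON f) {B B' : OM.FrameBundle}
    {A : ON.FrameBundle} (h : FrameProjects f B A) (h' : FrameProjects f B' A) :
    ∃ t : Circle, ∃ a ∈ verticalShears n, B' = (hf.circ t B).rotate a := by
  obtain ⟨D, a, a', rfl, rfl, h0, h1, h2⟩ := h.exists_bundleChart hf
  have hbase : f B'.base ∈ D.c.φ '' D.c.U := by
    obtain ⟨b, r, rfl, hr, ψ, k1, k2, -⟩ := h'
    have e := congrArg FrameBundle.base hr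
    rw [D.param_N.base_toFrame, base_mk] at e
    refine ⟨a'.1.1, a'.2.1, ?_⟩
    rw [← e, ← k2]
    exact k1.map_eq
  obtain ⟨b, rfl⟩ := D.exists_frameM hbase
  obtain ⟨k0, b', k1, k2⟩ := D.frameProjects_iff.1 h'
  obtain ⟨β, b1, b2, b3⟩ := (D.param_N.toFrame_eq_iff D.param_N).1 k2.symm
  have hl : IsLocalLift id D.c.φ D.c β a'.1.1 := by
    have hm : ∀ᶠ w in 𝓝 a'.1.1, β w ∈ D.c.U := by
      refine b1.self_of_nhds.1.continuousAt.eventually_mem (D.c.isOpen_U.mem_nhds ?_)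
      rw [b2]
      exact b'.2.1
    filter_upwards [b1, hm] with w hw hw'
    exact ⟨hw.1, hw', hw.2⟩
  -- the representatives of the frame of the base differ by an element of the chart group, which
  -- is lifted to the total space to reduce to frames with the same projection
  obtain ⟨γ, hγ, hj⟩ := exists_jetEq (isLocalLift_id D.c a'.2.1) hl
  obtain ⟨d, d1, d2, d3⟩ := D.exists_deck hγ a
  have e1 : eucTail n d.1.1 = eucTail n b.1.1 := by
    have h3 := congrArg Prod.fst k1
    change b'.1.1 = eucTail n b.1.1 at h3
    rw [← h3, ← b2, d2, ← h1]
    exact hj.1.symm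
  have e2 : ((eucTail n).comp b.1.2).comp (eucIncl n)
      = ((eucTail n).comp d.1.2).comp (eucIncl n) := by
    have h3 := congrArg Prod.snd k1
    change b'.1.2 = ((eucTail n).comp b.1.2).comp (eucIncl n) at h3
    rw [← h3, b3, d3, hj.2, fderiv_id, h2, h1]
    rfl
  have e3 : eucTail n (d.1.2 (eucFirst n)) = 0 := by
    have h3 := congrArg (fun L : Euc (n + 1) →L[ℝ] Euc n => L (eucFirst n)) d3
    refine Eq.trans h3 ?_
    change (fderiv ℝ (D.c.ext γ) (eucTail n a.1.1)) (eucTail n (a.1.2 (eucFirst n))) = 0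
    rw [h0, map_zero]
  have e4 : (((eucTail n).comp b.1.2).comp (eucIncl n)).det ≠ 0 := by
    have h3 := congrArg Prod.snd k1
    change b'.1.2 = ((eucTail n).comp b.1.2).comp (eucIncl n) at h3
    rw [← h3]
    exact IsOrientedParam.frame_det_ne_zero b'
  refine ⟨Circle.exp (b.1.1 0 - d.1.1 0), ParamFrames.ratio d b,
    D.ratio_mem_verticalShears e3 k0 e2.symm e4, ?_⟩
  rw [← d1]
  exact D.frameM_eq_circ_rotate hf e1

/-- The circle and the vertical shears act freely on the adapted frames. -/
theorem FrameProjects.circ_shear_free (hf : IsCircleOrbibundle OM ON f) {B : OM.FrameBundle}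
    {A : ON.FrameBundle} (h : FrameProjects f B A) {t : Circle} {R : GLPlus (n + 1)}
    (hR : R ∈ verticalShears n) (he : (hf.circ t B).rotate R = B) : t = 1 ∧ R = 1 := by
  obtain ⟨D, a, a', rfl, rfl, h0, h1, h2⟩ := h.exists_bundleChart hf
  obtain ⟨θ, rfl⟩ := Circle.exp_surjective t
  rw [hf.circ_frameM, D.param_M.toFrame_rotate] at he
  obtain ⟨β, b1, b2, b3⟩ := (D.param_M.toFrame_eq_iff D.param_M).1 he.symm
  change β a.1.1 = a.1.1 + θ • eucFirst n at b2
  change a.1.2.comp R.1 = _ at b3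
  have hx : eucTail n a.1.1 ∈ D.c.U := a.2.1
  have hTc : ∀ w, ContinuousAt (eucTail n) w := fun w => (eucTail n).continuous.continuousAt
  have hTβ : eucTail n (β a.1.1) = eucTail n a.1.1 := by rw [b2]; simp
  have hβc := b1.self_of_nhds.1
  have hm : ∀ᶠ w in 𝓝 a.1.1, eucTail n (β w) ∈ D.c.U := by
    refine (ContinuousAt.comp (hTc _) hβc.continuousAt).eventually_mem
      (D.c.isOpen_U.mem_nhds ?_)
    rw [Function.comp_apply, hTβ]
    exact hx
  have l1 : IsLocalLift f D.T.param D.c (eucTail n) a.1.1 := by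
    filter_upwards [(hTc a.1.1).eventually (D.c.isOpen_U.mem_nhds hx)] with w hw
    exact ⟨(eucTail n).contDiff.contDiffAt, hw, (D.f_param hw).symm⟩
  have l2 : IsLocalLift f D.T.param D.c (eucTail n ∘ β) a.1.1 := by
    filter_upwards [b1, hm] with w hw hw'
    exact ⟨(eucTail n).contDiff.contDiffAt.comp w hw.1, hw',
      (D.f_param hw').symm.trans (congrArg f hw.2)⟩
  have hsurj : Function.Surjective (fderiv ℝ (eucTail n) a.1.1) := fun v =>
    ⟨eucIncl n v, by rw [ContinuousLinearMap.fderiv, eucTail_eucIncl]⟩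
  obtain ⟨γ, hγ, hj⟩ := exists_eventually_eq_ext l1 l2 hsurj
  have hj0 := hj.self_of_nhds
  -- the change of trivializations covers the identity of the base
  have hγ1 : γ = 1 := by
    refine eq_one_of_jet hγ hx (hj0.1.symm.trans hTβ) ?_
    have e1 := hj0.2
    rw [fderiv_comp _ (eucTail n).differentiableAt hβc.differentiableAt_smooth,
      ContinuousLinearMap.fderiv, ContinuousLinearMap.fderiv] at e1
    refine comp_cancel_right (C := a'.1.2) (IsOrientedParam.frame_det_ne_zero a') ?_
    rw [ContinuousLinearMap.id_comp]
    have e2 : (fderiv ℝ (D.c.ext γ) (eucTail n a.1.1)).comp ((eucTail n).comp a.1.2)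
        = (eucTail n).comp a.1.2 := by
      rw [← ContinuousLinearMap.comp_assoc, ← e1, ContinuousLinearMap.comp_assoc, ← b3]
      ext1 v
      change eucTail n (a.1.2 (R.1 v)) = eucTail n (a.1.2 v)
      have k1 := eucTail_comp_eq (L := (eucTail n).comp a.1.2) h0 v
      have k2 := eucTail_comp_eq (L := (eucTail n).comp a.1.2) h0 (R.1 v)
      rw [hR v, ← k1] at k2
      exact k2
    rw [h2]
    conv_rhs => rw [← e2]
    rfl
  have htail : ∀ᶠ w in 𝓝 a.1.1, eucTail n (β w) = eucTail n w := by
    filter_upwards [hj, (hTc a.1.1).eventually (D.c.isOpen_U.mem_nhds hx)] with w hw hw'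
    refine hw.1.trans ?_
    rw [hγ1]
    exact ext_one hw'
  obtain ⟨k1, k2⟩ := D.eventually_eq_shift hx b1 htail
  have hθ : (β a.1.1) 0 - a.1.1 0 = θ := by rw [b2]; simp
  rw [hθ] at k1 k2
  refine ⟨k1, Subtype.ext (comp_cancel_left (C := a.1.2) (IsOrientedParam.frame_det_ne_zero a) ?_)⟩
  have k3 : β =ᶠ[𝓝 a.1.1] fun w => w + θ • eucFirst n := k2
  rw [b3, k3.fderiv_eq, fderiv_add_const, GLPlus.coe_one, ContinuousLinearMap.comp_id]
  have k4 : fderiv ℝ (fun w : Euc (n + 1) => w) a.1.1 = ContinuousLinearMap.id ℝ _ := fderiv_id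
  rw [k4, ContinuousLinearMap.id_comp]

end CircleBundle

/-! ### Local trivializations of the bundle of adapted frames -/

section CircleBundle

variable {n : ℕ} {M N : Type u} [TopologicalSpace M] [TopologicalSpace N]
  {OM : OrientedOrbifold (n + 1) M} {ON : OrientedOrbifold n N} {f : M → N}

variable (OM ON f) in
/-- The bundle of adapted frames of the total space. -/
abbrev AdaptedFrames : Type u :=
  {B : OM.FrameBundle // ∃ A : ON.FrameBundle, FrameProjects f B A}

/-- The projection of adapted frames to frames of the base. -/
def AdaptedFrames.proj (B : AdaptedFrames OM ON f) : ON.FrameBundle := B.2.choose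

theorem AdaptedFrames.frameProjects (B : AdaptedFrames OM ON f) : FrameProjects f B.1 B.proj :=
  B.2.choose_spec

theorem FrameProjects.proj_eq [MulAction Circle M] (hf : IsCircleOrbibundle OM ON f)
    {B : AdaptedFrames OM ON f} {A : ON.FrameBundle} (h : FrameProjects f B.1 A) : B.proj = A :=
  B.frameProjects.unique hf h

variable [MulAction Circle M]

namespace BundleChart

variable (D : BundleChart OM ON f)

/-- The projection of adapted frames in a trivialization. -/
def down (a : D.FramesM) : Euc n × (Euc n →L[ℝ] Euc n) :=
  (eucTail n a.1.1, ((eucTail n).comp a.1.2).comp (eucIncl n))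

theorem continuous_down : Continuous D.down := by
  have h2 : Continuous fun a : D.FramesM => a.1.2 := continuous_snd.comp continuous_subtype_val
  exact ((eucTail n).continuous.comp (continuous_fst.comp continuous_subtype_val)).prodMk
    ((continuous_const.clm_comp h2).clm_comp continuous_const)

/-- Near an adapted frame, adapted frames and their projections are computed in a trivialization. -/
theorem eventually_adapted {a : D.FramesM} (B₁ : AdaptedFrames OM ON f) (h1 : D.frameM a = B₁.1) :
    ∃ s : AdaptedFrames OM ON f → D.FramesM, ContinuousAt s B₁ ∧ s B₁ = a ∧
      ∀ᶠ B in 𝓝 B₁, D.frameM (s B) = B.1 ∧ eucTail n ((s B).1.2 (eucFirst n)) = 0 ∧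
        ∀ A, FrameProjects f B.1 A → ∃ a' : D.FramesN, a'.1 = D.down (s B) ∧ D.frameN a' = A := by
  obtain ⟨e, he, hee⟩ := D.param_M.exists_local_inverse a
  have hB : e a = B₁.1 := (congrFun hee a).symm.trans h1
  have hmem : B₁.1 ∈ e.target := hB ▸ e.map_source he
  refine ⟨fun B => e.symm B.1, ContinuousAt.comp (g := e.symm)
    (e.continuousAt_symm hmem) continuous_subtype_val.continuousAt, ?_, ?_⟩
  · change e.symm B₁.1 = a
    rw [← hB, e.left_inv he]
  · filter_upwards [(continuous_subtype_val.continuousAt (x := B₁)).eventually_mem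
      (e.open_target.mem_nhds hmem)] with B hB
    have h2 : D.frameM (e.symm B.1) = B.1 := (congrFun hee _).trans (e.right_inv hB)
    obtain ⟨A, hA⟩ := B.2
    refine ⟨h2, ?_, fun A' hA' => ?_⟩
    · rw [← h2] at hA
      exact (D.frameProjects_iff.1 hA).1
    · rw [← h2] at hA'
      obtain ⟨-, a', k1, k2⟩ := D.frameProjects_iff.1 hA'
      exact ⟨a', k1, k2⟩

/-- The elements of the circle and of the group of vertical shears that carry the product frame to
an adapted frame. -/
theorem division_formula (hf : IsCircleOrbibundle OM ON f) {a : D.FramesM} {b : D.FramesN}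
    (h0 : eucTail n (a.1.2 (eucFirst n)) = 0) (hb1 : b.1.1 = eucTail n a.1.1)
    (hb2 : b.1.2 = ((eucTail n).comp a.1.2).comp (eucIncl n)) {t : Circle} {R : GLPlus (n + 1)}
    (hR : R ∈ verticalShears n)
    (h : D.frameM a = (hf.circ t (D.frameM (D.sect b))).rotate R) :
    t = Circle.exp (a.1.1 0 - (D.sect b).1.1 0) ∧ R = ParamFrames.ratio (D.sect b) a := by
  have ht0 : eucTail n ((D.sect b).1.2 (eucFirst n)) = 0 := by
    rw [D.tail_sect, eucTail_eucFirst, map_zero]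
  have ht1 : ((eucTail n).comp (D.sect b).1.2).comp (eucIncl n)
      = ((eucTail n).comp a.1.2).comp (eucIncl n) := by
    rw [← hb2]
    ext1 v
    change eucTail n ((D.sect b).1.2 (eucIncl n v)) = _
    rw [D.tail_sect, eucTail_eucIncl]
  have hr := D.ratio_mem_verticalShears ht0 h0 ht1
    (by rw [← hb2]; exact IsOrientedParam.frame_det_ne_zero b)
  have h5 := D.frameM_eq_circ_rotate hf (a := D.sect b) (b := a) ((eucTail_eucIncl _).trans hb1)
  have hP : FrameProjects f (D.frameM (D.sect b)) (D.frameN b) := D.frameProjects_sect b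
  generalize D.frameM (D.sect b) = P at *
  generalize Circle.exp (a.1.1 0 - (D.sect b).1.1 0) = t' at *
  generalize ParamFrames.ratio (D.sect b) a = R' at *
  have h7 : (hf.circ (t'⁻¹ * t) P).rotate (R * R'⁻¹) = P := by
    rw [FrameBundle.rotate_mul, hf.circ_mul, ← hf.circ_rotate, ← h, h5, hf.circ_rotate,
      ← hf.circ_mul, inv_mul_cancel, hf.circ_one, ← FrameBundle.rotate_mul, mul_inv_cancel,
      FrameBundle.rotate_one]
  obtain ⟨h8, h9⟩ := hP.circ_shear_free hf
    ((verticalShears n).mul_mem hR ((verticalShears n).inv_mem hr)) h7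
  exact ⟨(inv_mul_eq_one.1 h8).symm, mul_inv_eq_one.1 h9⟩

end BundleChart

theorem AdaptedFrames.continuous_proj (hf : IsCircleOrbibundle OM ON f) :
    Continuous (AdaptedFrames.proj : AdaptedFrames OM ON f → ON.FrameBundle) := by
  refine continuous_iff_continuousAt.2 fun B₁ => ?_
  obtain ⟨D, a, a', h1, h2, h0, h3, h4⟩ := B₁.frameProjects.exists_bundleChart hf
  obtain ⟨s, s1, s2, s3⟩ := D.eventually_adapted B₁ h1
  rw [ContinuousAt, ← h2]
  intro V hV
  have hV' : D.frameN ⁻¹' V ∈ 𝓝 a' := D.param_N.continuous_toFrame.continuousAt hV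
  obtain ⟨V', hV'1, hV'2⟩ := (mem_nhds_induced Subtype.val a' _).1 hV'
  have hd : ContinuousAt (fun B => D.down (s B)) B₁ :=
    ContinuousAt.comp (g := D.down) D.continuous_down.continuousAt s1
  have hd0 : D.down (s B₁) = a'.1 := by
    rw [s2]
    exact (Prod.ext h3 h4).symm
  rw [mem_map]
  filter_upwards [hd.eventually_mem (by rw [hd0]; exact hV'1), s3] with B k1 k2
  obtain ⟨b', m1, m2⟩ := k2.2.2 _ B.frameProjects
  rw [mem_preimage, ← m2]
  refine hV'2 ?_
  rw [mem_preimage, m1]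
  exact k1

theorem exists_frameProjects (hf : IsCircleOrbibundle OM ON f) (A : ON.FrameBundle) :
    ∃ B : OM.FrameBundle, FrameProjects f B A := by
  obtain ⟨D, x, hx, hxA⟩ := hf.exists_bundleChart A.base
  obtain ⟨a, -, rfl⟩ := D.param_N.exists_toFrame_eq D.εN_ne_zero hx hxA.symm
  exact ⟨_, D.frameProjects_sect a⟩

/-- The adapted frames form a locally trivial principal bundle over the frames of the base: there
are local sections `σ`, and an adapted frame is obtained from the section by elements `τ` of the
circle and `α` of the group of vertical shears that depend continuously on it. -/
theorem exists_adapted_trivialization (hf : IsCircleOrbibundle OM ON f) (A₀ : ON.FrameBundle) :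
    ∃ W : Set ON.FrameBundle, IsOpen W ∧ A₀ ∈ W ∧
      ∃ (σ : ON.FrameBundle → OM.FrameBundle) (τ : AdaptedFrames OM ON f → Circle)
        (α : AdaptedFrames OM ON f → verticalShears n),
        ContinuousOn σ W ∧ (∀ A ∈ W, FrameProjects f (σ A) A) ∧
        ContinuousOn τ (AdaptedFrames.proj ⁻¹' W) ∧ ContinuousOn α (AdaptedFrames.proj ⁻¹' W) ∧
        ∀ B : AdaptedFrames OM ON f, B.proj ∈ W →
          B.1 = (hf.circ (τ B) (σ B.proj)).rotate (α B).1 := by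
  obtain ⟨D, x, hx, hxA⟩ := hf.exists_bundleChart A₀.base
  obtain ⟨a₀, -, rfl⟩ := D.param_N.exists_toFrame_eq D.εN_ne_zero hx hxA.symm
  obtain ⟨e, he, hee⟩ := D.param_N.exists_local_inverse a₀
  have heN : ∀ a, D.frameN a = e a := congrFun hee
  let σ : ON.FrameBundle → OM.FrameBundle := fun A => D.frameM (D.sect (e.symm A))
  have hσ : ∀ A ∈ e.target, FrameProjects f (σ A) A := fun A hA => by
    have h := D.frameProjects_sect (e.symm A)
    rwa [heN, e.right_inv hA] at h
  have hex : ∀ B : AdaptedFrames OM ON f, ∃ (t : Circle) (a : verticalShears n),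
      B.proj ∈ e.target → B.1 = (hf.circ t (σ B.proj)).rotate a.1 := fun B => by
    by_cases hB : B.proj ∈ e.target
    · obtain ⟨t, a, ha, h⟩ := (hσ _ hB).exists_circ_shear hf B.frameProjects
      exact ⟨t, ⟨a, ha⟩, fun _ => h⟩
    · exact ⟨1, 1, fun h => absurd h hB⟩
  choose τ α hτα using hex
  have hpc := AdaptedFrames.continuous_proj hf
  -- in a trivialization, `τ` and `α` are given by explicit formulas
  have key : ∀ B₁ : AdaptedFrames OM ON f, B₁.proj ∈ e.target →
      ContinuousAt τ B₁ ∧ ContinuousAt α B₁ := by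
    intro B₁ hB₁
    obtain ⟨θ, hθ⟩ := Circle.exp_surjective (τ B₁)
    let a₁ : D.FramesM := (D.shift (D.sect (e.symm B₁.proj)) θ).rotate (α B₁).1
    have ha₁ : D.frameM a₁ = B₁.1 := by
      rw [hτα B₁ hB₁, ← hθ]
      simp only [σ]
      rw [hf.circ_frameM, D.param_M.toFrame_rotate]
    have hdown : D.down a₁ = (e.symm B₁.proj).1 := by
      refine Prod.ext ?_ ?_
      · change eucTail n (eucIncl n (e.symm B₁.proj).1.1 + θ • eucFirst n) = _
        simp
      · ext1 v
        change eucTail n ((D.sect (e.symm B₁.proj)).1.2 ((α B₁).1.1 (eucIncl n v))) = _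
        rw [D.tail_sect, (α B₁).2, eucTail_eucIncl]
    obtain ⟨s, s1, s2, s3⟩ := D.eventually_adapted B₁ ha₁
    have hsource : (Subtype.val : D.FramesN → _) '' e.source ∈ 𝓝 (D.down (s B₁)) := by
      rw [s2, hdown]
      exact ((isOpen_paramFrames D.param_N.isOpen D.εN).isOpenEmbedding_subtypeVal.isOpenMap _
        e.open_source).mem_nhds ⟨_, e.map_target hB₁, rfl⟩
    have hdc : ContinuousAt (fun B => D.down (s B)) B₁ :=
      ContinuousAt.comp (g := D.down) D.continuous_down.continuousAt s1
    have hsec : ContinuousAt (fun B : AdaptedFrames OM ON f => D.sect (e.symm B.proj)) B₁ :=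
      ContinuousAt.comp (g := D.sect) D.continuous_sect.continuousAt
        (ContinuousAt.comp (g := e.symm) (e.continuousAt_symm hB₁) hpc.continuousAt)
    have hform : ∀ᶠ B in 𝓝 B₁,
        τ B = Circle.exp ((s B).1.1 0 - (D.sect (e.symm B.proj)).1.1 0) ∧
          (α B).1 = ParamFrames.ratio (D.sect (e.symm B.proj)) (s B) := by
      filter_upwards [hdc.eventually_mem hsource, s3,
        hpc.continuousAt.eventually_mem (e.open_target.mem_nhds hB₁)] with B k1 k2 k3
      obtain ⟨b, hb, hbd⟩ := k1
      obtain ⟨b', hb'd, hb'⟩ := k2.2.2 _ B.frameProjects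
      have hbb : b' = b := Subtype.ext (hb'd.trans hbd.symm)
      subst hbb
      have he2 : e.symm B.proj = b' := by rw [← hb', heN, e.left_inv hb]
      have hb1 : b'.1.1 = eucTail n (s B).1.1 := congrArg Prod.fst hb'd
      have hb2 : b'.1.2 = ((eucTail n).comp (s B).1.2).comp (eucIncl n) := congrArg Prod.snd hb'd
      have h6 := hτα B k3
      simp only [σ] at h6
      rw [he2, ← k2.1] at h6
      rw [he2]
      exact D.division_formula hf k2.2.1 hb1 hb2 (α B).2 h6
    have hz : Continuous fun a : D.FramesM => a.1.1 0 :=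
      (EuclideanSpace.proj 0 : Euc (n + 1) →L[ℝ] ℝ).continuous.comp
        (continuous_fst.comp continuous_subtype_val)
    constructor
    · have hc : ContinuousAt (fun B => Circle.exp ((s B).1.1 0
          - (D.sect (e.symm B.proj)).1.1 0)) B₁ :=
        Circle.exp.continuous.continuousAt.comp ((ContinuousAt.comp (g := fun a : D.FramesM =>
          a.1.1 0) hz.continuousAt s1).sub (ContinuousAt.comp (g := fun a : D.FramesM =>
          a.1.1 0) hz.continuousAt hsec))
      exact hc.congr (hform.mono fun B hB => hB.1.symm)
    · refine Topology.IsInducing.subtypeVal.continuousAt_iff.2 ?_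
      have hc := ParamFrames.continuousAt_ratio hsec s1
      exact hc.congr (hform.mono fun B hB => hB.2.symm)
  refine ⟨e.target, e.open_target, ?_, σ, τ, α, ?_, hσ, ?_, ?_, hτα⟩
  · rw [hee]
    exact e.map_source he
  · exact (D.param_M.continuous_toFrame.comp D.continuous_sect).comp_continuousOn
      e.continuousOn_symm
  · exact fun B hB => (key B hB).1.continuousWithinAt
  · exact fun B hB => (key B hB).2.continuousWithinAt

theorem det_pos_of_zero_dim {A : Euc 0 →L[ℝ] Euc 0} : A.det = 1 := by
  have : A = ContinuousLinearMap.id ℝ _ := by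
    ext1 v
    exact Subsingleton.elim _ _
  rw [this, GLPlus.det_id]

/-- Near a frame of the total space, frames can be continuously rotated into adapted frames. -/
theorem exists_spin_adapted (hf : IsCircleOrbibundle OM ON f) (B₀ : OM.FrameBundle) :
    ∃ V : Set OM.FrameBundle, IsOpen V ∧ B₀ ∈ V ∧ ∃ s : OM.FrameBundle → SpinGrp (n + 1),
      ContinuousOn s V ∧
      ∀ B ∈ V, ∃ A : ON.FrameBundle, FrameProjects f (B.rotate (spinRot (s B))) A := by
  obtain ⟨D, hD⟩ := hf.exists_bundleChart (f B₀.base)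
  obtain ⟨a₀, rfl⟩ := D.exists_frameM hD
  obtain ⟨e, he, hee⟩ := D.param_M.exists_local_inverse a₀
  have heM : ∀ a, D.frameM a = e a := congrFun hee
  have htar : D.frameM a₀ ∈ e.target := heM a₀ ▸ e.map_source he
  have hinv : ∀ B ∈ e.target, D.frameM (e.symm B) = B := fun B hB => by
    rw [heM, e.right_inv hB]
  rcases Nat.eq_zero_or_pos n with rfl | hn
  · -- over a point, all positively oriented frames are adapted
    refine ⟨e.target, e.open_target, htar, fun _ => 1, continuousOn_const, fun B hB => ?_⟩
    rw [map_one, FrameBundle.rotate_one, ← hinv B hB]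
    have h0 : eucTail 0 ((e.symm B).1.2 (eucFirst 0)) = 0 := Subsingleton.elim _ _
    refine D.exists_frameProjects h0 ((D.adapted_sign h0).1 ?_)
    obtain ⟨x, hx, -⟩ := hD
    obtain ⟨d, hd, y, hy, hxy⟩ := ON.covers (D.c.φ x)
    obtain ⟨ψ, h1, -⟩ := D.param_N.exists_lift d hd x hx y hy hxy.symm
    have h2 := D.param_N.det_pos d hd x hx ψ h1
    rw [det_pos_of_zero_dim] at h2 ⊢
    exact h2
  · -- the direction of the vertical vector, in the coordinates given by the frame
    let u : Euc (n + 1) := (D.εM * D.εN) • eucFirst n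
    have hu : u ≠ 0 := smul_ne_zero (mul_ne_zero D.εM_ne_zero D.εN_ne_zero) (by
      intro h
      have := norm_eucFirst (n := n)
      rw [h, norm_zero] at this
      exact zero_ne_one this)
    let w : D.FramesM → Euc (n + 1) := fun a => Ring.inverse a.1.2 u
    have hCw : ∀ a : D.FramesM, a.1.2 (w a) = u := fun a =>
      congrArg (fun L : Euc (n + 1) →L[ℝ] Euc (n + 1) => L u)
        (GLPlus.comp_inverse (IsOrientedParam.frame_det_ne_zero a))
    have hw0 : ∀ a, w a ≠ 0 := fun a h => hu (by rw [← hCw a, h, map_zero])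
    have hwc : Continuous w := continuous_iff_continuousAt.2 fun a => by
      have h1 : ContinuousAt (fun a : D.FramesM => Ring.inverse a.1.2) a :=
        ContinuousAt.comp (g := Ring.inverse)
          (GLPlus.continuousAt_inverse (IsOrientedParam.frame_det_ne_zero a))
          (continuous_snd.comp continuous_subtype_val).continuousAt
      exact h1.clm_apply continuousAt_const
    let dir : D.FramesM → Euc (n + 1) := fun a => ‖w a‖⁻¹ • w a
    have hdir1 : ∀ a, ‖dir a‖ = 1 := fun a => norm_smul_inv_norm (𝕜 := ℝ) (hw0 a)
    have hdirc : Continuous dir :=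
      (hwc.norm.inv₀ fun a => norm_ne_zero_iff.2 (hw0 a)).smul hwc
    -- a rotation brings the direction at `a₀` to the first basis vector, so that nearby ones stay
    -- away from its antipode, where `spinTo` is discontinuous
    obtain ⟨s₀, hs₀⟩ := exists_spinRot_eq hn.ne' (hdir1 a₀)
    let v : D.FramesM → Euc (n + 1) := fun a => (spinRot s₀⁻¹).1 (dir a)
    have hvc : Continuous v := (spinRot s₀⁻¹).1.continuous.comp hdirc
    have hv0 : v a₀ = eucFirst n := by
      simp only [v]
      rw [← hs₀, map_inv, GLPlus.inv_apply_apply]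
    have hv1 : ∀ a, ‖v a‖ = 1 := fun a => (norm_spinRot _ _).trans (hdir1 a)
    let O : Set D.FramesM := {a | v a + eucFirst n ≠ 0}
    have hO : IsOpen O := isOpen_ne_fun (hvc.add continuous_const) continuous_const
    have ha₀ : a₀ ∈ O := by
      change v a₀ + eucFirst n ≠ 0
      rw [hv0]
      exact eucFirst_add_self_ne_zero n
    refine ⟨e.target ∩ e.symm ⁻¹' O, e.isOpen_inter_preimage_symm hO, ⟨htar, ?_⟩,
      fun B => s₀ * spinTo (v (e.symm B)), ?_, ?_⟩
    · rw [mem_preimage, heM, e.left_inv he]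
      exact ha₀
    · intro B hB
      have h1 : ContinuousAt (fun B => v (e.symm B)) B :=
        ContinuousAt.comp (g := v) hvc.continuousAt (e.continuousAt_symm hB.1)
      exact (continuousAt_const.mul (ContinuousAt.comp (f := fun B => v (e.symm B)) (g := spinTo)
        (continuousAt_spinTo hB.2) h1)).continuousWithinAt
    · rintro B ⟨hB, hBO⟩
      set a := e.symm B with ha
      have hrot : (spinRot (s₀ * spinTo (v a))).1 (eucFirst n) = dir a := by
        rw [map_mul, GLPlus.mul_apply, spinRot_spinTo (hv1 a) hBO]
        simp only [v]
        rw [map_inv, GLPlus.apply_inv_apply]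
      have hC : (a.rotate (spinRot (s₀ * spinTo (v a)))).1.2 (eucFirst n)
          = (‖w a‖⁻¹ * (D.εM * D.εN)) • eucFirst n := by
        change a.1.2 ((spinRot (s₀ * spinTo (v a))).1 (eucFirst n)) = _
        rw [hrot]
        simp only [dir]
        rw [map_smul, hCw, smul_smul]
      have h2 : B.rotate (spinRot (s₀ * spinTo (v a)))
          = D.frameM (a.rotate (spinRot (s₀ * spinTo (v a)))) :=
        (congrArg (fun B : OM.FrameBundle => B.rotate _) (hinv B hB).symm).trans
          (D.param_M.toFrame_rotate _ _)
      rw [h2]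
      refine D.exists_frameProjects ?_ ?_
      · rw [hC, map_smul, eucTail_eucFirst, smul_zero]
      · rw [hC]
        have h3 : 0 < ‖w a‖⁻¹ := inv_pos.2 (norm_pos_iff.2 (hw0 a))
        have h4 : D.εM * D.εN ≠ 0 := mul_ne_zero D.εM_ne_zero D.εN_ne_zero
        have h5 : D.εM * D.εN * ((‖w a‖⁻¹ * (D.εM * D.εN)) • eucFirst n) 0
            = ‖w a‖⁻¹ * (D.εM * D.εN) ^ 2 := by
          simp
          ring
        rw [h5]
        positivity

end CircleBundle

/-! ### Square roots of inner products -/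

section Root

variable {n : ℕ}

/-- `S` is the positive self-adjoint operator with `⟪S v, S w⟫ = B v w`, i.e. the positive square
root of the Gram operator of the inner product `B`. -/
structure IsRoot (B : Euc n →L[ℝ] Euc n →L[ℝ] ℝ) (S : Euc n →L[ℝ] Euc n) : Prop where
  symm : ∀ v w, inner ℝ (S v) w = inner ℝ v (S w)
  pos : ∀ v, v ≠ 0 → 0 < inner ℝ (S v) v
  root : ∀ v w, inner ℝ (S v) (S w) = B v w

theorem exists_isRoot {B : Euc n →L[ℝ] Euc n →L[ℝ] ℝ} (hs : ∀ v w, B v w = B w v)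
    (hp : ∀ v, v ≠ 0 → 0 < B v v) : ∃ S, IsRoot B S := by
  let e := EuclideanSpace.basisFun (Fin n) ℝ
  let T : Euc n →ₗ[ℝ] Euc n := ∑ i, ((B.flip (e i) : Euc n →L[ℝ] ℝ) : Euc n →ₗ[ℝ] ℝ).smulRight (e i)
  have hT : ∀ v w, inner ℝ (T v) w = B v w := fun v w => by
    have h1 : T v = ∑ i, B v (e i) • e i := by simp [T, LinearMap.sum_apply]
    rw [h1, sum_inner]
    conv_rhs => rw [← e.sum_repr' w, map_sum]
    refine Finset.sum_congr rfl fun i _ => ?_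
    rw [real_inner_smul_left, map_smul, smul_eq_mul, mul_comm]
  have hTs : T.IsSymmetric := fun v w => by rw [hT, hs, ← hT, real_inner_comm]
  let b := hTs.eigenvectorBasis (finrank_euclideanSpace_fin (𝕜 := ℝ) (n := n))
  let l := hTs.eigenvalues (finrank_euclideanSpace_fin (𝕜 := ℝ) (n := n))
  have hb : ∀ i, T (b i) = l i • b i := fun i => hTs.apply_eigenvectorBasis _ i
  have hl : ∀ i, 0 < l i := fun i => by
    have h1 := hp (b i) (b.orthonormal.ne_zero i)
    rw [← hT, hb, real_inner_smul_left, real_inner_self_eq_norm_sq, b.norm_eq_one] at h1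
    simpa using h1
  let S : Euc n →L[ℝ] Euc n := ∑ i, (Real.sqrt (l i) • innerSL ℝ (b i)).smulRight (b i)
  have hS : ∀ v, S v = ∑ i, (Real.sqrt (l i) * inner ℝ (b i) v) • b i := fun v => by
    simp [S]
  have hSi : ∀ v w, inner ℝ (S v) w = ∑ i, Real.sqrt (l i) * inner ℝ (b i) v * inner ℝ (b i) w :=
    fun v w => by
      rw [hS, sum_inner]
      exact Finset.sum_congr rfl fun i _ => real_inner_smul_left _ _ _
  have hsym : ∀ v w, inner ℝ (S v) w = inner ℝ v (S w) := fun v w => by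
    rw [hSi, real_inner_comm, hSi]
    exact Finset.sum_congr rfl fun i _ => by ring
  have hSb : ∀ i, S (b i) = Real.sqrt (l i) • b i := fun i => by
    rw [hS, Finset.sum_eq_single i]
    · rw [real_inner_self_eq_norm_sq, b.norm_eq_one]
      simp
    · intro j _ hj
      rw [b.orthonormal.2 hj, mul_zero, zero_smul]
    · simp
  refine ⟨S, hsym, fun v hv => ?_, fun v w => ?_⟩
  · rw [hSi]
    have h0 : ∀ i, 0 ≤ Real.sqrt (l i) * inner ℝ (b i) v * inner ℝ (b i) v := fun i => by
      rw [mul_assoc]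
      exact mul_nonneg (Real.sqrt_nonneg _) (mul_self_nonneg _)
    refine (Finset.sum_nonneg fun i _ => h0 i).lt_of_ne fun h => hv ?_
    have h2 := (Finset.sum_eq_zero_iff_of_nonneg fun i _ => h0 i).1 h.symm
    rw [← b.sum_repr' v]
    refine Finset.sum_eq_zero fun i hi => ?_
    have h3 := h2 i hi
    rw [mul_assoc] at h3
    have h4 : inner ℝ (b i) v = 0 :=
      mul_self_eq_zero.1 ((mul_eq_zero.1 h3).resolve_left (Real.sqrt_pos.2 (hl i)).ne')
    rw [h4, zero_smul]
  · rw [hSi, ← hT, ← b.sum_inner_mul_inner]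
    refine Finset.sum_congr rfl fun i _ => ?_
    rw [← hsym, hSb, hTs, hb, real_inner_smul_left, real_inner_smul_right, real_inner_comm (b i) v,
      ← Real.mul_self_sqrt (hl i).le]
    rw [Real.sqrt_mul_self (Real.sqrt_nonneg _)]
    ring

theorem IsRoot.exists_lower_bound {B : Euc n →L[ℝ] Euc n →L[ℝ] ℝ} {S : Euc n →L[ℝ] Euc n}
    (h : IsRoot B S) : ∃ a : ℝ, 0 < a ∧ ∀ v, ‖v‖ = 1 → a ≤ inner ℝ (S v) v := by
  obtain ⟨a, ha, h1⟩ := (isCompact_sphere (0 : Euc n) 1).exists_forall_le'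
    (f := fun v => inner ℝ (S v) v) (by fun_prop) (a := 0) fun v hv => h.pos v fun h0 => by
      rw [h0] at hv
      simp at hv
  exact ⟨a, ha, fun v hv => h1 v (by simpa using hv)⟩

/-- Square roots depend continuously on the inner product. -/
theorem IsRoot.norm_sub_le {B B' : Euc n →L[ℝ] Euc n →L[ℝ] ℝ} {S S' : Euc n →L[ℝ] Euc n}
    (h : IsRoot B S) (h' : IsRoot B' S') {a : ℝ} (ha : 0 < a)
    (hS : ∀ v, ‖v‖ = 1 → a ≤ inner ℝ (S v) v) : ‖S - S'‖ ≤ ‖B - B'‖ / a := by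
  have hD : ((S - S' : Euc n →L[ℝ] Euc n) : Euc n →ₗ[ℝ] Euc n).IsSymmetric := fun v w => by
    change inner ℝ (S v - S' v) w = inner ℝ v (S w - S' w)
    rw [inner_sub_left, inner_sub_right, h.symm, h'.symm]
  let b := hD.eigenvectorBasis (finrank_euclideanSpace_fin (𝕜 := ℝ) (n := n))
  let l := hD.eigenvalues (finrank_euclideanSpace_fin (𝕜 := ℝ) (n := n))
  have hb : ∀ i, (S - S') (b i) = l i • b i := fun i => hD.apply_eigenvectorBasis _ i
  -- on a unit eigenvector `v` of `S - S'`, the difference `B - B'` is `λ ⟪v, S v + S' v⟫`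
  have hl : ∀ i, |l i| ≤ ‖B - B'‖ / a := fun i => by
    have h1 : (B - B') (b i) (b i)
        = l i * (inner ℝ (S (b i)) (b i) + inner ℝ (S' (b i)) (b i)) := by
      change B (b i) (b i) - B' (b i) (b i) = _
      have h2 : S (b i) - S' (b i) = l i • b i := hb i
      have h3 : inner ℝ (S (b i) - S' (b i)) (S (b i) + S' (b i))
          = B (b i) (b i) - B' (b i) (b i) := by
        rw [inner_sub_left, inner_add_right, inner_add_right, h.root, h'.root,
          real_inner_comm (S (b i)) (S' (b i))]
        ring
      rw [← h3, h2, real_inner_smul_left, inner_add_right, real_inner_comm (S (b i)),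
        real_inner_comm (S' (b i))]
    have h4 : a ≤ inner ℝ (S (b i)) (b i) + inner ℝ (S' (b i)) (b i) := by
      have := (h'.pos (b i) (b.orthonormal.ne_zero i)).le
      linarith [hS (b i) (b.norm_eq_one i)]
    have h5 : |(B - B') (b i) (b i)| ≤ ‖B - B'‖ := by
      have h6 := (B - B').le_opNorm₂ (b i) (b i)
      rwa [b.norm_eq_one, mul_one, mul_one] at h6
    rw [h1, abs_mul, abs_of_pos (ha.trans_le h4)] at h5
    rw [le_div_iff₀ ha]
    exact (mul_le_mul_of_nonneg_left h4 (abs_nonneg _)).trans h5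
  have hC : 0 ≤ ‖B - B'‖ / a := by positivity
  refine ContinuousLinearMap.opNorm_le_bound _ hC fun v => ?_
  refine le_of_sq_le_sq ?_ (by positivity)
  rw [mul_pow, ← b.sum_sq_norm_inner_right v, ← b.sum_sq_norm_inner_right ((S - S') v),
    Finset.mul_sum]
  refine Finset.sum_le_sum fun i _ => ?_
  have h1 : inner ℝ (b i) ((S - S') v) = l i * inner ℝ (b i) v := by
    have h2 := hD (b i) v
    change inner ℝ ((S - S') (b i)) v = inner ℝ (b i) ((S - S') v) at h2
    rw [← h2, hb, real_inner_smul_left]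
  rw [h1, norm_mul, mul_pow, Real.norm_eq_abs]
  gcongr
  exact hl i

theorem IsRoot.unique {B : Euc n →L[ℝ] Euc n →L[ℝ] ℝ} {S S' : Euc n →L[ℝ] Euc n}
    (h : IsRoot B S) (h' : IsRoot B S') : S = S' := by
  obtain ⟨a, ha, hS⟩ := h.exists_lower_bound
  have h1 := h.norm_sub_le h' ha hS
  have h2 : ‖B - B‖ = 0 :=
    (norm_eq_zero (E := Euc n →L[ℝ] Euc n →L[ℝ] ℝ)).2 (sub_self (G := Euc n →L[ℝ] Euc n →L[ℝ] ℝ) B)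
  rw [h2, zero_div] at h1
  exact sub_eq_zero.1 (norm_le_zero_iff.1 h1)

theorem IsRoot.tendsto {T : Type*} {l : Filter T} {B : T → Euc n →L[ℝ] Euc n →L[ℝ] ℝ}
    {S : T → Euc n →L[ℝ] Euc n} {B₀ : Euc n →L[ℝ] Euc n →L[ℝ] ℝ} {S₀ : Euc n →L[ℝ] Euc n}
    (h : ∀ x, IsRoot (B x) (S x)) (h₀ : IsRoot B₀ S₀) (hB : Tendsto B l (𝓝 B₀)) :
    Tendsto S l (𝓝 S₀) := by
  obtain ⟨a, ha, hS⟩ := h₀.exists_lower_bound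
  rw [tendsto_iff_norm_sub_tendsto_zero]
  have h1 : Tendsto (fun x => ‖B₀ - B x‖ / a) l (𝓝 0) := by
    have h2 := ((tendsto_iff_norm_sub_tendsto_zero
      (E := Euc n →L[ℝ] Euc n →L[ℝ] ℝ)).1 hB).div_const a
    rw [zero_div] at h2
    exact h2.congr fun x => by
      rw [norm_sub_rev (E := Euc n →L[ℝ] Euc n →L[ℝ] ℝ) (B x) B₀]
  refine squeeze_zero (fun x => norm_nonneg _) (fun x => ?_) h1
  rw [norm_sub_rev]
  exact h₀.norm_sub_le (h x) ha hS

theorem IsRoot.det_pos {B : Euc n →L[ℝ] Euc n →L[ℝ] ℝ} {S : Euc n →L[ℝ] Euc n}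
    (h : IsRoot B S) : 0 < S.det := by
  -- the segment from the identity to `S` consists of positive operators
  let p : ℝ → Euc n →L[ℝ] Euc n := fun t => (1 - t) • ContinuousLinearMap.id ℝ _ + t • S
  have hp : Continuous fun t => (p t).det := GLPlus.continuous_det.comp (by fun_prop)
  have hne : ∀ t ∈ Icc (0 : ℝ) 1, (p t).det ≠ 0 := fun t ht => by
    have hinj : LinearMap.ker ((p t : Euc n →L[ℝ] Euc n) : Euc n →ₗ[ℝ] Euc n) = ⊥ := by
      refine LinearMap.ker_eq_bot'.2 fun v hv => ?_
      by_contra hv0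
      have h1 : inner ℝ (p t v) v = (1 - t) * ‖v‖ ^ 2 + t * inner ℝ (S v) v := by
        change inner ℝ ((1 - t) • v + t • S v) v = _
        rw [inner_add_left, real_inner_smul_left, real_inner_smul_left, real_inner_self_eq_norm_sq]
      have h2 : inner ℝ (p t v) v = 0 := by
        have h3 : p t v = 0 := hv
        rw [h3, inner_zero_left]
      have h4 := h.pos v hv0
      have h5 : 0 < ‖v‖ := norm_pos_iff.2 hv0
      rcases eq_or_lt_of_le ht.1 with rfl | h6
      · rw [h2] at h1
        nlinarith
      · nlinarith [mul_pos h6 h4, mul_nonneg (sub_nonneg.2 ht.2) (sq_nonneg ‖v‖)]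
    exact (LinearEquiv.isUnit_det' (LinearEquiv.ofInjectiveEndo _
      (LinearMap.ker_eq_bot.1 hinj))).ne_zero
  have h0 : (p 0).det = 1 := by
    have : p 0 = ContinuousLinearMap.id ℝ _ := by
      ext1 v
      change (1 - (0 : ℝ)) • v + (0 : ℝ) • S v = v
      simp
    rw [this, GLPlus.det_id]
  have h1 : p 1 = S := by
    ext1 v
    change (1 - (1 : ℝ)) • v + (1 : ℝ) • S v = S v
    simp
  by_contra hneg
  rw [← h1] at hneg
  obtain ⟨t, ht, ht0⟩ := intermediate_value_Icc' zero_le_one hp.continuousOn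
    ⟨not_lt.1 hneg, by rw [h0]; exact zero_le_one⟩
  exact hne t ht ht0

end Root

namespace OrientedOrbifold

variable {n : ℕ} {X : Type u} [TopologicalSpace X] {O : OrientedOrbifold n X}

/-! ### The polar retraction of frames onto orthonormal frames -/

namespace Metric

variable (g : O.Metric)

/-- The inner product of the coordinates with respect to a frame in a chart. -/
def gramRep (b : O.FrameRep) : Euc n →L[ℝ] Euc n →L[ℝ] ℝ :=
  (g.g b.chart b.pt).bilinearComp b.frame b.frame

theorem gramRep_apply (b : O.FrameRep) (v w : Euc n) :
    g.gramRep b v w = g.g b.chart b.pt (b.frame v) (b.frame w) := rfl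

theorem gramRep_eq_of_rel {a b : O.FrameRep} (h : a.Rel b) : g.gramRep a = g.gramRep b := by
  obtain ⟨ψ, h1, h2, h3⟩ := h
  have hd : (fderiv ℝ ψ a.pt).det ≠ 0 := by
    have := b.frame_det_pos
    rw [h3, GLPlus.det_comp] at this
    exact left_ne_zero_of_mul this.ne'
  ext1 v
  ext1 w
  rw [gramRep_apply, gramRep_apply, h3, ← h2]
  exact (g.invariant a.chart a.chart_mem b.chart b.chart_mem a.pt a.pt_mem ψ h1
    (bijective_of_det_ne_zero hd) _ _).symm

/-- The inner product of the coordinates with respect to a frame. -/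
def gram (B : O.FrameBundle) : Euc n →L[ℝ] Euc n →L[ℝ] ℝ :=
  Quot.lift g.gramRep (fun _ _ => g.gramRep_eq_of_rel) B

theorem continuous_gram : Continuous g.gram := by
  refine Continuous.quotient_lift (s := ⟨_, FrameRep.Rel.refl, FrameRep.Rel.symm,
    FrameRep.Rel.trans⟩) ?_ _
  refine continuous_sigma_iff.2 fun c => ?_
  have h1 : Continuous fun a : {a : Euc n × (Euc n →L[ℝ] Euc n) // a.1 ∈ c.1.U ∧ 0 < a.2.det} =>
      g.g c.1 a.1.1 :=
    (g.continuousOn c.1 c.2).comp_continuous (continuous_fst.comp continuous_subtype_val)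
      fun a => a.2.1
  have h2 : Continuous fun a : {a : Euc n × (Euc n →L[ℝ] Euc n) // a.1 ∈ c.1.U ∧ 0 < a.2.det} =>
      a.1.2 := continuous_snd.comp continuous_subtype_val
  have h3 := ((ContinuousLinearMap.flipₗᵢ ℝ (Euc n) (Euc n) ℝ).continuous.comp
    (h1.clm_comp h2)).clm_comp h2
  exact (ContinuousLinearMap.flipₗᵢ ℝ (Euc n) (Euc n) ℝ).continuous.comp h3

theorem gram_rotate (B : O.FrameBundle) (R : GLPlus n) (v w : Euc n) :
    g.gram (B.rotate R) v w = g.gram B (R.1 v) (R.1 w) := by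
  obtain ⟨b, rfl⟩ := FrameRep.exists_mk B
  rfl

theorem mem_orthonormalFrames_iff {B : O.FrameBundle} :
    B ∈ g.orthonormalFrames ↔ ∀ v w, g.gram B v w = inner ℝ v w := by
  constructor
  · rintro ⟨a, rfl, h⟩
    exact h
  · intro h
    obtain ⟨b, rfl⟩ := FrameRep.exists_mk B
    exact ⟨b, rfl, h⟩

theorem rotate_mem_orthonormalFrames {B : O.FrameBundle} (hB : B ∈ g.orthonormalFrames)
    (s : SpinGrp n) : B.rotate (spinRot s) ∈ g.orthonormalFrames := by
  rw [mem_orthonormalFrames_iff] at hB ⊢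
  intro v w
  rw [gram_rotate, hB, inner_spinRot]

theorem exists_isRoot_gram (B : O.FrameBundle) : ∃ S, IsRoot (g.gram B) S := by
  obtain ⟨b, rfl⟩ := FrameRep.exists_mk B
  refine exists_isRoot (fun v w => g.symm _ b.chart_mem _ b.pt_mem _ _) fun v hv =>
    g.pos _ b.chart_mem _ b.pt_mem _ fun h => hv ?_
  exact (bijective_of_det_ne_zero b.frame_det_pos.ne').1 (h.trans (map_zero _).symm)

/-- The positive square root of the Gram operator of a frame. -/
def root (B : O.FrameBundle) : GLPlus n :=
  ⟨(g.exists_isRoot_gram B).choose, (g.exists_isRoot_gram B).choose_spec.det_pos⟩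

theorem isRoot_root (B : O.FrameBundle) : IsRoot (g.gram B) (g.root B).1 :=
  (g.exists_isRoot_gram B).choose_spec

theorem continuous_root : Continuous g.root :=
  Continuous.subtype_mk (continuous_iff_continuousAt.2 fun B =>
    IsRoot.tendsto g.isRoot_root (g.isRoot_root B) g.continuous_gram.continuousAt) _

theorem root_eq_one {B : O.FrameBundle} (hB : B ∈ g.orthonormalFrames) : g.root B = 1 := by
  rw [mem_orthonormalFrames_iff] at hB
  refine Subtype.ext ((g.isRoot_root B).unique ⟨fun v w => rfl, fun v hv => ?_, fun v w => ?_⟩)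
  · change 0 < inner ℝ v v
    exact real_inner_self_pos.2 hv
  · exact (hB v w).symm

theorem root_rotate (B : O.FrameBundle) (s : SpinGrp n) :
    g.root (B.rotate (spinRot s)) = (spinRot s)⁻¹ * g.root B * spinRot s := by
  have h := g.isRoot_root B
  have hinner : ∀ v w : Euc n, inner ℝ (((spinRot s)⁻¹).1 v) w = inner ℝ v ((spinRot s).1 w) :=
    fun v w => by rw [← inner_spinRot s, GLPlus.apply_inv_apply]
  have hinner' : ∀ v w : Euc n, inner ℝ v (((spinRot s)⁻¹).1 w) = inner ℝ ((spinRot s).1 v) w :=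
    fun v w => by rw [real_inner_comm, hinner, real_inner_comm]
  refine Subtype.ext ((g.isRoot_root _).unique ⟨fun v w => ?_, fun v hv => ?_, fun v w => ?_⟩)
  · change inner ℝ (((spinRot s)⁻¹).1 ((g.root B).1 ((spinRot s).1 v))) w
      = inner ℝ v (((spinRot s)⁻¹).1 ((g.root B).1 ((spinRot s).1 w)))
    rw [hinner, hinner', h.symm]
  · change 0 < inner ℝ (((spinRot s)⁻¹).1 ((g.root B).1 ((spinRot s).1 v))) v
    rw [hinner]
    refine h.pos _ fun h0 => hv ?_
    rw [← GLPlus.inv_apply_apply (spinRot s) v, h0, map_zero]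
  · change inner ℝ (((spinRot s)⁻¹).1 ((g.root B).1 ((spinRot s).1 v)))
      (((spinRot s)⁻¹).1 ((g.root B).1 ((spinRot s).1 w))) = _
    rw [hinner, GLPlus.apply_inv_apply, h.root, gram_rotate]

/-- The retraction of the frame bundle onto the orthonormal frames by polar decomposition. -/
def polar (B : O.FrameBundle) : g.orthonormalFrames :=
  ⟨B.rotate (g.root B)⁻¹, by
    rw [mem_orthonormalFrames_iff]
    intro v w
    rw [gram_rotate, ← (g.isRoot_root B).root, GLPlus.apply_inv_apply, GLPlus.apply_inv_apply]⟩

theorem continuous_polar : Continuous g.polar :=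
  Continuous.subtype_mk (FrameBundle.continuous_rotate.comp
    (continuous_id.prodMk (continuous_inv.comp g.continuous_root))) _

theorem polar_of_mem (B : g.orthonormalFrames) : g.polar B.1 = B := by
  refine Subtype.ext ?_
  change B.1.rotate (g.root B.1)⁻¹ = B.1
  rw [g.root_eq_one B.2, inv_one, FrameBundle.rotate_one]

theorem polar_rotate (B : O.FrameBundle) (s : SpinGrp n) :
    (g.polar (B.rotate (spinRot s))).1 = (g.polar B).1.rotate (spinRot s) := by
  change (B.rotate (spinRot s)).rotate (g.root (B.rotate (spinRot s)))⁻¹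
    = (B.rotate (g.root B)⁻¹).rotate (spinRot s)
  rw [root_rotate, ← FrameBundle.rotate_mul, ← FrameBundle.rotate_mul]
  congr 1
  group

end Metric

/-! ### Restriction and extension of spin structures -/

namespace SpinCover

theorem proj_act {S : Set O.FrameBundle} (Q : O.SpinCover S) (p : Q.P) (s : SpinGrp n) :
    (Q.proj (Q.act p s)).1 = (Q.proj p).1.rotate (spinRot s) :=
  Q.equivariant p s _ (isSpinImage_spinRot s)

theorem eq_one_of_act {S : Set O.FrameBundle} (Q : O.SpinCover S) {p : Q.P} {s : SpinGrp n}
    (hs : spinRot s = 1) (h : Q.act p s = p) : s = 1 :=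
  Q.free p s (isSpinImage_iff.2 hs.symm) h

theorem isCoveringMap_frame (Q : O.TopSpinStructure) :
    IsCoveringMap fun p : Q.P => (Q.proj p).1 :=
  Q.isCoveringMap.homeomorph_comp (Homeomorph.Set.univ O.FrameBundle)

theorem ncard_fiber_frame (Q : O.TopSpinStructure) (B : O.FrameBundle) :
    ((fun p : Q.P => (Q.proj p).1) ⁻¹' {B}).ncard = 2 :=
  (ncard_fiber_univ _ ⟨B, mem_univ _⟩).symm.trans (Q.two_sheeted _)

variable (g : O.Metric)

/-- The spin structure to which a topological spin structure restricts. -/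
def restrict (Q : O.TopSpinStructure) : O.SpinStructure g where
  P := {p : Q.P // (Q.proj p).1 ∈ g.orthonormalFrames}
  proj p := ⟨(Q.proj p.1).1, p.2⟩
  isCoveringMap := (Q.isCoveringMap.homeomorph_comp
    (Homeomorph.Set.univ O.FrameBundle)).restrictPreimage g.orthonormalFrames
  two_sheeted F := by
    rw [← Q.two_sheeted ⟨F.1, mem_univ _⟩]
    rw [← Set.ncard_image_of_injective _ Subtype.val_injective]
    congr 1
    ext p
    constructor
    · rintro ⟨q, hq, rfl⟩
      have hq' : (⟨(Q.proj q.1).1, q.2⟩ : g.orthonormalFrames) = F := hq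
      have h1 : (Q.proj q.1).1 = F.1 := congrArg Subtype.val hq'
      exact Subtype.ext h1
    · intro hp
      have h1 : (Q.proj p).1 = F.1 := congrArg Subtype.val hp
      exact ⟨⟨p, by rw [h1]; exact F.2⟩, Subtype.ext h1, rfl⟩
  act p s := ⟨Q.act p.1 s, by
    rw [Q.proj_act]
    exact g.rotate_mem_orthonormalFrames p.2 s⟩
  continuous_act := Continuous.subtype_mk (Q.continuous_act.comp
    ((continuous_subtype_val.comp continuous_fst).prodMk continuous_snd)) _
  act_one p := Subtype.ext (Q.act_one p.1)
  act_mul p s t := Subtype.ext (Q.act_mul p.1 s t)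
  equivariant p s R h := Q.equivariant p.1 s R h
  free p s h he := Q.free p.1 s h (congrArg Subtype.val he)

theorem extends_restrict (Q : O.TopSpinStructure) : Extends Q (restrict g Q) :=
  ⟨Subtype.val, continuous_subtype_val, Subtype.val_injective, fun _ => rfl, fun _ _ => rfl⟩

variable {g}

/-- The pullback of a spin structure along the polar retraction. -/
abbrev PolarPullback (P : O.SpinStructure g) : Type u :=
  {q : O.FrameBundle × P.P // g.polar q.1 = P.proj q.2}

/-- The topological spin structure of a spin structure. -/
def extend (P : O.SpinStructure g) : O.TopSpinStructure where
  P := PolarPullback P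
  proj q := ⟨q.1.1, mem_univ _⟩
  isCoveringMap := (isCoveringMap_pullback P.isCoveringMap two_ne_zero P.two_sheeted
    g.continuous_polar).homeomorph_comp (Homeomorph.Set.univ O.FrameBundle).symm
  two_sheeted F := by
    rw [ncard_fiber_univ]
    exact ncard_fiber_pullback two_ne_zero P.two_sheeted g.continuous_polar F.1
  act q s := ⟨(q.1.1.rotate (spinRot s), P.act q.1.2 s), Subtype.ext (by
    rw [g.polar_rotate, P.proj_act, q.2])⟩
  continuous_act := Continuous.subtype_mk ((FrameBundle.continuous_rotate.comp
    ((continuous_fst.comp (continuous_subtype_val.comp continuous_fst)).prodMk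
      (continuous_spinRot.comp continuous_snd))).prodMk (P.continuous_act.comp
    ((continuous_snd.comp (continuous_subtype_val.comp continuous_fst)).prodMk continuous_snd))) _
  act_one q := Subtype.ext (Prod.ext (by
    change q.1.1.rotate (spinRot 1) = _
    rw [map_one, FrameBundle.rotate_one]) (P.act_one _))
  act_mul q s t := Subtype.ext (Prod.ext (by
    change q.1.1.rotate _ = _
    rw [map_mul, FrameBundle.rotate_mul]) (P.act_mul _ _ _))
  equivariant q s R h := by rw [isSpinImage_iff.1 h]
  free q s h he := P.free q.1.2 s h (congrArg (fun q : PolarPullback P => q.1.2) he)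

theorem extends_extend (P : O.SpinStructure g) : Extends (extend P) P := by
  refine ⟨fun p => ⟨((P.proj p).1, p), g.polar_of_mem _⟩, ?_, ?_, fun p => rfl, fun p s => ?_⟩
  · exact Continuous.subtype_mk ((continuous_subtype_val.comp
      P.isCoveringMap.continuous).prodMk continuous_id) _
  · intro p q h
    exact congrArg (fun q : PolarPullback P => q.1.2) h
  · exact Subtype.ext (Prod.ext (P.proj_act p s) rfl)

end SpinCover

end OrientedOrbifold

/-! ### Quotients of coverings by group actions -/

section OrbitCoverings

/-- In an orbit of a covering space of a free `G`-space, there is at most one point over a given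
point of the base. -/
theorem orbit_unique {G Z B : Type*} [Group G] [MulAction G Z] [MulAction G B] {ϖ : Z → B}
    (hϖ : ∀ (g : G) z, ϖ (g • z) = g • ϖ z)
    (hfree : ∀ (g : G) (b : B), g • b = b → g = 1) {z z' : Z}
    (h : (Quotient.mk (MulAction.orbitRel G Z) z) = Quotient.mk _ z') (h' : ϖ z = ϖ z') :
    z = z' := by
  obtain ⟨g, rfl⟩ := MulAction.orbitRel_apply.1 (Quotient.exact h)
  have h1 : g • ϖ z' = ϖ z' := (hϖ g z').symm.trans h'
  rw [show g = 1 from hfree g _ h1]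
  exact one_smul G z'

variable {G Z B Y : Type*} [Group G] [MulAction G Z] [TopologicalSpace Z]
  [MulAction G B] [TopologicalSpace B] [TopologicalSpace Y]

/-- The map `Z / G → Y` induced by an equivariant map `ϖ : Z → B` and an invariant map
`q : B → Y`. -/
def orbitMap {ϖ : Z → B} (hϖ : ∀ (g : G) z, ϖ (g • z) = g • ϖ z) {q : B → Y}
    (hq : ∀ (g : G) b, q (g • b) = q b) : Quotient (MulAction.orbitRel G Z) → Y :=
  Quotient.lift (fun z => q (ϖ z)) fun z z' h => by
    obtain ⟨g, rfl⟩ := MulAction.orbitRel_apply.1 h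
    exact (congrArg q (hϖ g z')).trans (hq g _)

theorem continuous_orbitMap {ϖ : Z → B} (hϖ : ∀ (g : G) z, ϖ (g • z) = g • ϖ z) {q : B → Y}
    (hq : ∀ (g : G) b, q (g • b) = q b) (hϖc : Continuous ϖ) (hqc : Continuous q) :
    Continuous (orbitMap hϖ hq) :=
  (hqc.comp hϖc).quotient_lift _

/-- If `B → Y` is a principal `G`-bundle over `W`, given by the section `σ` and the division
map `δ`, and `G` acts on the space `Z` over `B`, then `Z / G → Y` is over `W` the pullback of
`Z → B` along the section. -/
theorem nonempty_orbit_localPullback [TopologicalSpace G] [IsTopologicalGroup G]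
    [ContinuousSMul G Z] {ϖ : Z → B}
    (hϖc : Continuous ϖ) (hϖ : ∀ (g : G) z, ϖ (g • z) = g • ϖ z) {q : B → Y}
    (hq : ∀ (g : G) b, q (g • b) = q b)
    (hfree : ∀ (g : G) (b : B), g • b = b → g = 1) {W : Set Y} {σ : Y → B} {δ : B → G}
    (hσ : ContinuousOn σ W) (hqσ : ∀ y ∈ W, q (σ y) = y) (hδ : ContinuousOn δ (q ⁻¹' W))
    (h : ∀ b, q b ∈ W → b = δ b • σ (q b)) : Nonempty (LocalPullback (orbitMap hϖ hq) ϖ W) := by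
  have hmk : IsOpenQuotientMap (Quotient.mk (MulAction.orbitRel G Z)) :=
    MulAction.isOpenQuotientMap_quotientMk
  -- `γ z` is the representative of the orbit of `z` over the section
  let γ : Z → Z := fun z => (δ (ϖ z))⁻¹ • z
  have hγ : ∀ z, q (ϖ z) ∈ W → ϖ (γ z) = σ (q (ϖ z)) := fun z hz => by
    rw [hϖ, inv_smul_eq_iff]
    exact h _ hz
  have hγmk : ∀ z, Quotient.mk (MulAction.orbitRel G Z) (γ z) = Quotient.mk _ z := fun z =>
    Quotient.sound (MulAction.orbitRel_apply.2 ⟨_, rfl⟩)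
  let g : Quotient (MulAction.orbitRel G Z) → Z := fun x => γ x.out
  have hgmk : ∀ x, Quotient.mk (MulAction.orbitRel G Z) (g x) = x := fun x =>
    (hγmk _).trans x.out_eq
  have hπ : ∀ z, orbitMap hϖ hq (Quotient.mk _ z) = q (ϖ z) := fun z => rfl
  have hg : ∀ x, orbitMap hϖ hq x ∈ W → ϖ (g x) = σ (orbitMap hϖ hq x) := fun x hx => by
    have h1 : orbitMap hϖ hq x = q (ϖ x.out) := (congrArg _ x.out_eq).symm
    rw [h1] at hx ⊢
    exact hγ _ hx
  have hgz : ∀ z, q (ϖ z) ∈ W → g (Quotient.mk _ z) = γ z := fun z hz =>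
    orbit_unique hϖ hfree ((hgmk _).trans (hγmk z).symm)
      ((hg (Quotient.mk _ z) hz).trans (hγ z hz).symm)
  refine ⟨{
    σ := σ
    g := g
    s := fun _ p => Quotient.mk _ p
    continuousOn_σ := hσ
    continuousOn_g := ?_
    continuousOn_s := (hmk.continuous.comp continuous_snd).continuousOn
    proj_g := hg
    proj_s := fun y hy p hp => by rw [hπ, hp, hqσ y hy]
    g_s := fun y hy p hp => by
      have h1 : q (ϖ p) = y := by rw [hp, hqσ y hy]
      refine orbit_unique hϖ hfree (hgmk _) ?_
      rw [hg _ (by rw [hπ, h1]; exact hy), hπ, h1, hp]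
    s_g := fun z _ => hgmk z }⟩
  rw [continuousOn_iff_continuous_domRestrict,
    ← (hmk.restrict_preimage (orbitMap hϖ hq ⁻¹' W)).continuous_comp_iff]
  have h1 : Continuous fun z : Quotient.mk (MulAction.orbitRel G Z) ⁻¹' (orbitMap hϖ hq ⁻¹' W) =>
      γ z.1 :=
    ((hδ.comp_continuous (hϖc.comp continuous_subtype_val) fun z => z.2).inv).smul
      continuous_subtype_val
  exact h1.congr fun z => (hgz z.1 z.2).symm

/-- A map of orbit spaces that depends continuously on a parameter, induced by maps that send
orbits to orbits. -/
theorem continuous_orbit_map₂ [ContinuousConstSMul G Z] {S : Type*} [TopologicalSpace S]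
    {F : Z → S → Z} (hF : Continuous fun p : Z × S => F p.1 p.2)
    {F' : Quotient (MulAction.orbitRel G Z) → S → Quotient (MulAction.orbitRel G Z)}
    (h : ∀ z s, F' (Quotient.mk _ z) s = Quotient.mk _ (F z s)) :
    Continuous fun p : Quotient (MulAction.orbitRel G Z) × S => F' p.1 p.2 := by
  have hmk : IsOpenQuotientMap (Quotient.mk (MulAction.orbitRel G Z)) :=
    MulAction.isOpenQuotientMap_quotientMk
  rw [← (hmk.prodMap IsOpenQuotientMap.id).continuous_comp_iff]
  exact (hmk.continuous.comp hF).congr fun p => (h p.1 p.2).symm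

end OrbitCoverings

section LiftedActions

variable {P X H : Type*} [TopologicalSpace P] [TopologicalSpace X] [TopologicalSpace H]

open unitInterval in
/-- A family of maps of the base of a covering, parametrized by a space `H` that contracts onto a
point that corresponds to the identity, lifts to the covering. -/
theorem IsCoveringMap.exists_lift_family {ϖ : P → X} (hϖ : IsCoveringMap ϖ) {ρ : X → H → X}
    (hρ : Continuous fun q : X × H => ρ q.1 q.2) {e : H} (he : ∀ x, ρ x e = x) {c : I → H → H}
    (hc : Continuous fun q : I × H => c q.1 q.2) (hc0 : ∀ a, c 0 a = e) (hc1 : ∀ a, c 1 a = a)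
    (hce : ∀ t, c t e = e) : ∃ r : P → H → P, Continuous (fun q : P × H => r q.1 q.2) ∧
      (∀ p a, ϖ (r p a) = ρ (ϖ p) a) ∧ ∀ p, r p e = p := by
  let K : C(I × (P × H), X) := ⟨fun q => ρ (ϖ q.2.1) (c q.1 q.2.2),
    hρ.comp ((hϖ.continuous.comp (continuous_fst.comp continuous_snd)).prodMk
      (hc.comp (continuous_fst.prodMk (continuous_snd.comp continuous_snd))))⟩
  have hK0 : ∀ q : P × H, K (0, q) = ϖ ((⟨Prod.fst, continuous_fst⟩ : C(P × H, P)) q) := fun q => by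
    change ρ (ϖ q.1) (c 0 q.2) = ϖ q.1
    rw [hc0, he]
  let L := hϖ.liftHomotopy K ⟨Prod.fst, continuous_fst⟩ hK0
  have hL : ∀ q, ϖ (L q) = K q := fun q => congrFun (hϖ.liftHomotopy_lifts K _ hK0) q
  refine ⟨fun p a => L (1, (p, a)), L.continuous.comp (continuous_const.prodMk continuous_id),
    fun p a => ?_, fun p => ?_⟩
  · rw [hL]
    change ρ (ϖ p) (c 1 a) = _
    rw [hc1]
  · -- the path `t ↦ c t e` is constant, and hence its lift as well
    have h1 := hϖ.const_of_comp (g := fun t : I => L (t, (p, e)))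
      (L.continuous.comp (continuous_id.prodMk continuous_const)) (fun t t' => by
        rw [hL, hL]
        change ρ (ϖ p) (c t e) = ρ (ϖ p) (c t' e)
        rw [hce, hce]) 1 0
    exact h1.trans (hϖ.liftHomotopy_zero K _ hK0 (p, e))

end LiftedActions

/-! ### Lifting the shears to spin structures -/

section Shears

variable {n : ℕ}

open unitInterval

theorem shear_pos {a : GLPlus (n + 1)} (ha : a ∈ verticalShears n) : 0 < a.1 (eucFirst n) 0 := by
  have h := det_eq_of_tail_comp (C := a.1) (A := ContinuousLinearMap.id ℝ _) ha
  rw [GLPlus.det_id, mul_one] at h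
  exact h ▸ a.2

/-- The group of the vertical shears is star-shaped about the identity. -/
def shearPath (t : I) (a : verticalShears n) : verticalShears n :=
  ⟨⟨(1 - (t : ℝ)) • ContinuousLinearMap.id ℝ (Euc (n + 1)) + (t : ℝ) • a.1.1, by
    rw [det_eq_of_tail_comp (A := ContinuousLinearMap.id ℝ _) (fun v => by
      have h : eucTail n (a.1.1 v) = eucTail n v := a.2 v
      simp only [add_apply, smul_apply,
        ContinuousLinearMap.id_apply, map_add, map_smul, h]
      rw [← add_smul, sub_add_cancel, one_smul]), GLPlus.det_id, mul_one]
    have h1 : ((1 - (t : ℝ)) • ContinuousLinearMap.id ℝ (Euc (n + 1)) + (t : ℝ) • a.1.1)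
        (eucFirst n) 0 = (1 - (t : ℝ)) + t * a.1.1 (eucFirst n) 0 := by
      simp [eucFirst]
    rw [h1]
    have h2 := shear_pos a.2
    have h3 := t.2.1
    have h4 := t.2.2
    rcases h3.eq_or_lt with h5 | h5
    · rw [← h5]
      norm_num
    · have := mul_pos h5 h2
      linarith⟩, fun v => by
    have h : eucTail n (a.1.1 v) = eucTail n v := a.2 v
    simp only [add_apply, smul_apply,
      ContinuousLinearMap.id_apply, map_add, map_smul, h]
    rw [← add_smul, sub_add_cancel, one_smul]⟩

theorem continuous_shearPath :
    Continuous fun q : I × verticalShears n => shearPath q.1 q.2 := by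
  refine Continuous.subtype_mk (Continuous.subtype_mk ?_ _) _
  have h1 : Continuous fun q : I × verticalShears n => (q.1 : ℝ) :=
    continuous_subtype_val.comp continuous_fst
  have h2 : Continuous fun q : I × verticalShears n => q.2.1.1 :=
    continuous_subtype_val.comp (continuous_subtype_val.comp continuous_snd)
  exact ((continuous_const.sub h1).smul continuous_const).add (h1.smul h2)

theorem shearPath_zero (a : verticalShears n) : shearPath 0 a = 1 := by
  refine Subtype.ext (Subtype.ext (ContinuousLinearMap.ext fun v => ?_))
  change (1 - (0 : ℝ)) • v + (0 : ℝ) • a.1.1 v = v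
  rw [sub_zero, one_smul, zero_smul, add_zero]

theorem shearPath_one (a : verticalShears n) : shearPath 1 a = a := by
  refine Subtype.ext (Subtype.ext (ContinuousLinearMap.ext fun v => ?_))
  change (1 - (1 : ℝ)) • v + (1 : ℝ) • a.1.1 v = a.1.1 v
  rw [sub_self, one_smul, zero_smul, zero_add]

theorem shearPath_id (t : I) : shearPath t (1 : verticalShears n) = 1 := by
  refine Subtype.ext (Subtype.ext (ContinuousLinearMap.ext fun v => ?_))
  change (1 - (t : ℝ)) • v + (t : ℝ) • v = v
  rw [← add_smul, sub_add_cancel, one_smul]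

instance : PreconnectedSpace (verticalShears n) := by
  refine ⟨isPreconnected_of_forall 1 fun a _ => ⟨range fun t : I => shearPath t a, subset_univ _,
    ⟨0, shearPath_zero a⟩, ⟨1, shearPath_one a⟩, ?_⟩⟩
  exact isPreconnected_range (continuous_shearPath.comp (continuous_id.prodMk continuous_const))

theorem eucTail_spinRot_spinIncl (s : SpinGrp n) (v : Euc (n + 1)) :
    eucTail n ((spinRot (spinIncl n s)).1 v) = (spinRot s).1 (eucTail n v) := by
  rw [eucTail_spinRot (spinRot_spinIncl_eucFirst s), spinRot_spinIncl_eucIncl, eucTail_eucIncl]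

/-- `Spin(n) ⊆ Spin(n+1)` acts on the vertical shears by conjugation. -/
def conjShear (s : SpinGrp n) (a : verticalShears n) : verticalShears n :=
  ⟨spinRot (spinIncl n s) * a.1 * (spinRot (spinIncl n s))⁻¹, fun v => by
    have h : ∀ w, eucTail n (a.1.1 w) = eucTail n w := a.2
    rw [GLPlus.mul_apply, GLPlus.mul_apply, eucTail_spinRot_spinIncl, h,
      ← eucTail_spinRot_spinIncl, GLPlus.apply_inv_apply]⟩

theorem continuous_conjShear (s : SpinGrp n) : Continuous (conjShear s) :=
  Continuous.subtype_mk ((continuous_const.mul continuous_subtype_val).mul continuous_const) _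

theorem conjShear_one (s : SpinGrp n) : conjShear s 1 = 1 :=
  Subtype.ext (by
    change spinRot (spinIncl n s) * 1 * _ = 1
    rw [mul_one, mul_inv_cancel])

theorem conjShear_inv_conjShear (s : SpinGrp n) (a : verticalShears n) :
    conjShear s (conjShear s⁻¹ a) = a :=
  Subtype.ext (by
    have h : spinIncl n s⁻¹ = (spinIncl n s)⁻¹ :=
      eq_inv_of_mul_eq_one_left (by rw [← spinIncl_mul, inv_mul_cancel, spinIncl_one])
    change spinRot (spinIncl n s) * (spinRot (spinIncl n s⁻¹) * a.1 *
      (spinRot (spinIncl n s⁻¹))⁻¹) * (spinRot (spinIncl n s))⁻¹ = a.1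
    rw [h, map_inv]
    group)

end Shears

namespace OrientedOrbifold

variable {n : ℕ} {X : Type u} [TopologicalSpace X] {O : OrientedOrbifold (n + 1) X}

namespace SpinCover

variable (Q : O.TopSpinStructure)

theorem exists_shear : ∃ r : Q.P → verticalShears n → Q.P,
    Continuous (fun q : Q.P × verticalShears n => r q.1 q.2) ∧
    (∀ p a, (Q.proj (r p a)).1 = (Q.proj p).1.rotate a.1) ∧ ∀ p, r p 1 = p :=
  Q.isCoveringMap_frame.exists_lift_family
    (ρ := fun B (a : verticalShears n) => B.rotate a.1)
    (FrameBundle.continuous_rotate.comp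
      (continuous_fst.prodMk (continuous_subtype_val.comp continuous_snd)))
    (e := 1) FrameBundle.rotate_one continuous_shearPath shearPath_zero shearPath_one shearPath_id

/-- The action of the vertical shears on a topological spin structure. -/
def shear : Q.P → verticalShears n → Q.P := Q.exists_shear.choose

theorem continuous_shear : Continuous (fun q : Q.P × verticalShears n => Q.shear q.1 q.2) :=
  Q.exists_shear.choose_spec.1

theorem proj_shear (p : Q.P) (a : verticalShears n) :
    (Q.proj (Q.shear p a)).1 = (Q.proj p).1.rotate a.1 := Q.exists_shear.choose_spec.2.1 p a

theorem shear_one (p : Q.P) : Q.shear p 1 = p := Q.exists_shear.choose_spec.2.2 p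

theorem continuous_shear_right (p : Q.P) : Continuous (Q.shear p) :=
  Q.continuous_shear.comp (continuous_const.prodMk continuous_id)

theorem shear_mul (p : Q.P) (a b : verticalShears n) :
    Q.shear p (a * b) = Q.shear (Q.shear p a) b := by
  refine congrFun (Q.isCoveringMap_frame.eq_of_comp_eq (g₁ := fun b => Q.shear p (a * b))
    (g₂ := Q.shear (Q.shear p a))
    ((Q.continuous_shear_right p).comp (continuous_const.mul continuous_id))
    (Q.continuous_shear_right _) (funext fun c => ?_) 1 (by rw [mul_one, shear_one])) b
  change (Q.proj (Q.shear p (a * c))).1 = (Q.proj (Q.shear (Q.shear p a) c)).1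
  rw [proj_shear, proj_shear, proj_shear, ← FrameBundle.rotate_mul]
  rfl

/-- Automorphisms of a spin structure commute with the shears up to the conjugation given by
their effect on frames. -/
theorem shear_comm {F : Q.P → Q.P} (hF : Continuous F) {c : verticalShears n → verticalShears n}
    (hc : Continuous c) (hc1 : c 1 = 1)
    (h : ∀ p b, (Q.proj (F p)).1.rotate b.1 = (Q.proj (F (Q.shear p (c b)))).1) (p : Q.P)
    (b : verticalShears n) : Q.shear (F p) b = F (Q.shear p (c b)) := by
  refine congrFun (Q.isCoveringMap_frame.eq_of_comp_eq (g₁ := Q.shear (F p))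
    (g₂ := fun b => F (Q.shear p (c b))) (Q.continuous_shear_right _)
    (hF.comp ((Q.continuous_shear_right p).comp hc)) (funext fun b => ?_) 1
    (by rw [shear_one, hc1, shear_one])) b
  exact (Q.proj_shear _ _).trans (h p b)

theorem shear_act (p : Q.P) (s : SpinGrp n) (a : verticalShears n) :
    Q.shear (Q.act p (spinIncl n s)) a = Q.act (Q.shear p (conjShear s a)) (spinIncl n s) := by
  refine Q.shear_comm (F := fun p => Q.act p (spinIncl n s))
    (Q.continuous_act.comp (continuous_id.prodMk continuous_const)) (continuous_conjShear s)
    (conjShear_one s) (fun p b => ?_) p a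
  rw [proj_act, proj_act, proj_shear, ← FrameBundle.rotate_mul, ← FrameBundle.rotate_mul]
  congr 1
  change _ = spinRot (spinIncl n s) * b.1 * (spinRot (spinIncl n s))⁻¹ * _
  rw [inv_mul_cancel_right]

end SpinCover

end OrientedOrbifold

/-! ### The induced spin structure on the base -/

section Descent

variable {n : ℕ} {M N : Type u} [TopologicalSpace M] [TopologicalSpace N] [MulAction Circle M]
  {OM : OrientedOrbifold (n + 1) M} {ON : OrientedOrbifold n N} {f : M → N}

/-- The space of the adapted frames, with the action of `S¹` and of the vertical shears that
makes it a principal bundle over the frames of the base. The type depends on the proof that `f`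
is a bundle because the action does. -/
def AdaptedFrameSpace (_ : IsCircleOrbibundle OM ON f) : Type u := AdaptedFrames OM ON f

/-- The part of a topological spin structure over the adapted frames, with the action of `S¹` and
of the vertical shears. -/
def AdaptedSpinFrames (_ : IsCircleOrbibundle OM ON f) {Q : OM.TopSpinStructure}
    (_ : CircleLift Q) : Type u :=
  {p : Q.P // ∃ A : ON.FrameBundle, FrameProjects f (Q.proj p : OM.FrameBundle) A}

variable (hf : IsCircleOrbibundle OM ON f) {Q : OM.TopSpinStructure} (κ : CircleLift Q)

instance : TopologicalSpace (AdaptedFrameSpace hf) :=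
  inferInstanceAs (TopologicalSpace (AdaptedFrames OM ON f))

instance : TopologicalSpace (AdaptedSpinFrames hf κ) :=
  inferInstanceAs (TopologicalSpace {p : Q.P // ∃ A : ON.FrameBundle,
    FrameProjects f (Q.proj p : OM.FrameBundle) A})

/-- The projection of an adapted frame to the frames of the base. -/
def AdaptedFrameSpace.down (B : AdaptedFrameSpace hf) : ON.FrameBundle := AdaptedFrames.proj B

/-- The adapted frame under a point of the spin structure. -/
def AdaptedSpinFrames.frame (z : AdaptedSpinFrames hf κ) : AdaptedFrameSpace hf :=
  ⟨(Q.proj z.1).1, z.2⟩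

theorem AdaptedFrameSpace.continuous_down : Continuous (AdaptedFrameSpace.down hf) :=
  AdaptedFrames.continuous_proj hf

theorem AdaptedSpinFrames.isCoveringMap_frame :
    IsCoveringMap (AdaptedSpinFrames.frame hf κ) :=
  Q.isCoveringMap_frame.restrictPreimage {B | ∃ A : ON.FrameBundle, FrameProjects f B A}

theorem AdaptedSpinFrames.ncard_fiber (B : AdaptedFrameSpace hf) :
    (AdaptedSpinFrames.frame hf κ ⁻¹' {B}).ncard = 2 := by
  rw [← Q.ncard_fiber_frame B.1]
  refine Set.ncard_congr (fun z _ => z.1) ?_ ?_ ?_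
  · rintro z rfl
    rfl
  · rintro z z' - - h
    exact Subtype.ext h
  · intro p hp
    have hp : (Q.proj p).1 = B.1 := hp
    exact ⟨⟨p, by rw [hp]; exact B.2⟩, Subtype.ext hp, rfl⟩

namespace OrientedOrbifold.CircleLift

variable {κ}

theorem proj_κ (hf : IsCircleOrbibundle OM ON f) (κ : CircleLift Q) (t : Circle) (p : Q.P) :
    (Q.proj (κ.κ t p)).1 = hf.circ t (Q.proj p).1 :=
  hf.pushFrame_iff.1 (κ.covers t p)

theorem shear_κ (hf : IsCircleOrbibundle OM ON f) (κ : CircleLift Q) (t : Circle) (p : Q.P)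
    (a : verticalShears n) : Q.shear (κ.κ t p) a = κ.κ t (Q.shear p a) := by
  refine Q.shear_comm (F := κ.κ t) (c := id) (κ.continuous_κ.comp
    (continuous_const.prodMk continuous_id)) continuous_id rfl (fun p b => ?_) p a
  rw [κ.proj_κ hf, κ.proj_κ hf, ← hf.circ_rotate]
  exact congrArg _ (Q.proj_shear p b).symm

end OrientedOrbifold.CircleLift

instance : MulAction (Circle × verticalShears n) (AdaptedFrameSpace hf) where
  smul g B := ⟨(hf.circ g.1 B.1).rotate (g.2⁻¹).1,
    B.2.imp fun _ h => (h.circ hf g.1).shear hf (g.2⁻¹).2⟩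
  one_smul B := Subtype.ext (by
    change (hf.circ 1 B.1).rotate ((1 : verticalShears n)⁻¹).1 = B.1
    rw [hf.circ_one, inv_one]
    exact FrameBundle.rotate_one _)
  mul_smul g g' B := Subtype.ext (by
    change (hf.circ (g.1 * g'.1) B.1).rotate ((g.2 * g'.2)⁻¹).1
      = (hf.circ g.1 ((hf.circ g'.1 B.1).rotate (g'.2⁻¹).1)).rotate (g.2⁻¹).1
    rw [hf.circ_rotate, ← FrameBundle.rotate_mul, hf.circ_mul, mul_inv_rev]
    rfl)

theorem AdaptedFrameSpace.down_smul (g : Circle × verticalShears n) (B : AdaptedFrameSpace hf) :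
    down hf (g • B) = down hf B :=
  FrameProjects.proj_eq hf (B := g • B)
    (((AdaptedFrames.frameProjects B).circ hf g.1).shear hf (g.2⁻¹).2)

theorem AdaptedFrameSpace.smul_free (g : Circle × verticalShears n) (B : AdaptedFrameSpace hf)
    (h : g • B = B) : g = 1 := by
  obtain ⟨h1, h2⟩ := (AdaptedFrames.frameProjects B).circ_shear_free hf (g.2⁻¹).2
    (congrArg Subtype.val h)
  exact Prod.ext h1 (inv_eq_one.1 (Subtype.ext h2))

instance : MulAction (Circle × verticalShears n) (AdaptedSpinFrames hf κ) where
  smul g z := ⟨κ.κ g.1 (Q.shear z.1 g.2⁻¹), by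
    have h := (g • z.frame).2
    have e : (g • z.frame).1 = (Q.proj (κ.κ g.1 (Q.shear z.1 g.2⁻¹))).1 := by
      rw [κ.proj_κ hf, Q.proj_shear, hf.circ_rotate]
      rfl
    rwa [e] at h⟩
  one_smul z := Subtype.ext (by
    change κ.κ 1 (Q.shear z.1 1⁻¹) = z.1
    rw [κ.κ_one, inv_one, Q.shear_one])
  mul_smul g g' z := Subtype.ext (by
    change κ.κ (g.1 * g'.1) (Q.shear z.1 (g.2 * g'.2)⁻¹)
      = κ.κ g.1 (Q.shear (κ.κ g'.1 (Q.shear z.1 g'.2⁻¹)) g.2⁻¹)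
    rw [κ.shear_κ hf, κ.κ_mul, mul_inv_rev, Q.shear_mul])

namespace AdaptedSpinFrames

theorem frame_smul (g : Circle × verticalShears n) (z : AdaptedSpinFrames hf κ) :
    frame hf κ (g • z) = g • frame hf κ z := Subtype.ext (by
  change (Q.proj (κ.κ g.1 (Q.shear z.1 g.2⁻¹))).1 = _
  rw [κ.proj_κ hf, Q.proj_shear, hf.circ_rotate]
  rfl)

instance : ContinuousSMul (Circle × verticalShears n) (AdaptedSpinFrames hf κ) where
  continuous_smul := by
    refine Continuous.subtype_mk (κ.continuous_κ.comp
      ((continuous_fst.comp continuous_fst).prodMk (Q.continuous_shear.comp (Continuous.prodMk ?_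
        (continuous_snd.comp continuous_fst).inv)))) _
    exact continuous_subtype_val.comp continuous_snd

/-- The action of `Spin(n) ⊆ Spin(n+1)` over the adapted frames. -/
def act (z : AdaptedSpinFrames hf κ) (s : SpinGrp n) : AdaptedSpinFrames hf κ :=
  ⟨Q.act z.1 (spinIncl n s), by
    obtain ⟨A, hA⟩ := z.2
    refine ⟨A.rotate (spinRot s), ?_⟩
    rw [Q.proj_act]
    exact hA.rotate hf (eucTail_spinRot_spinIncl s)⟩

theorem continuous_act : Continuous fun p : AdaptedSpinFrames hf κ × SpinGrp n =>
    act hf κ p.1 p.2 :=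
  Continuous.subtype_mk (Q.continuous_act.comp
    ((continuous_subtype_val.comp continuous_fst).prodMk
      ((continuous_spinIncl n).comp continuous_snd))) _

theorem smul_act (g : Circle × verticalShears n) (z : AdaptedSpinFrames hf κ) (s : SpinGrp n) :
    act hf κ (g • z) s = (g.1, (conjShear s⁻¹ g.2⁻¹)⁻¹) • act hf κ z s := Subtype.ext (by
  change Q.act (κ.κ g.1 (Q.shear z.1 g.2⁻¹)) _
    = κ.κ g.1 (Q.shear (Q.act z.1 _) (conjShear s⁻¹ g.2⁻¹)⁻¹⁻¹)
  rw [inv_inv, Q.shear_act, conjShear_inv_conjShear, κ.κ_act])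

end AdaptedSpinFrames

/-- The spin structure on the base, as the quotient of the part of the spin structure of the
total space that lies over the adapted frames. -/
abbrev DescendedSpin : Type u :=
  Quotient (MulAction.orbitRel (Circle × verticalShears n) (AdaptedSpinFrames hf κ))

namespace DescendedSpin

/-- The projection of the quotient to the frames of the base. -/
def proj : DescendedSpin hf κ → ON.FrameBundle :=
  orbitMap (AdaptedSpinFrames.frame_smul hf κ) (AdaptedFrameSpace.down_smul hf)

theorem exists_localPullback (A : ON.FrameBundle) : ∃ W : Set ON.FrameBundle, IsOpen W ∧ A ∈ W ∧
    Nonempty (LocalPullback (proj hf κ) (AdaptedSpinFrames.frame hf κ) W) := by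
  obtain ⟨W, hW, hA, σ, τ, α, h1, h2, h3, h4, h5⟩ := exists_adapted_trivialization hf A
  obtain ⟨B₀, hB₀⟩ := exists_frameProjects hf A
  classical
  have hσ : ∀ B ∈ W, ∃ A : ON.FrameBundle, FrameProjects f (σ B) A := fun B hB => ⟨_, h2 B hB⟩
  let σ' : ON.FrameBundle → AdaptedFrameSpace hf := fun B =>
    if h : ∃ A : ON.FrameBundle, FrameProjects f (σ B) A then ⟨σ B, h⟩ else ⟨B₀, A, hB₀⟩
  have hσ' : ∀ B (hB : B ∈ W), σ' B = ⟨σ B, hσ B hB⟩ := fun B hB => dif_pos _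
  refine ⟨W, hW, hA, nonempty_orbit_localPullback
    (AdaptedSpinFrames.isCoveringMap_frame hf κ).continuous (AdaptedSpinFrames.frame_smul hf κ)
    (AdaptedFrameSpace.down_smul hf) (AdaptedFrameSpace.smul_free hf) (W := W) (σ := σ')
    (δ := fun B => (τ B, (α B)⁻¹)) ?_ ?_ (h3.prodMk h4.inv) ?_⟩
  · rw [continuousOn_iff_continuous_domRestrict] at h1 ⊢
    exact (Continuous.subtype_mk h1 fun B => hσ B.1 B.2).congr fun B => (hσ' B.1 B.2).symm
  · intro B hB
    rw [hσ' B hB]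
    exact FrameProjects.proj_eq hf (B := ⟨σ B, hσ B hB⟩) (h2 B hB)
  · intro B hB
    rw [hσ' _ hB]
    refine Subtype.ext ((h5 B hB).trans ?_)
    change _ = (hf.circ (τ B) (σ (AdaptedFrames.proj B))).rotate ((α B)⁻¹⁻¹).1
    rw [inv_inv]

theorem continuous_proj : Continuous (proj hf κ) :=
  continuous_orbitMap _ _ (AdaptedSpinFrames.isCoveringMap_frame hf κ).continuous
    (AdaptedFrameSpace.continuous_down hf)

theorem isCoveringMap_proj : IsCoveringMap (proj hf κ) :=
  isCoveringMap_of_localPullback (continuous_proj hf κ) (AdaptedSpinFrames.isCoveringMap_frame hf κ)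
    (exists_localPullback hf κ)

/-- The action of `Spin(n)` on the quotient. -/
def act (x : DescendedSpin hf κ) (s : SpinGrp n) : DescendedSpin hf κ :=
  Quotient.map (fun z => AdaptedSpinFrames.act hf κ z s) (fun z z' h => by
    obtain ⟨g, rfl⟩ := MulAction.orbitRel_apply.1 h
    exact MulAction.orbitRel_apply.2 ⟨_, (AdaptedSpinFrames.smul_act hf κ g z' s).symm⟩) x

theorem frameProjects (z : AdaptedSpinFrames hf κ) :
    FrameProjects f (Q.proj z.1).1 (proj hf κ (Quotient.mk _ z)) :=
  AdaptedFrames.frameProjects (z.frame hf κ)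

theorem proj_eq {z : AdaptedSpinFrames hf κ} {A : ON.FrameBundle}
    (h : FrameProjects f (Q.proj z.1).1 A) : proj hf κ (Quotient.mk _ z) = A :=
  (frameProjects hf κ z).unique hf h

/-- The topological spin structure on the base that is induced by a projectable one. -/
def topSpinStructure : ON.TopSpinStructure where
  P := DescendedSpin hf κ
  proj x := ⟨proj hf κ x, mem_univ _⟩
  isCoveringMap := (isCoveringMap_proj hf κ).homeomorph_comp (Homeomorph.Set.univ _).symm
  two_sheeted A := by
    rw [ncard_fiber_univ]
    exact ncard_fiber_of_localPullback (AdaptedSpinFrames.ncard_fiber hf κ)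
      (exists_localPullback hf κ) A.1
  act := act hf κ
  continuous_act := continuous_orbit_map₂ (AdaptedSpinFrames.continuous_act hf κ) fun _ _ => rfl
  act_one x := by
    induction x using Quotient.inductionOn with | h z => ?_
    refine congrArg (Quotient.mk _) (Subtype.ext ?_)
    change Q.act z.1 (spinIncl n 1) = z.1
    rw [spinIncl_one, Q.act_one]
  act_mul x s t := by
    induction x using Quotient.inductionOn with | h z => ?_
    refine congrArg (Quotient.mk _) (Subtype.ext ?_)
    change Q.act z.1 (spinIncl n (s * t)) = Q.act (Q.act z.1 _) _
    rw [spinIncl_mul, Q.act_mul]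
  equivariant x s R h := by
    rw [isSpinImage_iff.1 h]
    induction x using Quotient.inductionOn with | h z => ?_
    refine proj_eq hf κ (z := z.act hf κ s) ?_
    change FrameProjects f (Q.proj (Q.act z.1 _)).1 _
    rw [Q.proj_act]
    exact (frameProjects hf κ z).rotate hf (eucTail_spinRot_spinIncl s)
  free x s h he := by
    induction x using Quotient.inductionOn with | h z => ?_
    have h1 : spinRot s = 1 := (isSpinImage_iff.1 h).symm
    have h2 : spinRot (spinIncl n s) = 1 := Subtype.ext (clm_eq_of_first_of_incl
      (spinRot_spinIncl_eucFirst s) (ContinuousLinearMap.ext fun v => by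
        change (spinRot (spinIncl n s)).1 (eucIncl n v) = eucIncl n v
        rw [spinRot_spinIncl_eucIncl, h1]
        rfl))
    have h3 : z.act hf κ s = z := orbit_unique (AdaptedSpinFrames.frame_smul hf κ)
      (AdaptedFrameSpace.smul_free hf) he (Subtype.ext (by
        change (Q.proj (Q.act z.1 _)).1 = (Q.proj z.1).1
        rw [Q.proj_act, h2, FrameBundle.rotate_one]))
    exact spinIncl_injective n ((Q.eq_one_of_act h2 (congrArg Subtype.val h3)).trans
      (spinIncl_one n).symm)

theorem topInduces : TopInduces f Q κ (topSpinStructure hf κ) := by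
  refine ⟨fun z => Quotient.mk (MulAction.orbitRel (Circle × verticalShears n)
    (AdaptedSpinFrames hf κ)) z, continuous_quotient_mk', frameProjects hf κ, ?_, ?_, ?_⟩
  · intro p q h h'
    have h1 : (Q.proj p.1).1 = (Q.proj q.1).1 := congrArg Subtype.val h
    exact orbit_unique (z := (p : AdaptedSpinFrames hf κ)) (z' := q)
      (AdaptedSpinFrames.frame_smul hf κ) (AdaptedFrameSpace.smul_free hf) h'
      (Subtype.ext h1)
  · intro p q t h
    refine Quotient.sound (MulAction.orbitRel_apply.2
      ⟨((t, 1) : Circle × verticalShears n), Subtype.ext ?_⟩)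
    change κ.κ t (Q.shear p.1 1⁻¹) = q.1
    rw [inv_one, Q.shear_one, h]
  · intro p q s h
    exact congrArg (Quotient.mk (MulAction.orbitRel (Circle × verticalShears n)
      (AdaptedSpinFrames hf κ))) (Subtype.ext h)

end DescendedSpin

end Descent

/-! ### The stabilizer of the vertical direction -/

section Stabilizer

/-- The stabilizer of the first basis vector in `Spin(n+1)`. It is `Spin(n)` for `n ≠ 0`, and
`Spin(1) = {±1}` for `n = 0`. -/
def spinStabilizer (n : ℕ) : Subgroup (SpinGrp (n + 1)) where
  carrier := {k | (spinRot k).1 (eucFirst n) = eucFirst n}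
  mul_mem' {a b} ha hb := by
    have ha : (spinRot a).1 (eucFirst n) = eucFirst n := ha
    have hb : (spinRot b).1 (eucFirst n) = eucFirst n := hb
    change (spinRot (a * b)).1 (eucFirst n) = _
    rw [map_mul, GLPlus.mul_apply, hb, ha]
  one_mem' := by
    change (spinRot 1).1 (eucFirst n) = _
    rw [map_one, GLPlus.one_apply]
  inv_mem' {a} ha := by
    have ha : (spinRot a).1 (eucFirst n) = eucFirst n := ha
    change (spinRot a⁻¹).1 (eucFirst n) = _
    rw [map_inv]
    conv_lhs => rw [← ha]
    exact GLPlus.inv_apply_apply _ _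

variable {n : ℕ}

/-- The rotation of `ℝⁿ` given by an element of the stabilizer. -/
def stabilizerRot (k : spinStabilizer n) : GLPlus n := stabRot k.1 k.2

theorem eucTail_stabilizer (k : spinStabilizer n) (v : Euc (n + 1)) :
    eucTail n ((spinRot k.1).1 v) = (stabilizerRot k).1 (eucTail n v) :=
  eucTail_spinRot k.2 v

/-- The inclusion of `Spin(n)` into the stabilizer. -/
def spinToStabilizer (s : SpinGrp n) : spinStabilizer n :=
  ⟨spinIncl n s, spinRot_spinIncl_eucFirst s⟩

namespace OrientedOrbifold.SpinCover

variable {X : Type u} [TopologicalSpace X]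

/-- A spin structure comes with an action of the stabilizer of the first basis vector in
`Spin(n+1)`. For `n ≠ 0`, this is the action of `Spin(n)`; for `n = 0`, the element `-1` exchanges
the two sheets of the covering. -/
structure IsStabilizerAction {O : OrientedOrbifold n X} (Q : O.TopSpinStructure)
    (r : Q.P → spinStabilizer n → Q.P) : Prop where
  continuous : Continuous fun q : Q.P × spinStabilizer n => r q.1 q.2
  one : ∀ y, r y 1 = y
  mul : ∀ y k l, r y (k * l) = r (r y k) l
  proj : ∀ y k, (Q.proj (r y k)).1 = (Q.proj y).1.rotate (stabilizerRot k)
  free : ∀ y k, spinRot k.1 = 1 → r y k = y → k = 1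
  act : ∀ y s, r y (spinToStabilizer s) = Q.act y s

theorem exists_isStabilizerAction_of_ne_zero (hn : n ≠ 0) {O : OrientedOrbifold n X}
    (Q : O.TopSpinStructure) : ∃ r, Q.IsStabilizerAction r := by
  choose ρ hρ using fun k : spinStabilizer n => exists_spinIncl_eq hn k.2
  have hρ' : ∀ s, ρ (spinToStabilizer s) = s := fun s => spinIncl_injective n (hρ _)
  have hρc : Continuous ρ := continuous_of_spinIncl (continuous_subtype_val.congr
    fun k => (hρ k).symm)
  have hrot : ∀ k, spinRot (ρ k) = stabilizerRot k := fun k => by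
    obtain ⟨k, hk⟩ := k
    have h : spinIncl n (ρ ⟨k, hk⟩) = k := hρ ⟨k, hk⟩
    rw [← stabRot_spinIncl]
    change _ = stabRot k hk
    congr 1
  refine ⟨fun y k => Q.act y (ρ k), Q.continuous_act.comp
    (continuous_fst.prodMk (hρc.comp continuous_snd)), fun y => ?_, fun y k l => ?_, fun y k => ?_,
    fun y k hk h => ?_, fun y s => by rw [hρ']⟩
  · have h : ρ 1 = 1 := spinIncl_injective n ((hρ 1).trans (spinIncl_one n).symm)
    rw [h, Q.act_one]
  · have h : ρ (k * l) = ρ k * ρ l := spinIncl_injective n (by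
      rw [spinIncl_mul, hρ, hρ, hρ]
      rfl)
    rw [h, Q.act_mul]
  · rw [Q.proj_act, hrot]
  · have h1 : spinRot (ρ k) = 1 := by
      rw [hrot]
      refine Subtype.ext (ContinuousLinearMap.ext fun v => ?_)
      change eucTail n ((spinRot k.1).1 (eucIncl n v)) = v
      rw [hk, GLPlus.one_apply, eucTail_eucIncl]
    have h2 : ρ k = 1 := Q.eq_one_of_act h1 h
    refine Subtype.ext ?_
    rw [← hρ k, h2, spinIncl_one]
    rfl

/-- For `n = 0` the stabilizer is `{±1}`, and `-1` acts by exchanging the two sheets. -/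
theorem exists_isStabilizerAction_zero {O : OrientedOrbifold 0 X} (Q : O.TopSpinStructure) :
    ∃ r, Q.IsStabilizerAction r := by
  classical
  obtain ⟨sw, h1, h2, h3, h4⟩ := exists_sheet_swap Q.isCoveringMap Q.two_sheeted
  have h5 : ∀ y, sw (sw y) = y := fun y => (h4 (sw y) y (h2 y).symm (h3 y).symm).symm
  have hcases : ∀ k : spinStabilizer 0, k = 1 ∨
      (k.1 : CliffordAlgebra (eucForm 1)) = -1 := fun k =>
    (spin_one_cases k.1 k.2).imp_left fun h => Subtype.ext h
  have hsub : ∀ R R' : GLPlus 0, R = R' := fun R R' =>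
    Subtype.ext (ContinuousLinearMap.ext fun v => Subsingleton.elim _ _)
  let r : Q.P → spinStabilizer 0 → Q.P := fun y k => if k = 1 then y else sw y
  have hr1 : ∀ y, r y 1 = y := fun y => if_pos rfl
  have hr2 : ∀ y k, k ≠ 1 → r y k = sw y := fun y k hk => if_neg hk
  refine ⟨r, ?_, hr1, fun y k l => ?_, fun y k => ?_, fun y k _ h => ?_, fun y s => ?_⟩
  · -- the stabilizer is discrete, so the action is continuous in both arguments
    refine continuous_iff_continuousAt.2 fun ⟨y, k⟩ => ?_
    obtain ⟨V, hV, hV1, hVk⟩ := exists_isOpen_spin_one 1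
    rcases hcases k with rfl | hk
    · refine (continuous_fst.continuousAt (x := (y, (1 : spinStabilizer 0)))).congr ?_
      have h6 : ∀ᶠ p : Q.P × spinStabilizer 0 in 𝓝 (y, 1), p.2.1 ∈ V :=
        (continuous_subtype_val.comp continuous_snd).continuousAt.eventually (hV.mem_nhds hV1)
      filter_upwards [h6] with p hp
      rcases hcases p.2 with hp2 | hp2
      · rw [hp2, hr1]
      · exact absurd hp (hVk _ hp2).1
    · obtain ⟨-, W, hW, hkW, h1W⟩ := hVk k.1 hk
      refine ((h1.comp continuous_fst).continuousAt (x := (y, k))).congr ?_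
      have h6 : ∀ᶠ p : Q.P × spinStabilizer 0 in 𝓝 (y, k), p.2.1 ∈ W :=
        (continuous_subtype_val.comp continuous_snd).continuousAt.eventually (hW.mem_nhds hkW)
      filter_upwards [h6] with p hp
      refine (hr2 _ _ fun hp2 => h1W ?_).symm
      rw [hp2] at hp
      exact hp
  · by_cases hk : k = 1
    · rw [hk, one_mul, hr1]
    · by_cases hl : l = 1
      · rw [hl, mul_one, hr1]
      · have h6 : k * l = 1 := Subtype.ext (Subtype.ext (by
          have e1 := (hcases k).resolve_left hk
          have e2 := (hcases l).resolve_left hl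
          change (k.1 : CliffordAlgebra (eucForm 1)) * (l.1 : CliffordAlgebra (eucForm 1)) = 1
          rw [e1, e2]
          norm_num))
        rw [h6, hr1, hr2 _ _ hk, hr2 _ _ hl, h5]
  · have h6 : (Q.proj (r y k)).1 = (Q.proj y).1 := by
      by_cases hk : k = 1
      · rw [hk, hr1]
      · rw [hr2 _ _ hk, h2]
    rw [h6, hsub (stabilizerRot k) 1, FrameBundle.rotate_one]
  · by_contra hk
    rw [hr2 _ _ hk] at h
    exact h3 y h
  · by_cases hs : s = 1
    · have h6 : spinToStabilizer s = 1 := Subtype.ext (by rw [hs]; exact spinIncl_one 0)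
      rw [h6, hs, hr1, Q.act_one]
    · have h6 : spinToStabilizer s ≠ 1 := fun h => hs (spinIncl_injective 0
        ((congrArg Subtype.val h).trans (spinIncl_one 0).symm))
      rw [hr2 _ _ h6]
      refine (h4 y _ (Subtype.ext ?_) fun h => hs (Q.eq_one_of_act (hsub _ _) h)).symm
      rw [Q.proj_act, hsub (spinRot s) 1, FrameBundle.rotate_one]

theorem exists_isStabilizerAction {O : OrientedOrbifold n X} (Q : O.TopSpinStructure) :
    ∃ r, Q.IsStabilizerAction r := by
  rcases eq_or_ne n 0 with rfl | hn
  · exact Q.exists_isStabilizerAction_zero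
  · exact Q.exists_isStabilizerAction_of_ne_zero hn

end OrientedOrbifold.SpinCover

end Stabilizer

/-! ### The induced spin structure on the total space -/

section Lift

variable {n : ℕ} {M N : Type u} [TopologicalSpace M] [TopologicalSpace N] [MulAction Circle M]
  {OM : OrientedOrbifold (n + 1) M} {ON : OrientedOrbifold n N} {f : M → N}

/-- The frames of the total space together with an element of `Spin(n+1)` that rotates them into
adapted frames. Over the frame bundle, this is a principal bundle for the stabilizer of the
vertical direction. -/
def RotatedFrames (_ : IsCircleOrbibundle OM ON f) : Type u :=
  {b : OM.FrameBundle × SpinGrp (n + 1) //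
    ∃ A : ON.FrameBundle, FrameProjects f (b.1.rotate (spinRot b.2)) A}

variable (hf : IsCircleOrbibundle OM ON f)

namespace RotatedFrames

instance : TopologicalSpace (RotatedFrames hf) :=
  inferInstanceAs (TopologicalSpace {b : OM.FrameBundle × SpinGrp (n + 1) //
    ∃ A : ON.FrameBundle, FrameProjects f (b.1.rotate (spinRot b.2)) A})

/-- The frame of the total space. -/
def frame (b : RotatedFrames hf) : OM.FrameBundle := b.1.1

/-- The frame of the base under the rotated frame. -/
def down (b : RotatedFrames hf) : ON.FrameBundle :=
  AdaptedFrames.proj (⟨b.1.1.rotate (spinRot b.1.2), b.2⟩ : AdaptedFrames OM ON f)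

theorem frameProjects_down (b : RotatedFrames hf) :
    FrameProjects f (b.1.1.rotate (spinRot b.1.2)) (down hf b) :=
  AdaptedFrames.frameProjects (⟨b.1.1.rotate (spinRot b.1.2), b.2⟩ : AdaptedFrames OM ON f)

theorem down_eq {b : RotatedFrames hf} {A : ON.FrameBundle}
    (h : FrameProjects f (b.1.1.rotate (spinRot b.1.2)) A) : down hf b = A :=
  (frameProjects_down hf b).unique hf h

theorem continuous_frame : Continuous (frame hf) := continuous_fst.comp continuous_subtype_val

theorem continuous_down : Continuous (down hf) :=
  (AdaptedFrames.continuous_proj hf).comp (Continuous.subtype_mk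
    (FrameBundle.continuous_rotate.comp ((continuous_fst.comp continuous_subtype_val).prodMk
      (continuous_spinRot.comp (continuous_snd.comp continuous_subtype_val)))) _)

theorem frameProjects_stabilizer (b : RotatedFrames hf) (k : spinStabilizer n) :
    FrameProjects f (b.1.1.rotate (spinRot (b.1.2 * k.1)))
      ((down hf b).rotate (stabilizerRot k)) := by
  rw [map_mul, FrameBundle.rotate_mul]
  exact (frameProjects_down hf b).rotate hf (eucTail_stabilizer k)

instance : MulAction (spinStabilizer n) (RotatedFrames hf) where
  smul k b := ⟨(b.1.1, b.1.2 * (k⁻¹).1), _, frameProjects_stabilizer hf b k⁻¹⟩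
  one_smul b := Subtype.ext (Prod.ext rfl (by
    change b.1.2 * ((1 : spinStabilizer n)⁻¹).1 = b.1.2
    rw [inv_one]
    exact mul_one _))
  mul_smul k l b := Subtype.ext (Prod.ext rfl (by
    change b.1.2 * ((k * l)⁻¹).1 = b.1.2 * (l⁻¹).1 * (k⁻¹).1
    rw [mul_inv_rev, mul_assoc]
    rfl))

theorem frame_smul (k : spinStabilizer n) (b : RotatedFrames hf) :
    frame hf (k • b) = frame hf b := rfl

theorem down_smul (k : spinStabilizer n) (b : RotatedFrames hf) :
    down hf (k • b) = (down hf b).rotate (stabilizerRot k⁻¹) :=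
  down_eq hf (b := k • b) (frameProjects_stabilizer hf b k⁻¹)

theorem smul_free (k : spinStabilizer n) (b : RotatedFrames hf) (h : k • b = b) : k = 1 := by
  have h1 : b.1.2 * (k⁻¹).1 = b.1.2 := congrArg (fun b : RotatedFrames hf => b.1.2) h
  exact inv_eq_one.1 (Subtype.ext (mul_eq_left.1 h1))

/-- Two rotations of a frame into adapted frames differ by an element of the stabilizer. -/
theorem inv_mul_mem (b : RotatedFrames hf) {s : SpinGrp (n + 1)} {A : ON.FrameBundle}
    (h : FrameProjects f (b.1.1.rotate (spinRot s)) A) : b.1.2⁻¹ * s ∈ spinStabilizer n := by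
  refine (frameProjects_down hf b).rotation_eucFirst hf (R := spinRot (b.1.2⁻¹ * s)) (A' := A) ?_
    (norm_spinRot _)
  rwa [← FrameBundle.rotate_mul, ← map_mul, mul_inv_cancel_left]

/-- The rotated frames form a locally trivial principal bundle over the frame bundle: there are
local sections `σ`, and the element `δ` of the stabilizer that carries the section to a rotated
frame depends continuously on it. -/
theorem exists_trivialization (B₀ : OM.FrameBundle) : ∃ V : Set OM.FrameBundle, IsOpen V ∧
    B₀ ∈ V ∧ ∃ (σ : OM.FrameBundle → RotatedFrames hf) (δ : RotatedFrames hf → spinStabilizer n),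
      ContinuousOn σ V ∧ (∀ B ∈ V, frame hf (σ B) = B) ∧ ContinuousOn δ (frame hf ⁻¹' V) ∧
      ∀ b, frame hf b ∈ V → b = δ b • σ (frame hf b) := by
  obtain ⟨V, hV, hB₀, s, hs, h⟩ := exists_spin_adapted hf B₀
  classical
  let σ : OM.FrameBundle → RotatedFrames hf := fun B =>
    if hB : ∃ A : ON.FrameBundle, FrameProjects f (B.rotate (spinRot (s B))) A
    then ⟨(B, s B), hB⟩ else ⟨(B₀, s B₀), h B₀ hB₀⟩
  have hσ : ∀ B (hB : B ∈ V), σ B = ⟨(B, s B), h B hB⟩ := fun B hB => dif_pos _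
  let δ : RotatedFrames hf → spinStabilizer n := fun b =>
    if hb : b.1.2⁻¹ * s (frame hf b) ∈ spinStabilizer n then ⟨_, hb⟩ else 1
  have hmem : ∀ b, frame hf b ∈ V → b.1.2⁻¹ * s (frame hf b) ∈ spinStabilizer n := fun b hb => by
    obtain ⟨A, hA⟩ := h _ hb
    exact inv_mul_mem hf b hA
  have hδ : ∀ b (hb : frame hf b ∈ V), δ b = ⟨_, hmem b hb⟩ := fun b hb => dif_pos _
  refine ⟨V, hV, hB₀, σ, δ, ?_, fun B hB => by rw [hσ B hB]; rfl, ?_, fun b hb => ?_⟩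
  · rw [continuousOn_iff_continuous_domRestrict] at hs ⊢
    exact (Continuous.subtype_mk (continuous_subtype_val.prodMk hs)
      fun B => h B.1 B.2).congr fun B => (hσ B.1 B.2).symm
  · rw [continuousOn_iff_continuous_domRestrict]
    have h1 : Continuous fun b : (frame hf ⁻¹' V : Set (RotatedFrames hf)) => b.1.1.2⁻¹ :=
      (continuous_snd.comp (continuous_subtype_val.comp
        (continuous_subtype_val (p := (· ∈ frame hf ⁻¹' V))))).inv
    have h2 : Continuous fun b : (frame hf ⁻¹' V : Set (RotatedFrames hf)) => s (frame hf b.1) :=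
      hs.comp_continuous ((continuous_frame hf).comp continuous_subtype_val) fun b => b.2
    exact (Continuous.subtype_mk (h1.mul h2) fun b => hmem b.1 b.2).congr
      fun b => (hδ b.1 b.2).symm
  · rw [hσ _ hb, hδ _ hb]
    refine Subtype.ext (Prod.ext rfl ?_)
    change b.1.2 = s (frame hf b) * (b.1.2⁻¹ * s (frame hf b))⁻¹
    rw [mul_inv_rev, inv_inv, mul_inv_cancel_left]

/-- The right action of `Spin(n+1)`, which rotates the frame but not the adapted frame. -/
def act (b : RotatedFrames hf) (k : SpinGrp (n + 1)) : RotatedFrames hf :=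
  ⟨(b.1.1.rotate (spinRot k), k⁻¹ * b.1.2), by
    rw [← FrameBundle.rotate_mul, ← map_mul, mul_inv_cancel_left]
    exact b.2⟩

theorem continuous_act : Continuous fun p : RotatedFrames hf × SpinGrp (n + 1) =>
    act hf p.1 p.2 := by
  have h : Continuous fun p : RotatedFrames hf × SpinGrp (n + 1) => p.1.1 :=
    continuous_subtype_val.comp continuous_fst
  exact Continuous.subtype_mk ((FrameBundle.continuous_rotate.comp ((continuous_fst.comp h).prodMk
    (continuous_spinRot.comp continuous_snd))).prodMk
      (continuous_snd.inv.mul (continuous_snd.comp h))) _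

theorem down_act (b : RotatedFrames hf) (k : SpinGrp (n + 1)) :
    down hf (act hf b k) = down hf b := by
  refine down_eq hf ?_
  change FrameProjects f ((b.1.1.rotate (spinRot k)).rotate (spinRot (k⁻¹ * b.1.2))) _
  rw [← FrameBundle.rotate_mul, ← map_mul, mul_inv_cancel_left]
  exact frameProjects_down hf b

theorem act_smul (k : spinStabilizer n) (b : RotatedFrames hf) (s : SpinGrp (n + 1)) :
    act hf (k • b) s = k • act hf b s :=
  Subtype.ext (Prod.ext rfl (mul_assoc _ _ _).symm)

theorem act_one (b : RotatedFrames hf) : act hf b 1 = b :=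
  Subtype.ext (Prod.ext (by
    change b.1.1.rotate (spinRot 1) = b.1.1
    rw [map_one, FrameBundle.rotate_one]) (by
    change 1⁻¹ * b.1.2 = b.1.2
    rw [inv_one, one_mul]))

theorem act_mul (b : RotatedFrames hf) (s t : SpinGrp (n + 1)) :
    act hf b (s * t) = act hf (act hf b s) t :=
  Subtype.ext (Prod.ext (by
    change b.1.1.rotate (spinRot (s * t)) = _
    rw [map_mul, FrameBundle.rotate_mul]
    rfl) (by
    change (s * t)⁻¹ * b.1.2 = t⁻¹ * (s⁻¹ * b.1.2)
    rw [mul_inv_rev, mul_assoc]))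

theorem frameProjects_circ (t : Circle) (b : RotatedFrames hf) :
    FrameProjects f ((hf.circ t b.1.1).rotate (spinRot b.1.2)) (down hf b) := by
  rw [← hf.circ_rotate]
  exact (frameProjects_down hf b).circ hf t

/-- The action of `S¹` by differentials. -/
def circ (t : Circle) (b : RotatedFrames hf) : RotatedFrames hf :=
  ⟨(hf.circ t b.1.1, b.1.2), _, frameProjects_circ hf t b⟩

theorem continuous_circ : Continuous fun p : Circle × RotatedFrames hf => circ hf p.1 p.2 := by
  have h : Continuous fun p : Circle × RotatedFrames hf => p.2.1 :=
    continuous_subtype_val.comp continuous_snd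
  exact Continuous.subtype_mk ((hf.continuous_circ.comp (continuous_fst.prodMk
    (continuous_fst.comp h))).prodMk (continuous_snd.comp h)) _

theorem down_circ (t : Circle) (b : RotatedFrames hf) : down hf (circ hf t b) = down hf b :=
  down_eq hf (b := circ hf t b) (frameProjects_circ hf t b)

theorem circ_act (t : Circle) (b : RotatedFrames hf) (s : SpinGrp (n + 1)) :
    circ hf t (act hf b s) = act hf (circ hf t b) s :=
  Subtype.ext (Prod.ext (hf.circ_rotate _ _ _) rfl)

theorem circ_one (b : RotatedFrames hf) : circ hf 1 b = b :=
  Subtype.ext (Prod.ext (hf.circ_one _) rfl)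

theorem circ_mul (s t : Circle) (b : RotatedFrames hf) :
    circ hf (s * t) b = circ hf s (circ hf t b) :=
  Subtype.ext (Prod.ext (hf.circ_mul _ _ _) rfl)

/-- A frame that is adapted itself is rotated by the stabilizer. -/
theorem mem_of_adapted (b : RotatedFrames hf) {A : ON.FrameBundle} (h : FrameProjects f b.1.1 A) :
    b.1.2 ∈ spinStabilizer n := by
  refine inv_mem_iff.1 ?_
  have h1 := inv_mul_mem hf b (s := 1) (A := A) (by rwa [map_one, FrameBundle.rotate_one])
  rwa [mul_one] at h1

end RotatedFrames

variable {Q : ON.TopSpinStructure} {r : Q.P → spinStabilizer n → Q.P}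
  (hr : Q.IsStabilizerAction r)

/-- The pullback of a topological spin structure on the base to the rotated frames. -/
def RotatedSpinFrames (hf : IsCircleOrbibundle OM ON f) (_ : Q.IsStabilizerAction r) : Type u :=
  {q : RotatedFrames hf × Q.P // RotatedFrames.down hf q.1 = (Q.proj q.2).1}

namespace RotatedSpinFrames

instance : TopologicalSpace (RotatedSpinFrames hf hr) :=
  inferInstanceAs (TopologicalSpace {q : RotatedFrames hf × Q.P //
    RotatedFrames.down hf q.1 = (Q.proj q.2).1})

/-- The projection of the pullback. -/
def base (z : RotatedSpinFrames hf hr) : RotatedFrames hf := z.1.1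

theorem isCoveringMap_base : IsCoveringMap (base hf hr) :=
  isCoveringMap_pullback Q.isCoveringMap_frame two_ne_zero Q.ncard_fiber_frame
    (RotatedFrames.continuous_down hf)

theorem ncard_fiber_base (b : RotatedFrames hf) : (base hf hr ⁻¹' {b}).ncard = 2 :=
  ncard_fiber_pullback (ϖ := fun y : Q.P => (Q.proj y).1) two_ne_zero Q.ncard_fiber_frame
    (RotatedFrames.continuous_down hf) b

instance : MulAction (spinStabilizer n) (RotatedSpinFrames hf hr) where
  smul k z := ⟨(k • z.1.1, r z.1.2 k⁻¹), by
    rw [RotatedFrames.down_smul, hr.proj, z.2]⟩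
  one_smul z := Subtype.ext (Prod.ext (one_smul _ _) (by
    change r z.1.2 1⁻¹ = z.1.2
    rw [inv_one, hr.one]))
  mul_smul k l z := Subtype.ext (Prod.ext (mul_smul _ _ _) (by
    change r z.1.2 (k * l)⁻¹ = r (r z.1.2 l⁻¹) k⁻¹
    rw [mul_inv_rev, hr.mul]))

theorem base_smul (k : spinStabilizer n) (z : RotatedSpinFrames hf hr) :
    base hf hr (k • z) = k • base hf hr z := rfl

instance : ContinuousSMul (spinStabilizer n) (RotatedSpinFrames hf hr) where
  continuous_smul := by
    have h2 : Continuous fun p : spinStabilizer n × RotatedSpinFrames hf hr => p.2.1 :=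
      continuous_subtype_val.comp continuous_snd
    have h3 : Continuous fun p : spinStabilizer n × RotatedSpinFrames hf hr => p.2.1.1.1 :=
      continuous_subtype_val.comp (continuous_fst.comp h2)
    have h4 : Continuous fun p : spinStabilizer n × RotatedSpinFrames hf hr => p.1⁻¹ :=
      continuous_fst.inv
    refine Continuous.subtype_mk (Continuous.prodMk (Continuous.subtype_mk
      ((continuous_fst.comp h3).prodMk ((continuous_snd.comp h3).mul
        (continuous_subtype_val.comp h4))) _) ?_) _
    exact hr.continuous.comp ((continuous_snd.comp h2).prodMk h4)

/-- The action of `Spin(n+1)` on the pullback. -/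
def act (z : RotatedSpinFrames hf hr) (s : SpinGrp (n + 1)) : RotatedSpinFrames hf hr :=
  ⟨(z.1.1.act hf s, z.1.2), by rw [RotatedFrames.down_act, z.2]⟩

/-- The action of `S¹` on the pullback. -/
def circ (t : Circle) (z : RotatedSpinFrames hf hr) : RotatedSpinFrames hf hr :=
  ⟨(z.1.1.circ hf t, z.1.2), by rw [RotatedFrames.down_circ, z.2]⟩

theorem continuous_act : Continuous fun p : RotatedSpinFrames hf hr × SpinGrp (n + 1) =>
    act hf hr p.1 p.2 := by
  have h : Continuous fun p : RotatedSpinFrames hf hr × SpinGrp (n + 1) => p.1.1 :=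
    continuous_subtype_val.comp continuous_fst
  exact Continuous.subtype_mk (((RotatedFrames.continuous_act hf).comp
    ((continuous_fst.comp h).prodMk continuous_snd)).prodMk (continuous_snd.comp h)) _

theorem continuous_circ : Continuous fun p : RotatedSpinFrames hf hr × Circle =>
    circ hf hr p.2 p.1 := by
  have h : Continuous fun p : RotatedSpinFrames hf hr × Circle => p.1.1 :=
    continuous_subtype_val.comp continuous_fst
  exact Continuous.subtype_mk (((RotatedFrames.continuous_circ hf).comp
    (continuous_snd.prodMk (continuous_fst.comp h))).prodMk (continuous_snd.comp h)) _

theorem act_smul (k : spinStabilizer n) (z : RotatedSpinFrames hf hr) (s : SpinGrp (n + 1)) :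
    act hf hr (k • z) s = k • act hf hr z s :=
  Subtype.ext (Prod.ext (RotatedFrames.act_smul hf k z.1.1 s) rfl)

theorem circ_smul (k : spinStabilizer n) (t : Circle) (z : RotatedSpinFrames hf hr) :
    circ hf hr t (k • z) = k • circ hf hr t z := rfl

end RotatedSpinFrames

/-- The spin structure on the total space, as a quotient of the pullback of the spin structure of
the base to the rotated frames. -/
abbrev LiftedSpin : Type u :=
  Quotient (MulAction.orbitRel (spinStabilizer n) (RotatedSpinFrames hf hr))

namespace LiftedSpin

/-- The class of a point of the pullback. -/
def mk (z : RotatedSpinFrames hf hr) : LiftedSpin hf hr := Quotient.mk _ z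

/-- The projection of the quotient to the frames of the total space. -/
def proj : LiftedSpin hf hr → OM.FrameBundle :=
  orbitMap (RotatedSpinFrames.base_smul hf hr) (RotatedFrames.frame_smul hf)

theorem exists_localPullback (B : OM.FrameBundle) : ∃ W : Set OM.FrameBundle, IsOpen W ∧ B ∈ W ∧
    Nonempty (LocalPullback (proj hf hr) (RotatedSpinFrames.base hf hr) W) := by
  obtain ⟨V, hV, hB, σ, δ, h1, h2, h3, h4⟩ := RotatedFrames.exists_trivialization hf B
  exact ⟨V, hV, hB, nonempty_orbit_localPullback
    (RotatedSpinFrames.isCoveringMap_base hf hr).continuous (RotatedSpinFrames.base_smul hf hr)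
    (RotatedFrames.frame_smul hf) (RotatedFrames.smul_free hf) h1 h2 h3 h4⟩

/-- The action of `Spin(n+1)` on the quotient. -/
def act (x : LiftedSpin hf hr) (s : SpinGrp (n + 1)) : LiftedSpin hf hr :=
  Quotient.map (fun z => RotatedSpinFrames.act hf hr z s) (fun z z' h => by
    obtain ⟨g, rfl⟩ := MulAction.orbitRel_apply.1 h
    exact MulAction.orbitRel_apply.2 ⟨_, (RotatedSpinFrames.act_smul hf hr g z' s).symm⟩) x

/-- The action of `S¹` on the quotient. -/
def circ (t : Circle) (x : LiftedSpin hf hr) : LiftedSpin hf hr :=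
  Quotient.map (RotatedSpinFrames.circ hf hr t) (fun z z' h => by
    obtain ⟨g, rfl⟩ := MulAction.orbitRel_apply.1 h
    exact MulAction.orbitRel_apply.2 ⟨_, (RotatedSpinFrames.circ_smul hf hr g t z').symm⟩) x

/-- The topological spin structure on the total space that is induced by one on the base. -/
def topSpinStructure : OM.TopSpinStructure where
  P := LiftedSpin hf hr
  proj x := ⟨proj hf hr x, mem_univ _⟩
  isCoveringMap := (isCoveringMap_of_localPullback (continuous_orbitMap _ _
    (RotatedSpinFrames.isCoveringMap_base hf hr).continuous (RotatedFrames.continuous_frame hf))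
    (RotatedSpinFrames.isCoveringMap_base hf hr)
    (exists_localPullback hf hr)).homeomorph_comp (Homeomorph.Set.univ _).symm
  two_sheeted B := by
    rw [ncard_fiber_univ]
    exact ncard_fiber_of_localPullback (RotatedSpinFrames.ncard_fiber_base hf hr)
      (exists_localPullback hf hr) B.1
  act := act hf hr
  continuous_act := continuous_orbit_map₂ (RotatedSpinFrames.continuous_act hf hr) fun _ _ => rfl
  act_one x := by
    induction x using Quotient.inductionOn with | h z => ?_
    exact congrArg (mk hf hr) (Subtype.ext (Prod.ext (RotatedFrames.act_one hf z.1.1) rfl))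
  act_mul x s t := by
    induction x using Quotient.inductionOn with | h z => ?_
    exact congrArg (mk hf hr) (Subtype.ext (Prod.ext (RotatedFrames.act_mul hf z.1.1 s t) rfl))
  equivariant x s R h := by
    rw [isSpinImage_iff.1 h]
    induction x using Quotient.inductionOn with | h z => ?_
    rfl
  free x s h he := by
    induction x using Quotient.inductionOn with | h z => ?_
    have h1 : spinRot s = 1 := (isSpinImage_iff.1 h).symm
    obtain ⟨k, hk⟩ := MulAction.orbitRel_apply.1 (Quotient.exact he)
    -- the classes agree through an element `k` of the stabilizer that rotates by the identity
    have h2 : z.1.1.1.2 * (k⁻¹).1 = s⁻¹ * z.1.1.1.2 :=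
      congrArg (fun z : RotatedSpinFrames hf hr => z.1.1.1.2) hk
    have h3 : r z.1.2 k⁻¹ = z.1.2 := congrArg (fun z : RotatedSpinFrames hf hr => z.1.2) hk
    have h4 : spinRot (k⁻¹).1 = 1 := by
      have := congrArg spinRot h2
      rwa [map_mul, map_mul, map_inv, h1, inv_one, one_mul, mul_eq_left] at this
    rw [hr.free _ _ h4 h3] at h2
    have h5 : z.1.1.1.2 * 1 = s⁻¹ * z.1.1.1.2 := h2
    rwa [mul_one, right_eq_mul, inv_eq_one] at h5

/-- The lift of the circle action to the induced spin structure. -/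
def circleLift : CircleLift (topSpinStructure hf hr) where
  κ := circ hf hr
  continuous_κ := (continuous_orbit_map₂ (F' := fun x t => circ hf hr t x)
    (RotatedSpinFrames.continuous_circ hf hr) fun _ _ => rfl).comp continuous_swap
  κ_one x := by
    induction x using Quotient.inductionOn with | h z => ?_
    exact congrArg (mk hf hr) (Subtype.ext (Prod.ext (RotatedFrames.circ_one hf z.1.1) rfl))
  κ_mul s t x := by
    induction x using Quotient.inductionOn with | h z => ?_
    exact congrArg (mk hf hr) (Subtype.ext (Prod.ext (RotatedFrames.circ_mul hf s t z.1.1) rfl))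
  κ_act t x s := by
    induction x using Quotient.inductionOn with | h z => ?_
    exact congrArg (mk hf hr) (Subtype.ext (Prod.ext (RotatedFrames.circ_act hf t z.1.1 s) rfl))
  covers t x := hf.pushFrame_iff.2 (by
    induction x using Quotient.inductionOn with | h z => ?_
    rfl)

/-- Over an adapted frame, a point of the pullback determines one of the spin structure of the
base. -/
def downFun (z : RotatedSpinFrames hf hr) (hz : z.1.1.1.2 ∈ spinStabilizer n) : Q.P :=
  r z.1.2 ⟨_, hz⟩⁻¹

theorem downFun_smul (k : spinStabilizer n) (z : RotatedSpinFrames hf hr)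
    (hz : z.1.1.1.2 ∈ spinStabilizer n) (hz' : (k • z).1.1.1.2 ∈ spinStabilizer n) :
    downFun hf hr (k • z) hz' = downFun hf hr z hz := by
  have h : (⟨(k • z).1.1.1.2, hz'⟩ : spinStabilizer n) = ⟨z.1.1.1.2, hz⟩ * k⁻¹ := rfl
  change r (r z.1.2 k⁻¹) (⟨(k • z).1.1.1.2, hz'⟩ : spinStabilizer n)⁻¹ = _
  rw [h, ← hr.mul, mul_inv_rev, inv_inv, inv_mul_cancel_left]
  rfl

theorem downFun_eq_of_mk {z z' : RotatedSpinFrames hf hr} (h : mk hf hr z = mk hf hr z')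
    (hz : z.1.1.1.2 ∈ spinStabilizer n) (hz' : z'.1.1.1.2 ∈ spinStabilizer n) :
    downFun hf hr z hz = downFun hf hr z' hz' := by
  obtain ⟨k, rfl⟩ := MulAction.orbitRel_apply.1 (Quotient.exact h)
  exact downFun_smul hf hr k z' hz' hz

theorem frameProjects_downFun (z : RotatedSpinFrames hf hr)
    (hz : z.1.1.1.2 ∈ spinStabilizer n) :
    FrameProjects f z.1.1.1.1 (Q.proj (downFun hf hr z hz)).1 := by
  have h := RotatedFrames.frameProjects_stabilizer hf z.1.1 ⟨_, hz⟩⁻¹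
  have e : z.1.1.1.2 * ((⟨z.1.1.1.2, hz⟩ : spinStabilizer n)⁻¹).1 = 1 := mul_inv_cancel _
  rw [e, map_one, FrameBundle.rotate_one, z.2] at h
  rwa [downFun, hr.proj]

/-- A point over an adapted frame is determined by the frame and its image in the spin structure
of the base. -/
theorem mk_eq_of_downFun {z z' : RotatedSpinFrames hf hr} (hz : z.1.1.1.2 ∈ spinStabilizer n)
    (hz' : z'.1.1.1.2 ∈ spinStabilizer n) (h : z.1.1.1.1 = z'.1.1.1.1)
    (hd : downFun hf hr z hz = downFun hf hr z' hz') : mk hf hr z = mk hf hr z' := by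
  let a : spinStabilizer n := ⟨_, hz⟩
  let a' : spinStabilizer n := ⟨_, hz'⟩
  have hd : r z.1.2 a⁻¹ = r z'.1.2 a'⁻¹ := hd
  refine Quotient.sound (MulAction.orbitRel_apply.2 ⟨a⁻¹ * a', Subtype.ext (Prod.ext
    (Subtype.ext (Prod.ext h.symm ?_)) ?_)⟩)
  · change z'.1.1.1.2 * (z.1.1.1.2⁻¹ * z'.1.1.1.2)⁻¹ = z.1.1.1.2
    rw [mul_inv_rev, inv_inv, mul_inv_cancel_left]
  · change r z'.1.2 (a⁻¹ * a')⁻¹ = z.1.2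
    rw [mul_inv_rev, inv_inv, hr.mul, ← hd, ← hr.mul, inv_mul_cancel, hr.one]

theorem mem_stabilizer (z : RotatedSpinFrames hf hr)
    (h : ∃ A : ON.FrameBundle, FrameProjects f (proj hf hr (mk hf hr z)) A) :
    z.1.1.1.2 ∈ spinStabilizer n :=
  RotatedFrames.mem_of_adapted hf z.1.1 h.choose_spec

theorem topInduces : TopInduces f (topSpinStructure hf hr) (circleLift hf hr) Q := by
  let T : Set (LiftedSpin hf hr) := {x | ∃ A : ON.FrameBundle, FrameProjects f (proj hf hr x) A}
  have hout : ∀ x : T, x.1.out.1.1.1.2 ∈ spinStabilizer n := fun x =>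
    mem_stabilizer hf hr _ (by
      have h : mk hf hr x.1.out = x.1 := x.1.out_eq
      rw [h]
      exact x.2)
  let Φ : T → Q.P := fun x => downFun hf hr x.1.out (hout x)
  have hΦ : ∀ z (hz : mk hf hr z ∈ T),
      Φ ⟨mk hf hr z, hz⟩ = downFun hf hr z (mem_stabilizer hf hr z hz) := fun z hz =>
    downFun_eq_of_mk hf hr (Quotient.out_eq _) _ _
  have hmk : IsOpenQuotientMap (mk hf hr) := MulAction.isOpenQuotientMap_quotientMk
  refine ⟨Φ, ?_, ?_, ?_, ?_, ?_⟩
  · change Continuous Φ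
    rw [← (hmk.restrict_preimage T).continuous_comp_iff]
    have h1 : Continuous fun z : mk hf hr ⁻¹' T =>
        downFun hf hr z.1 (mem_stabilizer hf hr z.1 z.2) := by
      have h2 : Continuous fun z : mk hf hr ⁻¹' T => z.1.1 :=
        continuous_subtype_val.comp continuous_subtype_val
      exact hr.continuous.comp ((continuous_snd.comp h2).prodMk (Continuous.inv
        (Continuous.subtype_mk (continuous_snd.comp (continuous_subtype_val.comp
          (continuous_fst.comp h2))) _)))
    exact h1.congr fun z => (hΦ z.1 z.2).symm
  · rintro ⟨x, hx⟩
    induction x using Quotient.inductionOn with | h z => ?_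
    have h := frameProjects_downFun hf hr z (mem_stabilizer hf hr z hx)
    rw [← hΦ z hx] at h
    exact h
  · rintro ⟨x, hx⟩ ⟨x', hx'⟩ h h'
    induction x using Quotient.inductionOn with | h z => ?_
    induction x' using Quotient.inductionOn with | h z' => ?_
    exact Subtype.ext (mk_eq_of_downFun hf hr (mem_stabilizer hf hr z hx)
      (mem_stabilizer hf hr z' hx') (congrArg Subtype.val h)
      ((hΦ z hx).symm.trans (h'.trans (hΦ z' hx'))))
  · rintro ⟨x, hx⟩ ⟨x', hx'⟩ t h
    have h : x' = circ hf hr t x := h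
    subst h
    induction x using Quotient.inductionOn with | h z => ?_
    exact (hΦ (z.circ hf hr t) hx').trans (hΦ z hx).symm
  · rintro ⟨x, hx⟩ ⟨x', hx'⟩ s h
    have h : x' = act hf hr x (spinIncl n s) := h
    subst h
    induction x using Quotient.inductionOn with | h z => ?_
    refine (hΦ (z.act hf hr (spinIncl n s)) hx').trans
      (Eq.trans ?_ (congrArg (fun y => Q.act y s) (hΦ z hx)).symm)
    let a : spinStabilizer n := ⟨_, mem_stabilizer hf hr z hx⟩
    change r z.1.2 ((spinToStabilizer s)⁻¹ * a)⁻¹ = Q.act (r z.1.2 a⁻¹) s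
    rw [mul_inv_rev, inv_inv, hr.mul, hr.act]

end LiftedSpin

end Lift

/-! ### The correspondence of spin structures -/

theorem proposition3p3 {n : ℕ} {M N : Type u} [TopologicalSpace M] [T2Space M]
    [ParacompactSpace M] [TopologicalSpace N] [T2Space N] [ParacompactSpace N]
    [MulAction Circle M] [ContinuousSMul Circle M]
    (OM : OrientedOrbifold (n + 1) M) (ON : OrientedOrbifold n N)
    (g : OM.Metric) (h : ON.Metric) (f : M → N) (hf : IsCircleOrbibundle OM ON f) :
    (∀ P : OM.SpinStructure g, OrientedOrbifold.SpinStructure.IsProjectable P →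
      ∃ P' : ON.SpinStructure h, SpinInduces f P P') ∧
    (∀ P' : ON.SpinStructure h, ∃ P : OM.SpinStructure g,
      OrientedOrbifold.SpinStructure.IsProjectable P ∧ SpinInduces f P P') := by
  constructor
  · rintro P ⟨Q, hQ, ⟨κ⟩⟩
    exact ⟨SpinCover.restrict h (DescendedSpin.topSpinStructure hf κ), Q, κ, _, hQ,
      SpinCover.extends_restrict h _, DescendedSpin.topInduces hf κ⟩
  · intro P'
    obtain ⟨r, hr⟩ := (SpinCover.extend P').exists_isStabilizerAction
    have hQ := SpinCover.extends_restrict g (LiftedSpin.topSpinStructure hf hr)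
    exact ⟨_, ⟨_, hQ, ⟨LiftedSpin.circleLift hf hr⟩⟩, _, LiftedSpin.circleLift hf hr, _, hQ,
      SpinCover.extends_extend P', LiftedSpin.topInduces hf hr⟩
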